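/- Write $z_1=x+iy$, and let $\Omega\subset\mathbb{C}^3$ be the set where $-\operatorname{Im}z_3+P(z_1,z_2)+Q(z_1,z_2)<0$, with $$P(z_1,z_2)=2x|z_2|^2-xy^4,$$ $$Q(z_1,z_2)=\tfrac13(x^2+|z_2|^2)^3+(x^2+|z_2|^2)^2y^2-\tfrac1{60}x^6+\tfrac14x^4y^2-\tfrac14x^2y^4+\tfrac1{60}y^6 .$$ Definitions. Let $2\le m\le\infty$. A uniformly $C^m$ defining function for a domain $D\subset\mathbb{C}^n$ is a function $\rho:\mathbb{C}^n\to\mathbb{R}$ with $D=\{\rho<0\}$ and $bD=\{\rho=0\}$ such that some open neighborhood $U$ of $bD$ satisfies $\operatorname{dist}(bD,bU)>0$, $\|\rho\|_{C^m(U)}<\infty$ (for $m=\infty$: the derivatives of each order are bounded on $U$) and $\inf_U|\nabla\rho|>0$. Write $\rho_j=\partial\rho/\partial z_j$ and $\rho_{j\bar k}=\partial^2\rho/\partial z_j\partial\bar z_k$, and let $\mu_1\le\dots\le\mu_{n-1}$ be the eigenvalues of the Levi form, that is, of the hermitian form $L\mapsto\sum_{j,k}\rho_{j\bar k}L^j\overline{L^k}$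 on $\{L\in\mathbb{C}^n:\sum_j\rho_jL^j=0\}$ with the Euclidean inner product. For $1\le q\le n-1$, a hermitian matrix $\Upsilon=(\Upsilon^{\bar kj})$ of functions on $bD$ that are uniformly bounded in $C^{m-1}$ (i.e. that extend to a neighborhood $U$ of $bD$ with $\operatorname{dist}(bD,bU)>0$ with finite $C^{m-1}(U)$ norm) is admissible for weak $Z(q)$ if on $bD$ we have $\sum_j\Upsilon^{\bar kj}\rho_j=0$ for every $k$ and (i) all eigenvalues of $\Upsilon$ lie in $[0,1]$; (ii) $\mu_1+\dots+\mu_q-\sum_{j,k}\Upsilon^{\bar kj}\rho_{j\bar k}\ge0$; (iii) $\inf_{bD}|q-\operatorname{Tr}\Upsilon|>0$. The domain satisfies weak $Z(q)$ if an admissible $\Upsilon$ exists, and it is $1$-pseudoconvex if there is a $\Upsilon$, admissible for weak $Z(2)$, whose eigenvalues at every boundary point all belong to $\{0,1\}$. Proposition. The set $\Omega$ is a domain, it has a uniformly $C^\infty$ defining function, and it satisfies weak $Z(2)$ (with an admissible $\Upsilon$ uniformly bounded in $C^\infty$). There is a closed unbounded set $K\subset b\Omega$ such that for every $2\le m\le\infty$,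 every uniformly $C^m$ defining function for $\Omega$, and every corresponding $\Upsilon$ admissible for weak $Z(2)$: at each point of $K$ exactly one eigenvalue of $\Upsilon$, counted with multiplicity, equals one, while every neighborhood of $K$ contains points of $b\Omega$ at which no eigenvalue of $\Upsilon$ equals one. In particular $\Omega$ is not $1$-pseudoconvex, for any $2\le m\le\infty$. -/

import Mathlib

open Complex

/-- The space `ℂⁿ` with its Euclidean norm. -/
abbrev Cn (n : ℕ) : Type := EuclideanSpace ℂ (Fin n)

noncomputable section

/-! ### Wirtinger derivatives -/

/-- `∂f/∂z_j = (∂f/∂x_j - i ∂f/∂y_j) / 2`. -/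
def dz {n : ℕ} (j : Fin n) (f : Cn n → ℂ) (z : Cn n) : ℂ :=
  (1 / 2) * (fderiv ℝ f z (EuclideanSpace.single j 1) -
    I * fderiv ℝ f z (EuclideanSpace.single j I))

/-- `∂f/∂z̄_k = (∂f/∂x_k + i ∂f/∂y_k) / 2`. -/
def dzbar {n : ℕ} (k : Fin n) (f : Cn n → ℂ) (z : Cn n) : ℂ :=
  (1 / 2) * (fderiv ℝ f z (EuclideanSpace.single k 1) +
    I * fderiv ℝ f z (EuclideanSpace.single k I))

/-- `ρ_j = ∂ρ/∂z_j` for a real-valued function `ρ`, as a vector indexed by `j`. -/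
def complexGradient {n : ℕ} (ρ : Cn n → ℝ) (z : Cn n) : Fin n → ℂ :=
  fun j => dz j (fun w => (ρ w : ℂ)) z

/-- The complex Hessian: the `(j, k)` entry is `ρ_{j k̄} = ∂²ρ/∂z_j∂z̄_k`. -/
def complexHessian {n : ℕ} (ρ : Cn n → ℝ) (z : Cn n) : Matrix (Fin n) (Fin n) ℂ :=
  Matrix.of fun j k => dz j (dzbar k (fun w => (ρ w : ℂ))) z

/-! ### Uniform smoothness -/

/-- `U` is an open neighborhood of `S` with `dist(S, bU) > 0`. -/
def IsUniformNhd {n : ℕ} (U S : Set (Cn n)) : Prop :=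
  IsOpen U ∧ S ⊆ U ∧ ∃ r : ℝ, 0 < r ∧ ∀ p ∈ S, ∀ q ∈ frontier U, r ≤ dist p q

/-- `f` is of class `C^m` on the open set `U` with `‖f‖_{C^m(U)} < ∞`. For `m = ∞` this means
that all derivatives of `f`, of every order, are bounded on `U`. -/
def HasFiniteCmNorm {n : ℕ} {F : Type*} [NormedAddCommGroup F] [NormedSpace ℝ F]
    (m : ℕ∞) (f : Cn n → F) (U : Set (Cn n)) : Prop :=
  ContDiffOn ℝ (m : WithTop ℕ∞) f U ∧
    ∀ i : ℕ, (i : ℕ∞) ≤ m → ∃ C : ℝ, ∀ z ∈ U, ‖iteratedFDeriv ℝ i f z‖ ≤ C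

/-- `ρ` is a uniformly `C^m` defining function for `Ω`: it is negative exactly on `Ω`, vanishes
exactly on `bΩ`, and on some open neighborhood `U` of `bΩ` with `dist(bΩ, bU) > 0` its `C^m` norm
is finite and `inf_U |∇ρ| > 0`. (The operator norm of the real differential equals `|∇ρ|`.) -/
def IsUniformDefiningFunction {n : ℕ} (m : ℕ∞) (Ω : Set (Cn n)) (ρ : Cn n → ℝ) : Prop :=
  Ω = {z | ρ z < 0} ∧ frontier Ω = {z | ρ z = 0} ∧
    ∃ U : Set (Cn n), IsUniformNhd U (frontier Ω) ∧ HasFiniteCmNorm m ρ U ∧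
      ∃ c : ℝ, 0 < c ∧ ∀ z ∈ U, c ≤ ‖fderiv ℝ ρ z‖

/-- `f`, of which only the values on `bΩ` matter, is uniformly bounded in `C^k` on `bΩ`: it is the
restriction to `bΩ` of a function with finite `C^k` norm on a uniform neighborhood of `bΩ`. -/
def IsUniformlyCkOnBoundary {n : ℕ} (k : ℕ∞) (Ω : Set (Cn n)) (f : Cn n → ℂ) : Prop :=
  ∃ (U : Set (Cn n)) (g : Cn n → ℂ), IsUniformNhd U (frontier Ω) ∧ HasFiniteCmNorm k g U ∧
    Set.EqOn g f (frontier Ω)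

/-! ### The Levi form and weak `Z(q)` -/

/-- `μ_1 ≤ ⋯ ≤ μ_{n-1}` are the eigenvalues, in increasing order and with multiplicity, of the
Levi form of `ρ` at `z`, i.e. of the hermitian form `L ↦ ∑ ρ_{j k̄} L^j conj(L^k)` on
`T^{1,0}_z = {L | ∑ ρ_j L^j = 0}` with respect to the Euclidean hermitian inner product:
there is an orthonormal basis of `T^{1,0}_z` in which this form is diagonal with entries `μ_a`. -/
def IsLeviEigenvalues {n : ℕ} (ρ : Cn n → ℝ) (z : Cn n) (μ : Fin (n - 1) → ℝ) : Prop :=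
  Monotone μ ∧ ∃ u : Fin (n - 1) → Cn n, Orthonormal ℂ u ∧
    (∀ a, ∑ j, complexGradient ρ z j * u a j = 0) ∧
    ∀ a b, ∑ j, ∑ k, complexHessian ρ z j k * u a j * (starRingEnd ℂ) (u b k) =
      if a = b then (μ a : ℂ) else 0

/-- `Υ` satisfies the requirements of weak `Z(q)` for `Ω` with respect to the (uniformly `C^m`)
defining function `ρ`. The entry `Υ z k j` is `Υ^{k̄ j}(z)`, and only `z ∈ bΩ` matters. The Levi
form and the `ρ_{j k̄}` in the third clause are those of the same `ρ`; as `Υ` is tangential, this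
clause is not affected by multiplying `ρ` by a positive function, in particular by normalizing
`ρ` so that `|dρ| = 1` on `bΩ`. -/
structure IsAdmissible {n : ℕ} (m : ℕ∞) (q : ℕ) (Ω : Set (Cn n)) (ρ : Cn n → ℝ)
    (Υ : Cn n → Matrix (Fin n) (Fin n) ℂ) : Prop where
  /-- the entries are uniformly bounded in `C^{m-1}` on `bΩ` -/
  uniformly_bounded : ∀ k j, IsUniformlyCkOnBoundary (m - 1) Ω (fun z => Υ z k j)
  /-- `∑_j Υ^{k̄ j} ρ_j = 0` on `bΩ` -/
  tangential : ∀ z ∈ frontier Ω, ∀ k, ∑ j, Υ z k j * complexGradient ρ z j = 0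
  /-- `Υ` is hermitian with all eigenvalues in `[0, 1]` -/
  hermitian_eigenvalues : ∀ z ∈ frontier Ω,
    ∃ h : (Υ z).IsHermitian, ∀ i, h.eigenvalues i ∈ Set.Icc (0 : ℝ) 1
  /-- `μ_1 + ⋯ + μ_q - ∑_{j,k} Υ^{k̄ j} ρ_{j k̄} ≥ 0` -/
  levi_nonneg : ∀ z ∈ frontier Ω, ∃ μ : Fin (n - 1) → ℝ, IsLeviEigenvalues ρ z μ ∧
    0 ≤ (∑ i with i.val < q, μ i) - (∑ j, ∑ k, Υ z k j * complexHessian ρ z j k).re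
  /-- `inf_{bΩ} |q - Tr Υ| > 0` -/
  trace_ne : ∃ c : ℝ, 0 < c ∧ ∀ z ∈ frontier Ω, c ≤ ‖(q : ℂ) - (Υ z).trace‖

/-- `Ω` has a uniformly `C^m` defining function and satisfies `Z(q)` weakly. -/
def WeakZ {n : ℕ} (m : ℕ∞) (q : ℕ) (Ω : Set (Cn n)) : Prop :=
  ∃ ρ : Cn n → ℝ, IsUniformDefiningFunction m Ω ρ ∧
    ∃ Υ : Cn n → Matrix (Fin n) (Fin n) ℂ, IsAdmissible m q Ω ρ Υ

/-- `Ω` is `1`-pseudoconvex (in the class `C^m`): some `Υ` satisfies the requirements of weak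
`Z(2)` and has only the eigenvalues `0` and `1` at every boundary point. -/
def IsOnePseudoconvex {n : ℕ} (m : ℕ∞) (Ω : Set (Cn n)) : Prop :=
  ∃ ρ : Cn n → ℝ, IsUniformDefiningFunction m Ω ρ ∧
    ∃ Υ : Cn n → Matrix (Fin n) (Fin n) ℂ, IsAdmissible m 2 Ω ρ Υ ∧
      ∀ z ∈ frontier Ω, ∀ c : ℂ,
        Module.End.HasEigenvalue (Matrix.toLin' (Υ z)) c → c = 0 ∨ c = 1

/-! ### The example (coordinates `z_1, z_2, z_3` are `z 0, z 1, z 2`) -/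

/-- `P(z_1, z_2) = 2 x |z_2|² - x y⁴`, where `z_1 = x + i y`. -/
def exampleP (z₁ z₂ : ℂ) : ℝ := 2 * z₁.re * ‖z₂‖ ^ 2 - z₁.re * z₁.im ^ 4

/-- `Q(z_1, z_2) = (x² + |z_2|²)³ / 3 + (x² + |z_2|²)² y² - x⁶ / 60 + x⁴ y² / 4 - x² y⁴ / 4
+ y⁶ / 60`, where `z_1 = x + i y`. -/
def exampleQ (z₁ z₂ : ℂ) : ℝ :=
  (1 / 3) * (z₁.re ^ 2 + ‖z₂‖ ^ 2) ^ 3 + (z₁.re ^ 2 + ‖z₂‖ ^ 2) ^ 2 * z₁.im ^ 2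
    - (1 / 60) * z₁.re ^ 6 + (1 / 4) * z₁.re ^ 4 * z₁.im ^ 2
    - (1 / 4) * z₁.re ^ 2 * z₁.im ^ 4 + (1 / 60) * z₁.im ^ 6

/-- The domain `{z ∈ ℂ³ | -Im z_3 + P(z_1, z_2) + Q(z_1, z_2) < 0}`. -/
def exampleDomain : Set (Cn 3) :=
  {z | -(z 2).im + exampleP (z 0) (z 1) + exampleQ (z 0) (z 1) < 0}

end

/-! ### Real-linear forms, Wirtinger coefficients and the Levi form as a real Hessian. -/

noncomputable section

/-! Let r = -Im z₃ + P + Q, s = x² + |z₂|², and let B be the orthogonal projection onto the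
complement of the complex gradient of r, minus Υ (`projSub`). Since q = 2 = n - 1, the sum μ₁ + μ₂
is the whole trace of the Levi form, so condition (ii) says exactly that the contraction of B with
the complex Hessian is nonnegative. Any other defining function changes this contraction on bΩ only
by a positive factor (`IsUniformDefiningFunction.exists_factor`, `IsLeviEigenvalues.sum_sub_eq`).
For r the contraction is B₀₀ H₁₁ + B₁₁ H₂₂ + 2 Re(B₁₀ H₁₂), where H is the 2 × 2 Hessian of P + Q.

Rigidity. H vanishes where x = z₂ = 0, and its linear part in (x, z₂) comes from P alone: H₁₁ ~
-3xy², H₂₂ ~ 2x, H₁₂ ~ z₂. A nonnegative quantity has no first-order term at a zero, so there B₁₀ =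
0 and 2B₁₁ = 3y²B₀₀ (`IsAdmissible.first_order`, `IsAdmissible.proj_axis`). Condition (iii) excludes
B = 0. The eigenvalue one of Υ corresponds to the kernel of B in the complement of the gradient,
hence has multiplicity one at y = 0 and does not occur for y ≠ 0. If all eigenvalues were 0 or 1,
then Υ = 0 at y = 1/2, B is the full projection, and 2B₁₁ = (3/4)B₀₀ fails.

Existence. The relation dictates the weights 2 and 3y² near the axis: 2H₁₁ + 3y²H₂₂ loses the terms
of P, and Q makes it at least 2s² + 2sy². For s ≥ 1 the plain trace H₁₁ + H₂₂ is nonnegative as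
well. A mixture of the two diagonal tensors, with weights made of (1 + s)⁻¹, therefore has
nonnegative contraction everywhere (`weighted_polyHess_nonneg`).

Uniformity. Q is homogeneous of degree six, bounded below by a multiple of (s + y²)³, so the
gradient of r grows exactly like the fifth power of the size of (z₁, z₂). The terms of Q without z₂
that are not powers of s or multiples of s² form -Re(z₁⁶)/60; they do not affect the Levi form but
provide this growth on the y-axis. Dividing by the fifth power of the bracket gives the uniform
defining function, and by the tenth power a tensor whose trace lies between positive constants. All
derivatives are bounded because the functions involved lie in algebras generated by bounded
functions and closed under partial derivatives (`ClosedUnderPartials.bounded_iteratedFDeriv`). -/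

theorem euclidean_eq_sum_single {n : ℕ} (L : Cn n) :
    L = ∑ j, EuclideanSpace.single j (L j) := by
  ext i
  simp [Finset.sum_apply]

theorem single_eq_re_im {n : ℕ} (j : Fin n) (c : ℂ) :
    (EuclideanSpace.single j c : Cn n) =
      c.re • EuclideanSpace.single j (1 : ℂ) + c.im • EuclideanSpace.single j I := by
  ext i
  by_cases h : i = j
  · subst h
    simp
  · simp [h]

theorem apply_single {n : ℕ} (φ : Cn n →L[ℝ] ℂ) (j : Fin n) (c : ℂ) :
    φ (EuclideanSpace.single j c) =
      c.re * φ (EuclideanSpace.single j 1) + c.im * φ (EuclideanSpace.single j I) := by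
  rw [single_eq_re_im, map_add, map_smul, map_smul]
  simp

/-- The `ℂ`-linear part of a real-linear form, in terms of its Wirtinger coefficients. -/
theorem sum_holomorphic_part {n : ℕ} (φ : Cn n →L[ℝ] ℂ) (L : Cn n) :
    ∑ j, ((1 / 2) * (φ (EuclideanSpace.single j 1) - I * φ (EuclideanSpace.single j I))) * L j =
      (1 / 2) * (φ L - I * φ (I • L)) := by
  have h1 : φ L = ∑ j, φ (EuclideanSpace.single j (L j)) := by
    conv_lhs => rw [euclidean_eq_sum_single L, map_sum]
  have h2 : φ (I • L) = ∑ j, φ (EuclideanSpace.single j (I * L j)) := by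
    conv_lhs => rw [euclidean_eq_sum_single (I • L), map_sum]
    simp
  rw [h1, h2, Finset.mul_sum, ← Finset.sum_sub_distrib, Finset.mul_sum]
  refine Finset.sum_congr rfl fun j _ => ?_
  rw [apply_single φ j (L j), apply_single φ j (I * L j)]
  conv_lhs => rw [← re_add_im (L j)]
  simp only [mul_re, mul_im, I_re, I_im]
  push_cast
  linear_combination (-1 / 2 * (L j).im * φ (EuclideanSpace.single j I)) * I_sq

/-- The antilinear part of a real-linear form, in terms of its Wirtinger coefficients. -/
theorem sum_antiholomorphic_part {n : ℕ} (φ : Cn n →L[ℝ] ℂ) (L : Cn n) :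
    ∑ j, ((1 / 2) * (φ (EuclideanSpace.single j 1) + I * φ (EuclideanSpace.single j I))) *
        (starRingEnd ℂ) (L j) =
      (1 / 2) * (φ L + I * φ (I • L)) := by
  have h1 : φ L = ∑ j, φ (EuclideanSpace.single j (L j)) := by
    conv_lhs => rw [euclidean_eq_sum_single L, map_sum]
  have h2 : φ (I • L) = ∑ j, φ (EuclideanSpace.single j (I * L j)) := by
    conv_lhs => rw [euclidean_eq_sum_single (I • L), map_sum]
    simp
  rw [h1, h2, Finset.mul_sum, ← Finset.sum_add_distrib, Finset.mul_sum]
  refine Finset.sum_congr rfl fun j _ => ?_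
  rw [apply_single φ j (L j), apply_single φ j (I * L j)]
  conv_lhs => rw [← re_add_im (L j)]
  simp only [mul_re, mul_im, I_re, I_im, map_add, map_mul, conj_ofReal, conj_I]
  push_cast
  linear_combination (-1 / 2 * (L j).im * φ (EuclideanSpace.single j I)) * I_sq

theorem fderiv_ofReal_apply {n : ℕ} {ρ : Cn n → ℝ} {z : Cn n} (h : DifferentiableAt ℝ ρ z)
    (v : Cn n) : fderiv ℝ (fun w => (ρ w : ℂ)) z v = (fderiv ℝ ρ z v : ℂ) := by
  have := (ofRealCLM.hasFDerivAt.comp z h.hasFDerivAt).fderiv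
  change fderiv ℝ (ofRealCLM ∘ ρ) z v = _
  rw [this]
  simp

theorem sum_complexGradient_mul {n : ℕ} {ρ : Cn n → ℝ} {z : Cn n}
    (h : DifferentiableAt ℝ ρ z) (L : Cn n) :
    ∑ j, complexGradient ρ z j * L j =
      (1 / 2) * ((fderiv ℝ ρ z L : ℂ) - I * (fderiv ℝ ρ z (I • L) : ℂ)) := by
  rw [← fderiv_ofReal_apply h, ← fderiv_ofReal_apply h, ← sum_holomorphic_part]
  rfl

/-- The Levi form of `ρ` in terms of its real Hessian. -/
theorem sum_complexHessian_mul {n : ℕ} {ρ : Cn n → ℝ} {z : Cn n}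
    (h : ContDiffAt ℝ 2 ρ z) (L M : Cn n) :
    ∑ j, ∑ k, complexHessian ρ z j k * L j * (starRingEnd ℂ) (M k) =
      (1 / 4) * ((fderiv ℝ (fderiv ℝ ρ) z L M : ℂ) +
        (fderiv ℝ (fderiv ℝ ρ) z (I • L) (I • M) : ℂ) +
        I * ((fderiv ℝ (fderiv ℝ ρ) z L (I • M) : ℂ) -
          (fderiv ℝ (fderiv ℝ ρ) z (I • L) M : ℂ))) := by
  have hd : ∀ᶠ w in nhds z, DifferentiableAt ℝ ρ w := by
    filter_upwards [h.eventually (by simp)] with w hw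
    exact hw.differentiableAt (by norm_num)
  have hdd : DifferentiableAt ℝ (fderiv ℝ ρ) z :=
    (h.fderiv_right (m := 1) (by norm_num)).differentiableAt (by norm_num)
  have hA : ∀ v : Cn n, HasFDerivAt (fun w => (fderiv ℝ ρ w v : ℂ))
      (ofRealCLM.comp ((ContinuousLinearMap.apply ℝ ℝ v).comp (fderiv ℝ (fderiv ℝ ρ) z))) z :=
    fun v => ofRealCLM.hasFDerivAt.comp z
      ((ContinuousLinearMap.apply ℝ ℝ v).hasFDerivAt.comp z hdd.hasFDerivAt)
  have hB : ∀ k, HasFDerivAt (dzbar k (fun w => (ρ w : ℂ)))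
      ((1 / 2 : ℂ) • (ofRealCLM.comp ((ContinuousLinearMap.apply ℝ ℝ
          (EuclideanSpace.single k 1)).comp (fderiv ℝ (fderiv ℝ ρ) z)) +
        I • ofRealCLM.comp ((ContinuousLinearMap.apply ℝ ℝ
          (EuclideanSpace.single k I)).comp (fderiv ℝ (fderiv ℝ ρ) z)))) z := by
    intro k
    refine HasFDerivAt.congr_of_eventuallyEq (((hA _).add ((hA _).const_smul I)).const_smul
      (1 / 2 : ℂ)) ?_
    filter_upwards [hd] with w hw
    simp [dzbar, fderiv_ofReal_apply hw]
  have hC : ∀ j k, complexHessian ρ z j k = (1 / 2) *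
      ((1 / 2) * ((fderiv ℝ (fderiv ℝ ρ) z (EuclideanSpace.single j 1)
          (EuclideanSpace.single k 1) : ℂ) +
        I * (fderiv ℝ (fderiv ℝ ρ) z (EuclideanSpace.single j 1)
          (EuclideanSpace.single k I) : ℂ)) -
        I * ((1 / 2) * ((fderiv ℝ (fderiv ℝ ρ) z (EuclideanSpace.single j I)
          (EuclideanSpace.single k 1) : ℂ) +
        I * (fderiv ℝ (fderiv ℝ ρ) z (EuclideanSpace.single j I)
          (EuclideanSpace.single k I) : ℂ)))) := by
    intro j k
    simp only [complexHessian, Matrix.of_apply, dz]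
    rw [(hB k).fderiv]
    simp
    ring
  have hD : ∀ j, ∑ k, complexHessian ρ z j k * L j * (starRingEnd ℂ) (M k) =
      ((1 / 2) * (((1 / 2 : ℂ) • ((ofRealCLM.comp ((ContinuousLinearMap.apply ℝ ℝ M).comp
          (fderiv ℝ (fderiv ℝ ρ) z))) + I • (ofRealCLM.comp ((ContinuousLinearMap.apply ℝ ℝ
          (I • M)).comp (fderiv ℝ (fderiv ℝ ρ) z))))) (EuclideanSpace.single j 1) -
        I * ((1 / 2 : ℂ) • ((ofRealCLM.comp ((ContinuousLinearMap.apply ℝ ℝ M).comp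
          (fderiv ℝ (fderiv ℝ ρ) z))) + I • (ofRealCLM.comp ((ContinuousLinearMap.apply ℝ ℝ
          (I • M)).comp (fderiv ℝ (fderiv ℝ ρ) z)))))
            (EuclideanSpace.single j I))) * L j := by
    intro j
    have h1 := sum_antiholomorphic_part
      (ofRealCLM.comp (fderiv ℝ (fderiv ℝ ρ) z (EuclideanSpace.single j 1))) M
    have h2 := sum_antiholomorphic_part
      (ofRealCLM.comp (fderiv ℝ (fderiv ℝ ρ) z (EuclideanSpace.single j I))) M
    simp only [ContinuousLinearMap.comp_apply, ofRealCLM_apply] at h1 h2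
    simp only [ContinuousLinearMap.comp_apply, ofRealCLM_apply, add_apply,
      smul_apply, ContinuousLinearMap.apply_apply, smul_eq_mul]
    rw [← h1, ← h2, Finset.mul_sum, ← Finset.sum_sub_distrib, Finset.mul_sum, Finset.sum_mul]
    refine Finset.sum_congr rfl fun k _ => ?_
    rw [hC]
    ring
  simp_rw [hD]
  rw [sum_holomorphic_part]
  simp only [ContinuousLinearMap.comp_apply, ofRealCLM_apply, add_apply,
      smul_apply, ContinuousLinearMap.apply_apply, smul_eq_mul]
  linear_combination (-1 / 4 * (fderiv ℝ (fderiv ℝ ρ) z (I • L) (I • M) : ℂ)) * I_sq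

/-! ### Comparison of two functions vanishing on the same graph. -/

section Transfer

variable {E : Type*} [NormedAddCommGroup E] [NormedSpace ℝ E]

/-- If `ρ` vanishes on the zero set of `r`, which is a graph over the direction `e`, then the
first and the tangential second derivatives of `ρ` are multiples of those of `r`. -/
theorem fderiv_eq_of_zero_on_graph {r ρ : E → ℝ} {e z : E} (hr : ContDiff ℝ 2 r)
    (hre : ∀ w c, r (w + c • e) = r w - c) (hz : r z = 0) (hρz : ContDiffAt ℝ 2 ρ z)
    (hρ : ∀ w, r w = 0 → ρ w = 0) :
    (∀ ξ, fderiv ℝ ρ z ξ = -(fderiv ℝ ρ z e) * fderiv ℝ r z ξ) ∧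
    ∀ ξ η, fderiv ℝ r z ξ = 0 → fderiv ℝ r z η = 0 →
      fderiv ℝ (fderiv ℝ ρ) z η ξ = -(fderiv ℝ ρ z e) * fderiv ℝ (fderiv ℝ r) z η ξ := by
  have hrd : ∀ w, HasFDerivAt r (fderiv ℝ r w) w := fun w =>
    ((hr.differentiable (by norm_num)) w).hasFDerivAt
  have hrdd : HasFDerivAt (fderiv ℝ r) (fderiv ℝ (fderiv ℝ r) z) z :=
    ((hr.fderiv_right (m := 1) (by norm_num)).differentiable (by norm_num) z).hasFDerivAt
  -- The map w ↦ w + r(w)e projects onto the zero set of r along e, so ρ composed with it vanishes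
  -- identically. Both conclusions come from differentiating this identity, once and twice.
  have hπ : ∀ w, HasFDerivAt (fun w => w + r w • e)
      (ContinuousLinearMap.id ℝ E + (fderiv ℝ r w).smulRight e) w := fun w =>
    (hasFDerivAt_id w).add ((hrd w).smul_const e)
  have hπz : z + r z • e = z := by simp [hz]
  have h0 : ∀ w, ρ (w + r w • e) = 0 := fun w => hρ _ (by rw [hre]; ring)
  have hev : ∀ᶠ w in nhds z, DifferentiableAt ℝ ρ (w + r w • e) := by
    have h1 : ∀ᶠ w in nhds (z + r z • e), DifferentiableAt ℝ ρ w := by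
      rw [hπz]
      filter_upwards [hρz.eventually (by simp)] with w hw
      exact hw.differentiableAt (by norm_num)
    exact (hπ z).continuousAt.eventually h1
  have hρdd : HasFDerivAt (fderiv ℝ ρ) (fderiv ℝ (fderiv ℝ ρ) z) (z + r z • e) := by
    rw [hπz]
    exact ((hρz.fderiv_right (m := 1) (by norm_num)).differentiableAt (by norm_num)).hasFDerivAt
  have h1 : ∀ᶠ w in nhds z, ∀ ξ, fderiv ℝ ρ (w + r w • e) (ξ + fderiv ℝ r w ξ • e) = 0 := by
    filter_upwards [hev] with w hw ξ
    have h2 := hw.hasFDerivAt.comp w (hπ w)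
    have h3 : HasFDerivAt (ρ ∘ fun w => w + r w • e) (0 : E →L[ℝ] ℝ) w := by
      have : (ρ ∘ fun w => w + r w • e) = fun _ => 0 := funext h0
      rw [this]
      exact hasFDerivAt_const _ _
    have h4 := DFunLike.congr_fun (h2.unique h3) ξ
    simpa using h4
  constructor
  · intro ξ
    have h2 := h1.self_of_nhds ξ
    rw [hπz, map_add, map_smul, smul_eq_mul] at h2
    linarith
  · intro ξ η hξ hη
    have hL := hρdd.comp z (hπ z)
    have hv : HasFDerivAt (fun w => ξ + fderiv ℝ r w ξ • e)
        ((((ContinuousLinearMap.apply ℝ ℝ ξ).comp (fderiv ℝ (fderiv ℝ r) z))).smulRight e) z := by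
      refine HasFDerivAt.const_add ξ ?_
      exact ((ContinuousLinearMap.apply ℝ ℝ ξ).hasFDerivAt.comp z hrdd).smul_const e
    -- At z, for ξ and η in the kernel of dr, the corrections along e in both arguments of the
    -- Hessian of ρ vanish. What is left is D²ρ(η, ξ) + dρ(e) D²r(η, ξ) = 0.
    have h2 := hL.clm_apply hv
    have h3 : HasFDerivAt (fun w => (fderiv ℝ ρ ∘ fun w => w + r w • e) w
        (ξ + fderiv ℝ r w ξ • e)) (0 : E →L[ℝ] ℝ) z := by
      refine (hasFDerivAt_const (0 : ℝ) z).congr_of_eventuallyEq ?_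
      filter_upwards [h1] with w hw
      exact hw ξ
    have h4 := DFunLike.congr_fun (h2.unique h3) η
    simp [hz, hξ, hη] at h4
    linarith

end Transfer

/-! ### The defining function of the example -/

/-- The polynomial defining function of the example. -/
def exampleFun (z : Cn 3) : ℝ := -(z 2).im + exampleP (z 0) (z 1) + exampleQ (z 0) (z 1)

/-- The direction transversal to the boundary of the example. -/
def verticalDir : Cn 3 := EuclideanSpace.single 2 I

/-- The complex coordinates of `ℂ³`. -/
def complexCoord (j : Fin 3) : Cn 3 →L[ℂ] ℂ := EuclideanSpace.proj j

/-- The real coordinates of `ℂ³`. -/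
def realCoord : Fin 6 → Cn 3 →L[ℝ] ℝ
  | 0 => reCLM.comp ((complexCoord 0).restrictScalars ℝ)
  | 1 => imCLM.comp ((complexCoord 0).restrictScalars ℝ)
  | 2 => reCLM.comp ((complexCoord 1).restrictScalars ℝ)
  | 3 => imCLM.comp ((complexCoord 1).restrictScalars ℝ)
  | 4 => reCLM.comp ((complexCoord 2).restrictScalars ℝ)
  | 5 => imCLM.comp ((complexCoord 2).restrictScalars ℝ)

@[simp] theorem realCoord_zero (z : Cn 3) : realCoord 0 z = (z 0).re := rfl
@[simp] theorem realCoord_one (z : Cn 3) : realCoord 1 z = (z 0).im := rfl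
@[simp] theorem realCoord_two (z : Cn 3) : realCoord 2 z = (z 1).re := rfl
@[simp] theorem realCoord_three (z : Cn 3) : realCoord 3 z = (z 1).im := rfl
@[simp] theorem realCoord_four (z : Cn 3) : realCoord 4 z = (z 2).re := rfl
@[simp] theorem realCoord_five (z : Cn 3) : realCoord 5 z = (z 2).im := rfl

/-- `x² + |z₂|²` as a polynomial in the real coordinates. -/
def polyS (x u v : ℝ) : ℝ := x ^ 2 + u ^ 2 + v ^ 2

/-- `P + Q` as a polynomial in the real coordinates. -/
def polyF (x y u v : ℝ) : ℝ :=
  2 * x * (u ^ 2 + v ^ 2) - x * y ^ 4 + (1 / 3) * polyS x u v ^ 3 + polyS x u v ^ 2 * y ^ 2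
    - (1 / 60) * x ^ 6 + (1 / 4) * x ^ 4 * y ^ 2 - (1 / 4) * x ^ 2 * y ^ 4 + (1 / 60) * y ^ 6

/-- `∂(P + Q)/∂x`. -/
def polyFx (x y u v : ℝ) : ℝ :=
  2 * (u ^ 2 + v ^ 2) - y ^ 4 + 2 * x * polyS x u v ^ 2 + 4 * x * polyS x u v * y ^ 2
    - (1 / 10) * x ^ 5 + x ^ 3 * y ^ 2 - (1 / 2) * x * y ^ 4

/-- `∂(P + Q)/∂y`. -/
def polyFy (x y u v : ℝ) : ℝ :=
  -4 * x * y ^ 3 + 2 * polyS x u v ^ 2 * y + (1 / 2) * x ^ 4 * y - x ^ 2 * y ^ 3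
    + (1 / 10) * y ^ 5

/-- `∂(P + Q)/∂u = u * polyFw` and `∂(P + Q)/∂v = v * polyFw`, where `z₂ = u + iv`. -/
def polyFw (x y u v : ℝ) : ℝ := 4 * x + 2 * polyS x u v ^ 2 + 4 * polyS x u v * y ^ 2

theorem exampleFun_eq (z : Cn 3) :
    exampleFun z = -(z 2).im + polyF (z 0).re (z 0).im (z 1).re (z 1).im := by
  have h : ‖z 1‖ ^ 2 = (z 1).re ^ 2 + (z 1).im ^ 2 := by
    rw [Complex.sq_norm, Complex.normSq_apply]; ring
  simp only [exampleFun, exampleP, exampleQ, polyF, polyS, h]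
  ring

theorem exampleDomain_eq : exampleDomain = {z | exampleFun z < 0} := rfl

theorem exampleFun_add_vertical (w : Cn 3) (c : ℝ) :
    exampleFun (w + c • verticalDir) = exampleFun w - c := by
  simp [exampleFun, verticalDir]
  ring

theorem hasFDerivAt_exampleFun (z : Cn 3) :
    HasFDerivAt exampleFun
      (polyFx (z 0).re (z 0).im (z 1).re (z 1).im • realCoord 0 +
        polyFy (z 0).re (z 0).im (z 1).re (z 1).im • realCoord 1 +
        ((z 1).re * polyFw (z 0).re (z 0).im (z 1).re (z 1).im) • realCoord 2 +
        ((z 1).im * polyFw (z 0).re (z 0).im (z 1).re (z 1).im) • realCoord 3 -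
        realCoord 5) z := by
  have hx := (realCoord 0).hasFDerivAt (x := z)
  have hy := (realCoord 1).hasFDerivAt (x := z)
  have hu := (realCoord 2).hasFDerivAt (x := z)
  have hv := (realCoord 3).hasFDerivAt (x := z)
  have ht := (realCoord 5).hasFDerivAt (x := z)
  have hs := ((hx.pow 2).add (hu.pow 2)).add (hv.pow 2)
  have h := ht.neg.add ((((((((hx.const_mul 2).mul ((hu.pow 2).add (hv.pow 2))).sub
    (hx.mul (hy.pow 4))).add ((hs.pow 3).const_mul (1 / 3))).add
    ((hs.pow 2).mul (hy.pow 2))).sub ((hx.pow 6).const_mul (1 / 60))).add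
    (((hx.pow 4).const_mul (1 / 4)).mul (hy.pow 2))).sub
    (((hx.pow 2).const_mul (1 / 4)).mul (hy.pow 4)) |>.add ((hy.pow 6).const_mul (1 / 60)))
  refine (h.congr_fderiv ?_).congr_of_eventuallyEq (Filter.Eventually.of_forall fun w => ?_)
  · ext v
    simp [polyFx, polyFy, polyFw, polyS]
    ring
  · simp [exampleFun_eq, polyF, polyS]

theorem contDiff_exampleFun {n : WithTop ℕ∞} : ContDiff ℝ n exampleFun := by
  have h : exampleFun = fun z => -realCoord 5 z +
      polyF (realCoord 0 z) (realCoord 1 z) (realCoord 2 z) (realCoord 3 z) := by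
    funext z
    simp [exampleFun_eq]
  rw [h]
  unfold polyF polyS
  fun_prop

/-- From a zero of `exampleFun`, an arbitrarily small move along `verticalDir` enters the domain, so
the zero set has no points outside the closure. -/
theorem frontier_exampleDomain : frontier exampleDomain = {z | exampleFun z = 0} := by
  have hc : Continuous exampleFun := (contDiff_exampleFun (n := 0)).continuous
  refine Set.Subset.antisymm ?_ ?_
  · rw [exampleDomain_eq]
    exact frontier_lt_subset_eq hc continuous_const
  · intro z hz
    have ho : IsOpen exampleDomain := isOpen_lt hc continuous_const
    rw [ho.frontier_eq]
    refine ⟨?_, fun h => (ne_of_lt h) hz⟩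
    have ht : Filter.Tendsto (fun c : ℝ => z + c • verticalDir) (nhdsWithin 0 (Set.Ioi 0))
        (nhds z) := by
      have : Filter.Tendsto (fun c : ℝ => z + c • verticalDir) (nhds 0)
          (nhds (z + (0 : ℝ) • verticalDir)) := by
        apply Continuous.tendsto
        fun_prop
      simp only [zero_smul, add_zero] at this
      exact this.mono_left nhdsWithin_le_nhds
    refine mem_closure_of_tendsto ht ?_
    filter_upwards [self_mem_nhdsWithin] with c hc
    change exampleFun _ < 0
    rw [exampleFun_add_vertical, show exampleFun z = 0 from hz]
    simpa using hc

theorem isOpen_exampleDomain : IsOpen exampleDomain :=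
  isOpen_lt (contDiff_exampleFun (n := 0)).continuous continuous_const

/-- The domain is the image of the convex half-space Im z₃ > 0 under a continuous shear in the
vertical direction. -/
theorem isConnected_exampleDomain : IsConnected exampleDomain := by
  have h : exampleDomain = (fun z : Cn 3 => z + (exampleFun z + (z 2).im) • verticalDir) ''
      {z | 0 < (z 2).im} := by
    ext z
    constructor
    · intro hz
      refine ⟨z + (-(exampleFun z + (z 2).im)) • verticalDir, ?_, ?_⟩
      · have hz' : exampleFun z < 0 := hz
        simp [verticalDir]
        exact hz'
      · simp only [exampleFun_add_vertical]
        have h2 : ((z + (-(exampleFun z + (z 2).im)) • verticalDir) 2).im = -exampleFun z := by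
          simp [verticalDir]
        rw [h2, add_assoc, ← add_smul]
        simp
        left
        ring
    · rintro ⟨w, hw, rfl⟩
      change exampleFun _ < 0
      rw [exampleFun_add_vertical]
      have : 0 < (w 2).im := hw
      linarith
  rw [h]
  have him : Continuous fun z : Cn 3 => (z 2).im := (realCoord 5).continuous
  refine IsConnected.image ?_ _ ?_
  · refine Convex.isConnected ?_ ⟨verticalDir, by simp [verticalDir]⟩
    exact convex_halfSpace_gt (realCoord 5).toLinearMap.isLinear 0
  · have hc : Continuous exampleFun := (contDiff_exampleFun (n := 0)).continuous
    fun_prop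

/-! ### Complex gradient and complex Hessian of the example. -/

/-- The coefficient `(P + Q)_{1\bar 1}` of the complex Hessian. -/
def polyHess11 (x y u v : ℝ) : ℝ :=
  -3 * x * y ^ 2 + 2 * (polyS x u v + y ^ 2) * x ^ 2 + polyS x u v ^ 2 + polyS x u v * y ^ 2

/-- The coefficient `(P + Q)_{2\bar 2}` of the complex Hessian. -/
def polyHess22 (x y u v : ℝ) : ℝ :=
  2 * x + 2 * (polyS x u v + y ^ 2) * (u ^ 2 + v ^ 2) + polyS x u v ^ 2
    + 2 * polyS x u v * y ^ 2

/-- The coefficient `(P + Q)_{1\bar 2}` of the complex Hessian. -/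
def polyHess12 (x y u v : ℝ) : ℂ :=
  (u + v * I) * (1 + 2 * (polyS x u v + y ^ 2) * x - 2 * polyS x u v * y * I)

/-- The complex gradient of `exampleFun`. -/
def exampleGrad (z : Cn 3) : Fin 3 → ℂ :=
  ![(1 / 2) * ((polyFx (z 0).re (z 0).im (z 1).re (z 1).im : ℂ) -
      I * (polyFy (z 0).re (z 0).im (z 1).re (z 1).im : ℂ)),
    (1 / 2) * (((z 1).re : ℂ) - I * ((z 1).im : ℂ)) *
      (polyFw (z 0).re (z 0).im (z 1).re (z 1).im : ℂ),
    I / 2]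

/-- The complex Hessian of `exampleFun`. -/
def exampleHess (z : Cn 3) : Matrix (Fin 3) (Fin 3) ℂ :=
  !![(polyHess11 (z 0).re (z 0).im (z 1).re (z 1).im : ℂ),
      polyHess12 (z 0).re (z 0).im (z 1).re (z 1).im, 0;
    (starRingEnd ℂ) (polyHess12 (z 0).re (z 0).im (z 1).re (z 1).im),
      (polyHess22 (z 0).re (z 0).im (z 1).re (z 1).im : ℂ), 0;
    0, 0, 0]

theorem complexGradient_exampleFun (z : Cn 3) :
    complexGradient exampleFun z = exampleGrad z := by
  have h := (hasFDerivAt_exampleFun z)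
  funext j
  simp only [complexGradient, dz, fderiv_ofReal_apply h.differentiableAt, h.fderiv]
  fin_cases j
  · simp [exampleGrad]
  · simp [exampleGrad]
    ring
  · simp [exampleGrad]
    ring

theorem dzbar_exampleFun (k : Fin 3) :
    dzbar k (fun w => (exampleFun w : ℂ)) = fun z => (starRingEnd ℂ) (exampleGrad z k) := by
  funext z
  have h := (hasFDerivAt_exampleFun z)
  simp only [dzbar, fderiv_ofReal_apply h.differentiableAt, h.fderiv]
  fin_cases k
  · simp [exampleGrad, RCLike.conj_ofNat]
  · simp [exampleGrad, RCLike.conj_ofNat]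
    ring
  · simp [exampleGrad, RCLike.conj_ofNat]
    ring

theorem hasFDerivAt_ofReal_realCoord (k : Fin 6) (z : Cn 3) :
    HasFDerivAt (fun w => (realCoord k w : ℂ)) (ofRealCLM.comp (realCoord k)) z :=
  (ofRealCLM.comp (realCoord k)).hasFDerivAt

theorem complexHessian_eq_dz (z : Cn 3) (j k : Fin 3) :
    complexHessian exampleFun z j k = dz j (fun z => (starRingEnd ℂ) (exampleGrad z k)) z := by
  simp only [complexHessian, Matrix.of_apply, dzbar_exampleFun]

set_option maxHeartbeats 1000000 in
theorem complexHessian_exampleFun_zero (z : Cn 3) (j : Fin 3) :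
    complexHessian exampleFun z j 0 = exampleHess z j 0 := by
  have hx := hasFDerivAt_ofReal_realCoord 0 z
  have hy := hasFDerivAt_ofReal_realCoord 1 z
  have hu := hasFDerivAt_ofReal_realCoord 2 z
  have hv := hasFDerivAt_ofReal_realCoord 3 z
  have hs := ((hx.pow 2).add (hu.pow 2)).add (hv.pow 2)
  have hFx := (((((((hu.pow 2).add (hv.pow 2)).const_mul 2).sub (hy.pow 4)).add
    ((hx.const_mul 2).mul (hs.pow 2))).add
    (((hx.const_mul 4).mul hs).mul (hy.pow 2))).sub ((hx.pow 5).const_mul (1 / 10))).add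
    ((hx.pow 3).mul (hy.pow 2)) |>.sub ((hx.const_mul (1 / 2)).mul (hy.pow 4))
  have hFy := ((((hx.const_mul (-4)).mul (hy.pow 3)).add
    (((hs.pow 2).const_mul 2).mul hy)).add (((hx.pow 4).const_mul (1 / 2)).mul hy)).sub
    ((hx.pow 2).mul (hy.pow 3)) |>.add ((hy.pow 5).const_mul (1 / 10))
  have h0 := (hFx.add (hFy.const_mul I)).const_mul (1 / 2)
  have g0 := h0.congr_of_eventuallyEq (f₁ := fun z => (starRingEnd ℂ) (exampleGrad z 0))
    (Filter.Eventually.of_forall fun w => by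
      simp [exampleGrad, polyFx, polyFy, polyS, RCLike.conj_ofNat])
  rw [complexHessian_eq_dz, dz, g0.fderiv]
  fin_cases j
  · simp [exampleHess, polyHess11, polyS]
    ring_nf
    simp
    ring
  · simp [exampleHess, polyHess12, polyS, RCLike.conj_ofNat, -re_add_im]
    ring
  · simp [exampleHess]

set_option maxHeartbeats 1000000 in
theorem complexHessian_exampleFun_one (z : Cn 3) (j : Fin 3) :
    complexHessian exampleFun z j 1 = exampleHess z j 1 := by
  have hx := hasFDerivAt_ofReal_realCoord 0 z
  have hy := hasFDerivAt_ofReal_realCoord 1 z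
  have hu := hasFDerivAt_ofReal_realCoord 2 z
  have hv := hasFDerivAt_ofReal_realCoord 3 z
  have hs := ((hx.pow 2).add (hu.pow 2)).add (hv.pow 2)
  have hFw := ((hx.const_mul 4).add ((hs.pow 2).const_mul 2)).add
    ((hs.const_mul 4).mul (hy.pow 2))
  have h1 := ((hu.add (hv.const_mul I)).const_mul (1 / 2)).mul hFw
  have g1 := h1.congr_of_eventuallyEq (f₁ := fun z => (starRingEnd ℂ) (exampleGrad z 1))
    (Filter.Eventually.of_forall fun w => by
      simp [exampleGrad, polyFw, polyS, RCLike.conj_ofNat])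
  rw [complexHessian_eq_dz, dz, g1.fderiv]
  fin_cases j
  · simp [exampleHess, polyHess12, polyS, -re_add_im]
    ring
  · simp [exampleHess, polyHess22, polyS]
    ring_nf
    simp
    ring
  · simp [exampleHess]

theorem complexHessian_exampleFun (z : Cn 3) :
    complexHessian exampleFun z = exampleHess z := by
  ext j k
  fin_cases k
  · exact complexHessian_exampleFun_zero z j
  · exact complexHessian_exampleFun_one z j
  · have h : (fun z => (starRingEnd ℂ) (exampleGrad z 2)) = fun _ => (starRingEnd ℂ) (I / 2) := by
      simp [exampleGrad]
    change complexHessian exampleFun z j 2 = _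
    rw [complexHessian_eq_dz, h, dz, fderiv_fun_const]
    fin_cases j <;> simp [exampleHess]

/-! ### Linear algebra of tangential hermitian tensors. -/

/-- The hermitian form `(L, M) ↦ ∑ H_{j k̄} L^j conj(M^k)`. -/
def leviForm {n : ℕ} (H : Matrix (Fin n) (Fin n) ℂ) (L M : Cn n) : ℂ :=
  ∑ j, ∑ k, H j k * L j * (starRingEnd ℂ) (M k)

/-- The squared length of a vector. -/
def vecNormSq {n : ℕ} (r : Fin n → ℂ) : ℝ := ∑ j, normSq (r j)

/-- The difference between the orthogonal projection onto the complement of `r` and `Υ`. -/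
def projSub {n : ℕ} (r : Fin n → ℂ) (Υ : Matrix (Fin n) (Fin n) ℂ) :
    Matrix (Fin n) (Fin n) ℂ :=
  Matrix.of fun k j => (if k = j then 1 else 0) - r k * (starRingEnd ℂ) (r j) / vecNormSq r - Υ k j

theorem sum_mul_conj_eq_vecNormSq {n : ℕ} (r : Fin n → ℂ) :
    ∑ j, r j * (starRingEnd ℂ) (r j) = vecNormSq r := by
  simp [vecNormSq, mul_conj]

theorem vecNormSq_pos {n : ℕ} {r : Fin n → ℂ} {i : Fin n} (h : r i ≠ 0) : 0 < vecNormSq r :=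
  Finset.sum_pos' (fun _ _ => normSq_nonneg _) ⟨i, Finset.mem_univ _, normSq_pos.mpr h⟩

/-- Completeness of an orthonormal basis of the annihilator of `r`. -/
theorem sum_orthonormal_tangent {r : Fin 3 → ℂ} (hr : 0 < vecNormSq r)
    {u : Fin 2 → Cn 3} (hu : Orthonormal ℂ u) (hur : ∀ a, ∑ j, r j * u a j = 0) (j k : Fin 3) :
    ∑ a, u a j * (starRingEnd ℂ) (u a k) =
      (if k = j then 1 else 0) - r k * (starRingEnd ℂ) (r j) / vecNormSq r := by
  have hs : (vecNormSq r : ℂ) ≠ 0 := by exact_mod_cast hr.ne'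
  have hsq : ((Real.sqrt (vecNormSq r) : ℝ) : ℂ) * (Real.sqrt (vecNormSq r) : ℝ) = vecNormSq r := by
    rw [← ofReal_mul, Real.mul_self_sqrt hr.le]
  have hs2 : ((Real.sqrt (vecNormSq r) : ℝ) : ℂ) ≠ 0 := by
    intro h
    rw [h, mul_zero] at hsq
    exact hs hsq.symm
  set t : ℂ := ((Real.sqrt (vecNormSq r) : ℝ) : ℂ) with ht
  have htc : (starRingEnd ℂ) t = t := conj_ofReal _
  have hrs := sum_mul_conj_eq_vecNormSq r
  rw [Fin.sum_univ_three] at hrs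
  have horth : ∀ a b, ∑ j, u a j * (starRingEnd ℂ) (u b j) = if a = b then 1 else 0 := by
    intro a b
    have h := orthonormal_iff_ite.mp hu b a
    rw [PiLp.inner_apply] at h
    simp only [RCLike.inner_apply] at h
    rw [h]
    simp [eq_comm]
  have hur' : ∀ a, ∑ j, (starRingEnd ℂ) (r j) * (starRingEnd ℂ) (u a j) = 0 := by
    intro a
    have := congrArg (starRingEnd ℂ) (hur a)
    simpa using this
  -- The rows u₀, u₁ and the normalized conjugate of r are orthonormal, so W W* = 1. For a square
  -- matrix this gives W* W = 1, whose entries are the claim.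
  let W : Matrix (Fin 3) (Fin 3) ℂ :=
    !![u 0 0, u 0 1, u 0 2; u 1 0, u 1 1, u 1 2;
      (starRingEnd ℂ) (r 0) / t, (starRingEnd ℂ) (r 1) / t, (starRingEnd ℂ) (r 2) / t]
  have h00 := horth 0 0
  have h01 := horth 0 1
  have h10 := horth 1 0
  have h11 := horth 1 1
  have k0 := hur 0
  have k1 := hur 1
  have l0 := hur' 0
  have l1 := hur' 1
  simp only [Fin.sum_univ_three] at h00 h01 h10 h11 k0 k1 l0 l1
  simp at h00 h01 h10 h11
  have hW : W * W.conjTranspose = 1 := by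
    ext a b
    simp only [Matrix.mul_apply, Fin.sum_univ_three, Matrix.conjTranspose_apply]
    fin_cases a <;> fin_cases b <;> simp [W, htc] <;> field_simp
    · linear_combination h00
    · linear_combination h01
    · linear_combination k0
    · linear_combination h10
    · linear_combination h11
    · linear_combination k1
    · linear_combination l0
    · linear_combination l1
    · linear_combination hrs - hsq
  have hW' := mul_eq_one_comm.mp hW
  have h := congrFun (congrFun hW' k) j
  simp only [Matrix.mul_apply, Fin.sum_univ_three, Matrix.conjTranspose_apply] at h
  rw [Fin.sum_univ_two]
  have h2 : u 0 j * (starRingEnd ℂ) (u 0 k) + u 1 j * (starRingEnd ℂ) (u 1 k) +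
      r k * (starRingEnd ℂ) (r j) / (t * t) = (1 : Matrix (Fin 3) (Fin 3) ℂ) k j := by
    rw [← h]
    fin_cases j <;> fin_cases k <;> simp [W, htc] <;> field_simp
  rw [hsq, Matrix.one_apply] at h2
  linear_combination h2

/-- The frame of the annihilator of `r`, when `r 2 ≠ 0`. -/
def tangentFrame (r : Fin 3 → ℂ) : Fin 2 → Cn 3
  | 0 => WithLp.toLp 2 ![1, 0, -r 0 / r 2]
  | 1 => WithLp.toLp 2 ![0, 1, -r 1 / r 2]

theorem sum_mul_tangentFrame {r : Fin 3 → ℂ} (hr : r 2 ≠ 0) (a : Fin 2) :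
    ∑ j, r j * tangentFrame r a j = 0 := by
  fin_cases a <;> simp [tangentFrame, Fin.sum_univ_three] <;> field_simp <;> ring

/-- A tangential hermitian tensor is determined by its coefficients in the frame. -/
theorem sum_tangential_mul {r : Fin 3 → ℂ} (hr : r 2 ≠ 0) {B : Matrix (Fin 3) (Fin 3) ℂ}
    (hB : B.IsHermitian) (hBr : ∀ k, ∑ j, B k j * r j = 0) (H : Matrix (Fin 3) (Fin 3) ℂ) :
    ∑ j, ∑ k, B k j * H j k =
      B 0 0 * leviForm H (tangentFrame r 0) (tangentFrame r 0) +
      B 1 0 * leviForm H (tangentFrame r 0) (tangentFrame r 1) +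
      B 0 1 * leviForm H (tangentFrame r 1) (tangentFrame r 0) +
      B 1 1 * leviForm H (tangentFrame r 1) (tangentFrame r 1) := by
  have hr' : (starRingEnd ℂ) (r 2) ≠ 0 := by simpa using hr
  have hc : ∀ k j, (starRingEnd ℂ) (B k j) = B j k := fun k j => hB.apply j k
  -- Tangentiality determines the last column, and hermitian symmetry then the last row, from the
  -- upper left 2 × 2 block.
  have hcol : ∀ k, B k 2 = B k 0 * (-r 0 / r 2) + B k 1 * (-r 1 / r 2) := by
    intro k
    have := hBr k
    rw [Fin.sum_univ_three] at this
    field_simp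
    linear_combination this
  have hrow : ∀ j, B 2 j = (starRingEnd ℂ) (-r 0 / r 2) * B 0 j +
      (starRingEnd ℂ) (-r 1 / r 2) * B 1 j := by
    intro j
    have := congrArg (starRingEnd ℂ) (hcol j)
    rw [hc, map_add, map_mul, map_mul, hc, hc] at this
    rw [this]
    ring
  have e22 := hcol 2
  rw [hrow 0, hrow 1] at e22
  simp only [leviForm, Fin.sum_univ_three, tangentFrame]
  simp
  rw [e22, hcol 0, hcol 1, hrow 0, hrow 1]
  simp
  ring

/-! ### Independence of the defining function. -/

theorem IsUniformDefiningFunction.contDiffAt {n : ℕ} {m : ℕ∞} (hm : 2 ≤ m) {Ω : Set (Cn n)}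
    {ρ : Cn n → ℝ} (h : IsUniformDefiningFunction m Ω ρ) {z : Cn n} (hz : z ∈ frontier Ω) :
    ContDiffAt ℝ 2 ρ z ∧ fderiv ℝ ρ z ≠ 0 := by
  obtain ⟨-, -, U, hU, hC, c, hc, hg⟩ := h
  refine ⟨?_, fun h0 => ?_⟩
  · have h1 := hC.1.contDiffAt (hU.1.mem_nhds (hU.2.1 hz))
    exact h1.of_le (WithTop.coe_le_coe.mpr hm)
  · have := hg z (hU.2.1 hz)
    rw [h0, norm_zero] at this
    linarith

theorem fderiv_eq_zero_of_tangent {n : ℕ} {r : Cn n → ℝ} {z : Cn n}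
    (h : DifferentiableAt ℝ r z) {L : Cn n} (hL : ∑ j, complexGradient r z j * L j = 0) :
    fderiv ℝ r z L = 0 ∧ fderiv ℝ r z (I • L) = 0 := by
  rw [sum_complexGradient_mul h] at hL
  have h1 := congrArg re hL
  have h2 := congrArg im hL
  simp at h1 h2
  exact ⟨h1, h2⟩

/-- Every defining function of the example has, on the boundary, the same complex gradient and
Levi form as `exampleFun`, up to a positive factor. -/
theorem IsUniformDefiningFunction.exists_factor {m : ℕ∞} (hm : 2 ≤ m) {ρ : Cn 3 → ℝ}
    (h : IsUniformDefiningFunction m exampleDomain ρ) {z : Cn 3}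
    (hz : z ∈ frontier exampleDomain) :
    ∃ κ : ℝ, 0 < κ ∧ (∀ j, complexGradient ρ z j = κ * exampleGrad z j) ∧
      ∀ L M : Cn 3, ∑ j, exampleGrad z j * L j = 0 → ∑ j, exampleGrad z j * M j = 0 →
        leviForm (complexHessian ρ z) L M = κ * leviForm (exampleHess z) L M := by
  obtain ⟨hρ2, hρ0⟩ := h.contDiffAt hm hz
  have hρd : DifferentiableAt ℝ ρ z := hρ2.differentiableAt (by norm_num)
  have hz0 : exampleFun z = 0 := by
    rw [frontier_exampleDomain] at hz
    exact hz
  have hr := contDiff_exampleFun (n := 2)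
  have hrd := (hasFDerivAt_exampleFun z).differentiableAt
  obtain ⟨h1, h2⟩ := fderiv_eq_of_zero_on_graph hr exampleFun_add_vertical hz0 hρ2 (by
    intro w hw
    have : w ∈ frontier exampleDomain := by
      rw [frontier_exampleDomain]
      exact hw
    rw [h.2.1] at this
    exact this)
  set κ : ℝ := -(fderiv ℝ ρ z verticalDir) with hκ
  have hκ0 : κ ≠ 0 := by
    intro h0
    apply hρ0
    ext ξ
    rw [h1, h0]
    simp
  -- Moving from z along `verticalDir` enters the domain, where ρ < 0, so the derivative of ρ in
  -- that direction cannot be positive.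
  have hκpos : 0 ≤ κ := by
    have hline : HasDerivAt (fun c : ℝ => z + c • verticalDir) verticalDir 0 := by
      simpa using ((hasDerivAt_id (0 : ℝ)).smul_const verticalDir).const_add z
    have hz' : z = z + (0 : ℝ) • verticalDir := by simp
    have hd : HasDerivAt (fun c : ℝ => ρ (z + c • verticalDir)) (fderiv ℝ ρ z verticalDir) 0 := by
      have h3 := hρd.hasFDerivAt
      rw [hz'] at h3
      have h4 := h3.comp_hasDerivAt (0 : ℝ) hline
      rwa [← hz'] at h4
    by_contra hneg
    push Not at hneg
    have hpos : 0 < fderiv ℝ ρ z verticalDir := by linarith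
    have h5 := hd.tendsto_slope_zero_right
    have h6 : ∀ᶠ c in nhdsWithin (0 : ℝ) (Set.Ioi 0),
        c⁻¹ • (ρ (z + (0 + c) • verticalDir) - ρ (z + (0 : ℝ) • verticalDir)) ≤ 0 := by
      filter_upwards [self_mem_nhdsWithin] with c hc
      have hc' : 0 < c := hc
      have hzρ : ρ z = 0 := by
        have : z ∈ {z | ρ z = 0} := h.2.1 ▸ hz
        exact this
      have hneg' : ρ (z + c • verticalDir) < 0 := by
        have : z + c • verticalDir ∈ exampleDomain := by
          change exampleFun _ < 0
          rw [exampleFun_add_vertical, hz0]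
          linarith
        rw [h.1] at this
        exact this
      rw [← hz', hzρ, zero_add, sub_zero, smul_eq_mul]
      exact mul_nonpos_of_nonneg_of_nonpos (by positivity) hneg'.le
    have := le_of_tendsto h5 h6
    linarith
  refine ⟨κ, lt_of_le_of_ne hκpos (Ne.symm hκ0), fun j => ?_, fun L M hL hM => ?_⟩
  · rw [← complexGradient_exampleFun]
    simp only [complexGradient, dz, fderiv_ofReal_apply hρd, fderiv_ofReal_apply hrd, h1]
    push_cast
    ring
  · rw [← complexGradient_exampleFun] at hL hM
    obtain ⟨hL1, hL2⟩ := fderiv_eq_zero_of_tangent hrd hL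
    obtain ⟨hM1, hM2⟩ := fderiv_eq_zero_of_tangent hrd hM
    rw [← complexHessian_exampleFun]
    simp only [leviForm]
    rw [sum_complexHessian_mul hρ2, sum_complexHessian_mul hr.contDiffAt]
    rw [h2 _ _ hM1 hL1, h2 _ _ hM2 hL2, h2 _ _ hM2 hL1, h2 _ _ hM1 hL2]
    push_cast
    ring

theorem exampleGrad_two (z : Cn 3) : exampleGrad z 2 = I / 2 := rfl

theorem exampleGrad_two_ne_zero (z : Cn 3) : exampleGrad z 2 ≠ 0 := by
  simp [exampleGrad_two]

theorem vecNormSq_exampleGrad_pos (z : Cn 3) : 0 < vecNormSq (exampleGrad z) :=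
  vecNormSq_pos (exampleGrad_two_ne_zero z)

theorem isHermitian_projSub {n : ℕ} {r : Fin n → ℂ} {Υ : Matrix (Fin n) (Fin n) ℂ}
    (h : Υ.IsHermitian) : (projSub r Υ).IsHermitian := by
  ext k j
  have := h.apply k j
  simp only [projSub, Matrix.conjTranspose_apply, Matrix.of_apply, RCLike.star_def, map_sub,
    map_div₀, map_mul, conj_conj, conj_ofReal] at this ⊢
  rw [this]
  by_cases hkj : j = k
  · subst hkj
    simp
    ring
  · simp [hkj, Ne.symm hkj]
    ring

theorem sum_projSub_mul {n : ℕ} {r : Fin n → ℂ} (hr : 0 < vecNormSq r)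
    {Υ : Matrix (Fin n) (Fin n) ℂ} (h : ∀ k, ∑ j, Υ k j * r j = 0) (k : Fin n) :
    ∑ j, projSub r Υ k j * r j = 0 := by
  have hs : (vecNormSq r : ℂ) ≠ 0 := by exact_mod_cast hr.ne'
  have h1 : ∀ j, projSub r Υ k j * r j = (if k = j then r j else 0) -
      r k / vecNormSq r * (r j * (starRingEnd ℂ) (r j)) - Υ k j * r j := by
    intro j
    simp only [projSub, Matrix.of_apply]
    split_ifs <;> ring
  simp_rw [h1]
  rw [Finset.sum_sub_distrib, Finset.sum_sub_distrib, h, ← Finset.mul_sum,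
    sum_mul_conj_eq_vecNormSq]
  field_simp
  simp

/-- The trace of a tangential tensor against the Levi form. -/
theorem IsLeviEigenvalues.sum_sub_eq {ρ : Cn 3 → ℝ} {z : Cn 3} {κ : ℝ} (hκ : 0 < κ)
    (hgrad : ∀ j, complexGradient ρ z j = κ * exampleGrad z j)
    (hlevi : ∀ L M : Cn 3, ∑ j, exampleGrad z j * L j = 0 → ∑ j, exampleGrad z j * M j = 0 →
        leviForm (complexHessian ρ z) L M = κ * leviForm (exampleHess z) L M)
    {μ : Fin (3 - 1) → ℝ} (hμ : IsLeviEigenvalues ρ z μ) {Υ : Matrix (Fin 3) (Fin 3) ℂ}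
    (hΥ : Υ.IsHermitian) (hΥr : ∀ k, ∑ j, Υ k j * exampleGrad z j = 0) :
    (∑ i with i.val < 2, μ i) - (∑ j, ∑ k, Υ k j * complexHessian ρ z j k).re =
      κ * (∑ j, ∑ k, projSub (exampleGrad z) Υ k j * exampleHess z j k).re := by
  obtain ⟨-, u, hu, hut, hudiag⟩ := hμ
  have hκc : (κ : ℂ) ≠ 0 := by exact_mod_cast hκ.ne'
  have hut' : ∀ a, ∑ j, exampleGrad z j * u a j = 0 := by
    intro a
    have := hut a
    simp_rw [hgrad, mul_assoc] at this
    rw [← Finset.mul_sum] at this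
    exact (mul_eq_zero.mp this).resolve_left hκc
  have hr := vecNormSq_exampleGrad_pos z
  have hcompl := sum_orthonormal_tangent hr (u := u) hu hut'
  set H := complexHessian ρ z with hH
  set B := projSub (exampleGrad z) Υ with hBdef
  have hB : B.IsHermitian := isHermitian_projSub hΥ
  have hBr : ∀ k, ∑ j, B k j * exampleGrad z j = 0 := sum_projSub_mul hr hΥr
  have h1 : ∑ j, ∑ k, B k j * H j k = κ * ∑ j, ∑ k, B k j * exampleHess z j k := by
    rw [sum_tangential_mul (exampleGrad_two_ne_zero z) hB hBr H,
      sum_tangential_mul (exampleGrad_two_ne_zero z) hB hBr (exampleHess z)]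
    have ht := sum_mul_tangentFrame (exampleGrad_two_ne_zero z)
    rw [hlevi _ _ (ht 0) (ht 0), hlevi _ _ (ht 0) (ht 1), hlevi _ _ (ht 1) (ht 0),
      hlevi _ _ (ht 1) (ht 1)]
    ring
  have h2 : ((∑ i with i.val < 2, μ i : ℝ) : ℂ) =
      ∑ j, ∑ k, (∑ a, u a j * (starRingEnd ℂ) (u a k)) * H j k := by
    -- Here q = n - 1: the sum contains every Levi eigenvalue, hence is a trace, and `hcompl` turns
    -- it into a contraction of the projection with the Hessian.
    have h3 : (∑ i with i.val < 2, μ i) = ∑ i : Fin 2, μ i := by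
      rw [Finset.filter_true_of_mem]
      intro i _
      exact i.isLt
    rw [h3, ofReal_sum]
    have h4 : ∀ a : Fin 2, (μ a : ℂ) = ∑ j, ∑ k, H j k * u a j * (starRingEnd ℂ) (u a k) := by
      intro a
      rw [hudiag a a, if_pos rfl]
    simp_rw [h4, Finset.sum_mul]
    rw [Finset.sum_comm]
    refine Finset.sum_congr rfl fun j _ => ?_
    rw [Finset.sum_comm]
    refine Finset.sum_congr rfl fun k _ => Finset.sum_congr rfl fun a _ => ?_
    ring
  have h5 : ((∑ i with i.val < 2, μ i : ℝ) : ℂ) - ∑ j, ∑ k, Υ k j * H j k =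
      κ * ∑ j, ∑ k, B k j * exampleHess z j k := by
    rw [← h1, h2, ← Finset.sum_sub_distrib]
    refine Finset.sum_congr rfl fun j _ => ?_
    rw [← Finset.sum_sub_distrib]
    refine Finset.sum_congr rfl fun k _ => ?_
    have := hcompl j k
    rw [this, hBdef]
    simp only [projSub, Matrix.of_apply]
    ring
  have h6 := congrArg re h5
  rw [sub_re, ofReal_re, re_ofReal_mul] at h6
  exact h6

/-! ### Rigidity of admissible tensors along x = z₂ = 0. -/

/-- The boundary point of the example over `(z₁, z₂)` with real part of `z₃` equal to `s`. -/
def graphPoint (z₁ z₂ : ℂ) (s : ℝ) : Cn 3 :=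
  WithLp.toLp 2 ![z₁, z₂, s + polyF z₁.re z₁.im z₂.re z₂.im * I]

theorem graphPoint_mem_frontier (z₁ z₂ : ℂ) (s : ℝ) :
    graphPoint z₁ z₂ s ∈ frontier exampleDomain := by
  rw [frontier_exampleDomain]
  simp [exampleFun_eq, graphPoint]

theorem continuous_exampleGrad (j : Fin 3) : Continuous fun z => exampleGrad z j := by
  fin_cases j
  · simp [exampleGrad, polyFx, polyFy, polyS]
    fun_prop
  · simp [exampleGrad, polyFw, polyS]
    fun_prop
  · simp [exampleGrad]
    fun_prop

/-- Continuity along boundary curves is the only consequence of the regularity of Υ that the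
rigidity argument uses. -/
theorem continuousAt_of_isUniformlyCkOnBoundary {n : ℕ} {k : ℕ∞} {Ω : Set (Cn n)}
    {f : Cn n → ℂ} (hf : IsUniformlyCkOnBoundary k Ω f) {γ : ℝ → Cn n} (hγ : Continuous γ)
    (hγΩ : ∀ t, γ t ∈ frontier Ω) : Continuous fun t => f (γ t) := by
  obtain ⟨U, g, hU, hg, hgf⟩ := hf
  have h : (fun t => f (γ t)) = fun t => g (γ t) := by
    funext t
    exact (hgf (hγΩ t)).symm
  rw [h]
  exact hg.1.continuousOn.comp_continuous hγ fun t => hU.2.1 (hγΩ t)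

theorem eq_zero_of_mul_nonneg {ψ : ℝ → ℝ} (hψ : Continuous ψ) (h : ∀ t, 0 ≤ t * ψ t) :
    ψ 0 = 0 := by
  refine le_antisymm ?_ ?_
  · have ht : Filter.Tendsto ψ (nhdsWithin 0 (Set.Iio 0)) (nhds (ψ 0)) :=
      hψ.continuousAt.mono_left nhdsWithin_le_nhds
    refine le_of_tendsto ht ?_
    filter_upwards [self_mem_nhdsWithin] with t ht
    by_contra hc
    push Not at hc
    have := h t
    nlinarith [mul_pos_of_neg_of_neg (show t < 0 from ht) (show -ψ t < 0 by linarith)]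
  · have ht : Filter.Tendsto ψ (nhdsWithin 0 (Set.Ioi 0)) (nhds (ψ 0)) :=
      hψ.continuousAt.mono_left nhdsWithin_le_nhds
    refine ge_of_tendsto ht ?_
    filter_upwards [self_mem_nhdsWithin] with t ht
    exact nonneg_of_mul_nonneg_right (h t) ht

theorem re_sum_mul_exampleHess {B : Matrix (Fin 3) (Fin 3) ℂ} (hB : B.IsHermitian) (z : Cn 3) :
    (∑ j, ∑ k, B k j * exampleHess z j k).re =
      (B 0 0).re * polyHess11 (z 0).re (z 0).im (z 1).re (z 1).im +
      (B 1 1).re * polyHess22 (z 0).re (z 0).im (z 1).re (z 1).im +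
      2 * (B 1 0 * polyHess12 (z 0).re (z 0).im (z 1).re (z 1).im).re := by
  have h : B 0 1 = (starRingEnd ℂ) (B 1 0) := (hB.apply 0 1).symm
  simp [Fin.sum_univ_three, exampleHess, h]
  ring

section Admissible

variable {m : ℕ∞} {ρ : Cn 3 → ℝ} {Υ : Cn 3 → Matrix (Fin 3) (Fin 3) ℂ}

theorem IsAdmissible.tangential_example (hm : 2 ≤ m)
    (hρ : IsUniformDefiningFunction m exampleDomain ρ)
    (hΥ : IsAdmissible m 2 exampleDomain ρ Υ) {z : Cn 3} (hz : z ∈ frontier exampleDomain)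
    (k : Fin 3) : ∑ j, Υ z k j * exampleGrad z j = 0 := by
  obtain ⟨κ, hκ, hgrad, -⟩ := hρ.exists_factor hm hz
  have h : ∑ j, (κ : ℂ) * (Υ z k j * exampleGrad z j) = 0 := by
    rw [← hΥ.tangential z hz k]
    refine Finset.sum_congr rfl fun j _ => ?_
    rw [hgrad]
    ring
  rw [← Finset.mul_sum] at h
  exact (mul_eq_zero.mp h).resolve_left (by exact_mod_cast hκ.ne')

theorem IsAdmissible.nonneg_example (hm : 2 ≤ m)
    (hρ : IsUniformDefiningFunction m exampleDomain ρ)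
    (hΥ : IsAdmissible m 2 exampleDomain ρ Υ) {z : Cn 3} (hz : z ∈ frontier exampleDomain) :
    0 ≤ (∑ j, ∑ k, projSub (exampleGrad z) (Υ z) k j * exampleHess z j k).re := by
  obtain ⟨κ, hκ, hgrad, hlevi⟩ := hρ.exists_factor hm hz
  obtain ⟨hherm, -⟩ := hΥ.hermitian_eigenvalues z hz
  obtain ⟨μ, hμ, hpos⟩ := hΥ.levi_nonneg z hz
  rw [hμ.sum_sub_eq hκ hgrad hlevi hherm (hΥ.tangential_example hm hρ hz)] at hpos
  exact nonneg_of_mul_nonneg_right hpos hκ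

/-- The contraction of B with the Hessian is nonnegative on bΩ and vanishes where x = z₂ = 0,
because the Hessian does. Its derivative in every direction (x₀, u₀ + iv₀) must therefore be zero.
Only the Hessian is differentiated, which is why continuity of B suffices. -/
theorem IsAdmissible.first_order (hm : 2 ≤ m)
    (hρ : IsUniformDefiningFunction m exampleDomain ρ)
    (hΥ : IsAdmissible m 2 exampleDomain ρ Υ) (y s x₀ u₀ v₀ : ℝ) :
    (projSub (exampleGrad (graphPoint (y * I) 0 s)) (Υ (graphPoint (y * I) 0 s)) 0 0).re *
        (-3 * x₀ * y ^ 2) +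
      (projSub (exampleGrad (graphPoint (y * I) 0 s)) (Υ (graphPoint (y * I) 0 s)) 1 1).re *
        (2 * x₀) +
      2 * (projSub (exampleGrad (graphPoint (y * I) 0 s)) (Υ (graphPoint (y * I) 0 s)) 1 0 *
        (u₀ + v₀ * I)).re = 0 := by
  set γ : ℝ → Cn 3 := fun t => graphPoint ((t * x₀ : ℝ) + y * I) ((t * u₀ : ℝ) + (t * v₀ : ℝ) * I) s
    with hγ
  have hγc : Continuous γ := by
    refine (PiLp.continuous_toLp 2 _).comp ?_
    refine continuous_pi fun i => ?_
    fin_cases i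
    · simp
      fun_prop
    · simp
      fun_prop
    · simp [polyF, polyS]
      fun_prop
  have hγf : ∀ t, γ t ∈ frontier exampleDomain := fun t => graphPoint_mem_frontier _ _ _
  have h0 : γ 0 = graphPoint (y * I) 0 s := by simp [hγ]
  set B : ℝ → Matrix (Fin 3) (Fin 3) ℂ := fun t => projSub (exampleGrad (γ t)) (Υ (γ t)) with hBdef
  have hBc : ∀ k j, Continuous fun t => B t k j := by
    intro k j
    have h1 := continuousAt_of_isUniformlyCkOnBoundary (hΥ.uniformly_bounded k j) hγc hγf
    have hg : ∀ i, Continuous fun t => exampleGrad (γ t) i := fun i =>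
      (continuous_exampleGrad i).comp hγc
    have hN : Continuous fun t => (vecNormSq (exampleGrad (γ t)) : ℂ) := by
      simp_rw [← sum_mul_conj_eq_vecNormSq]
      exact continuous_finsetSum _ fun i _ => (hg i).mul (continuous_conj.comp (hg i))
    simp only [hBdef, projSub, Matrix.of_apply]
    refine (continuous_const.sub (((hg k).mul (continuous_conj.comp (hg j))).div hN ?_)).sub h1
    intro t
    exact_mod_cast (vecNormSq_exampleGrad_pos (γ t)).ne'
  set S : ℝ := x₀ ^ 2 + u₀ ^ 2 + v₀ ^ 2
  -- ψ is the contraction along γ divided by t. This is a formula rather than a limit, since every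
  -- entry of the Hessian along γ has the explicit factor t.
  set ψ : ℝ → ℝ := fun t =>
    (B t 0 0).re * (-3 * x₀ * y ^ 2 + t * (2 * (t ^ 2 * S + y ^ 2) * x₀ ^ 2 + t ^ 2 * S ^ 2
      + S * y ^ 2)) +
    (B t 1 1).re * (2 * x₀ + t * (2 * (t ^ 2 * S + y ^ 2) * (u₀ ^ 2 + v₀ ^ 2) + t ^ 2 * S ^ 2
      + 2 * S * y ^ 2)) +
    2 * (B t 1 0 * ((u₀ + v₀ * I) * (1 + 2 * (t ^ 2 * S + y ^ 2) * (t * x₀)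
      - 2 * (t ^ 2 * S) * y * I))).re with hψ
  have hψc : Continuous ψ := by
    have h00 := hBc 0 0
    have h11 := hBc 1 1
    have h10 := hBc 1 0
    have r00 := continuous_re.comp h00
    have r11 := continuous_re.comp h11
    refine Continuous.add (Continuous.add (r00.mul (by fun_prop)) (r11.mul (by fun_prop))) ?_
    exact continuous_const.mul (continuous_re.comp (h10.mul (by fun_prop)))
  have hpos : ∀ t, 0 ≤ t * ψ t := by
    intro t
    have h1 := hΥ.nonneg_example hm hρ (hγf t)
    have hherm := isHermitian_projSub (r := exampleGrad (γ t))
      (hΥ.hermitian_eigenvalues _ (hγf t)).choose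
    rw [re_sum_mul_exampleHess hherm] at h1
    have e0 : (γ t) 0 = (t * x₀ : ℝ) + y * I := rfl
    have e1 : (γ t) 1 = (t * u₀ : ℝ) + (t * v₀ : ℝ) * I := rfl
    have hre : ∀ a b : ℝ, ((a : ℂ) + b * I).re = a := by simp
    have him : ∀ a b : ℝ, ((a : ℂ) + b * I).im = b := by simp
    rw [e0, e1, hre, him, hre, him] at h1
    have e12 : polyHess12 (t * x₀) y (t * u₀) (t * v₀) = (t : ℂ) *
        ((u₀ + v₀ * I) * (1 + 2 * (t ^ 2 * S + y ^ 2) * (t * x₀) - 2 * (t ^ 2 * S) * y * I)) := by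
      simp [polyHess12, polyS, S]
      ring
    have e3 : (B t 1 0 * polyHess12 (t * x₀) y (t * u₀) (t * v₀)).re = t * (B t 1 0 *
        ((u₀ + v₀ * I) * (1 + 2 * (t ^ 2 * S + y ^ 2) * (t * x₀)
          - 2 * (t ^ 2 * S) * y * I))).re := by
      rw [e12, mul_left_comm, re_ofReal_mul]
    refine h1.trans_eq ?_
    change (B t 0 0).re * _ + (B t 1 1).re * _ + 2 * (B t 1 0 * _).re = _
    rw [e3, hψ]
    simp only [polyHess11, polyHess22, polyS, S]
    ring
  have h := eq_zero_of_mul_nonneg hψc hpos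
  simp only [hψ, hBdef, h0] at h
  simpa using h

/-- On the curves `x = z₂ = 0` in the boundary, the tensor `Υ` is determined up to a factor. -/
theorem IsAdmissible.proj_axis (hm : 2 ≤ m)
    (hρ : IsUniformDefiningFunction m exampleDomain ρ)
    (hΥ : IsAdmissible m 2 exampleDomain ρ Υ) (y s : ℝ) {B : Matrix (Fin 3) (Fin 3) ℂ}
    (hB : B = projSub (exampleGrad (graphPoint (y * I) 0 s)) (Υ (graphPoint (y * I) 0 s))) :
    B 0 1 = 0 ∧ B 1 0 = 0 ∧ 2 * B 1 1 = 3 * y ^ 2 * B 0 0 := by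
  have hherm : B.IsHermitian := hB ▸ isHermitian_projSub
    (hΥ.hermitian_eigenvalues _ (graphPoint_mem_frontier _ _ _)).choose
  -- The three real directions x, Re z₂ and Im z₂ give the ratio of the diagonal entries and the
  -- real and imaginary parts of B₁₀.
  have h1 := hΥ.first_order hm hρ y s 1 0 0
  have h2 := hΥ.first_order hm hρ y s 0 1 0
  have h3 := hΥ.first_order hm hρ y s 0 0 1
  rw [← hB] at h1 h2 h3
  simp at h1 h2 h3
  have h10 : B 1 0 = 0 := Complex.ext h2 h3
  have hre : ∀ i, B i i = ((B i i).re : ℂ) := by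
    intro i
    have := hherm.apply i i
    exact (conj_eq_iff_re.mp this).symm
  refine ⟨?_, h10, ?_⟩
  · rw [← hherm.apply 0 1, h10, star_zero]
  · rw [hre 0, hre 1]
    have : 2 * (B 1 1).re = 3 * y ^ 2 * (B 0 0).re := by linarith
    exact_mod_cast this

end Admissible

/-! ### The eigenvalue one on and off the critical line. -/

theorem trace_projSub {r : Fin 3 → ℂ} (hr : 0 < vecNormSq r) (Υ : Matrix (Fin 3) (Fin 3) ℂ) :
    (projSub r Υ).trace = 2 - Υ.trace := by
  have hs : (vecNormSq r : ℂ) ≠ 0 := by exact_mod_cast hr.ne'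
  have h := sum_mul_conj_eq_vecNormSq r
  rw [Fin.sum_univ_three] at h
  simp [Matrix.trace, Fin.sum_univ_three, projSub]
  field_simp
  linear_combination -h

/-- The set of boundary points with `z₁ = z₂ = 0`. -/
def criticalLine : Set (Cn 3) := {z | z 0 = 0 ∧ z 1 = 0 ∧ (z 2).im = 0}

theorem eq_graphPoint_of_mem_criticalLine {z : Cn 3} (hz : z ∈ criticalLine) :
    z = graphPoint ((0 : ℝ) * I) 0 (z 2).re := by
  obtain ⟨h0, h1, h2⟩ := hz
  ext i
  fin_cases i
  · simp [graphPoint, h0]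
  · simp [graphPoint, h1]
  · apply Complex.ext <;> simp [graphPoint, h2, polyF, polyS]

theorem graphPoint_mem_criticalLine (s : ℝ) : graphPoint 0 0 s ∈ criticalLine := by
  simp [criticalLine, graphPoint, polyF, polyS]

theorem criticalLine_subset_frontier : criticalLine ⊆ frontier exampleDomain := by
  intro z hz
  rw [eq_graphPoint_of_mem_criticalLine hz]
  exact graphPoint_mem_frontier _ _ _

theorem isClosed_criticalLine : IsClosed criticalLine := by
  have h0 : Continuous fun z : Cn 3 => z 0 := by fun_prop
  have h1 : Continuous fun z : Cn 3 => z 1 := by fun_prop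
  have h2 : Continuous fun z : Cn 3 => (z 2).im := by fun_prop
  exact (isClosed_eq h0 continuous_const).inter
    ((isClosed_eq h1 continuous_const).inter (isClosed_eq h2 continuous_const))

theorem not_isBounded_criticalLine : ¬ Bornology.IsBounded criticalLine := by
  intro h
  obtain ⟨C, hC⟩ := h.exists_norm_le
  have h1 := hC _ (graphPoint_mem_criticalLine (|C| + 1))
  have h2 : ‖(graphPoint 0 0 (|C| + 1)) 2‖ ≤ ‖graphPoint 0 0 (|C| + 1)‖ := PiLp.norm_apply_le _ 2
  have h3 : (graphPoint 0 0 (|C| + 1)) 2 = ((|C| + 1 : ℝ) : ℂ) := by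
    simp [graphPoint, polyF, polyS]
  rw [h3, norm_real, Real.norm_of_nonneg (by positivity)] at h2
  linarith [le_abs_self C]

section Admissible

variable {m : ℕ∞} {ρ : Cn 3 → ℝ} {Υ : Cn 3 → Matrix (Fin 3) (Fin 3) ℂ}

theorem IsAdmissible.trace_ne_two {Ω : Set (Cn 3)} (hΥ : IsAdmissible m 2 Ω ρ Υ) {z : Cn 3}
    (hz : z ∈ frontier Ω) : (2 : ℂ) - (Υ z).trace ≠ 0 := by
  obtain ⟨c, hc, h⟩ := hΥ.trace_ne
  intro h0
  have := h z hz
  simp only [Nat.cast_ofNat, h0, norm_zero] at this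
  linarith

/-- On the critical line the gradient points in the z₃ direction, so Υ lives on the first two
coordinates. The axis relation with y = 0 makes it diagonal with Υ₁₁ = 1, and then Υ₀₀ ≠ 1 because
the trace is not 2. -/
theorem IsAdmissible.finrank_eigenspace (hm : 2 ≤ m)
    (hρ : IsUniformDefiningFunction m exampleDomain ρ)
    (hΥ : IsAdmissible m 2 exampleDomain ρ Υ) {z : Cn 3} (hz : z ∈ criticalLine) :
    Module.finrank ℂ (Module.End.eigenspace (Matrix.toLin' (Υ z)) 1) = 1 := by
  have hzf := criticalLine_subset_frontier hz
  obtain ⟨hherm, -⟩ := hΥ.hermitian_eigenvalues z hzf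
  have htang := hΥ.tangential_example hm hρ hzf
  obtain ⟨h01, h10, h11⟩ := hΥ.proj_axis hm hρ 0 (z 2).re rfl
  rw [← eq_graphPoint_of_mem_criticalLine hz] at h01 h10 h11
  have hg0 : exampleGrad z 0 = 0 := by
    simp [exampleGrad, hz.1, hz.2.1, polyFx, polyFy, polyS]
  have hg1 : exampleGrad z 1 = 0 := by
    simp [exampleGrad, hz.2.1]
  have hcol : ∀ k, Υ z k 2 = 0 := by
    intro k
    have := htang k
    rw [Fin.sum_univ_three, hg0, hg1, exampleGrad_two] at this
    simpa using this
  have hrow : ∀ k, Υ z 2 k = 0 := by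
    intro k
    rw [← hherm.apply 2 k, hcol, star_zero]
  simp [projSub, hg0] at h01 h10
  simp [projSub, hg1] at h11
  have h11' : Υ z 1 1 = 1 := by linear_combination -h11
  have htr := hΥ.trace_ne_two hzf
  rw [Matrix.trace, Fin.sum_univ_three] at htr
  simp [h11', hcol] at htr
  have h00 : Υ z 0 0 - 1 ≠ 0 := fun h => htr (by linear_combination -h)
  have hspan : Module.End.eigenspace (Matrix.toLin' (Υ z)) 1 =
      Submodule.span ℂ {(Pi.single 1 1 : Fin 3 → ℂ)} := by
    ext v
    rw [Module.End.mem_eigenspace_iff, Submodule.mem_span_singleton, Matrix.toLin'_apply, one_smul]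
    constructor
    · intro hv
      refine ⟨v 1, ?_⟩
      have hv0 := congrFun hv 0
      have hv2 := congrFun hv 2
      simp [Matrix.mulVec, dotProduct, Fin.sum_univ_three, hrow, hcol, h01] at hv0 hv2
      have hv0' : v 0 = 0 := by
        have : (Υ z 0 0 - 1) * v 0 = 0 := by linear_combination hv0
        exact (mul_eq_zero.mp this).resolve_left h00
      ext i
      fin_cases i
      · simp [hv0']
      · simp
      · simpa using hv2
    · rintro ⟨c, rfl⟩
      ext i
      fin_cases i
      · simp [Matrix.mulVec, dotProduct, Fin.sum_univ_three, h01]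
      · simp [Matrix.mulVec, dotProduct, Fin.sum_univ_three, h11']
      · simp [Matrix.mulVec, dotProduct, hrow]
  rw [hspan, finrank_span_singleton]
  intro h
  have := congrFun h 1
  simp at this

/-- For y ≠ 0 the relation 2B₁₁ = 3y²B₀₀ makes both diagonal entries nonzero as soon as one is, and
if both vanished then B would have trace 0, against the trace condition. So B is injective on the
complement of the gradient, while an eigenvector of Υ for the value one would lie in that complement
and in the kernel of B. -/
theorem IsAdmissible.not_hasEigenvalue_one (hm : 2 ≤ m)
    (hρ : IsUniformDefiningFunction m exampleDomain ρ)
    (hΥ : IsAdmissible m 2 exampleDomain ρ Υ) {y : ℝ} (hy : y ≠ 0) (s : ℝ) :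
    ¬ Module.End.HasEigenvalue (Matrix.toLin' (Υ (graphPoint (y * I) 0 s))) 1 := by
  set z := graphPoint (y * I) 0 s with hz
  have hzf : z ∈ frontier exampleDomain := graphPoint_mem_frontier _ _ _
  obtain ⟨hherm, -⟩ := hΥ.hermitian_eigenvalues z hzf
  have htang := hΥ.tangential_example hm hρ hzf
  have hr := vecNormSq_exampleGrad_pos z
  set B := projSub (exampleGrad z) (Υ z) with hB
  obtain ⟨h01, h10, h11⟩ := hΥ.proj_axis hm hρ y s hB
  have hBh : B.IsHermitian := isHermitian_projSub hherm
  have hBr : ∀ k, ∑ j, B k j * exampleGrad z j = 0 := sum_projSub_mul hr htang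
  have hg1 : exampleGrad z 1 = 0 := by
    simp [exampleGrad, hz, graphPoint]
  set f := exampleGrad z 0 with hf
  have hB02 : ∀ k, B k 2 * I = -2 * B k 0 * f := by
    intro k
    have := hBr k
    rw [Fin.sum_univ_three, hg1, exampleGrad_two] at this
    linear_combination 2 * this
  have hB12 : B 1 2 = 0 := by
    have := hB02 1
    rw [h10] at this
    simpa using this
  have h00 : B 0 0 ≠ 0 := by
    intro h00
    have hB02' : B 0 2 = 0 := by
      have := hB02 0
      rw [h00] at this
      simpa using this
    have hB20 : B 2 0 = 0 := by rw [← hBh.apply 2 0, hB02', star_zero]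
    have hB22 : B 2 2 = 0 := by
      have := hB02 2
      rw [hB20] at this
      simpa using this
    have hB11 : B 1 1 = 0 := by
      rw [h00] at h11
      simpa using h11
    apply hΥ.trace_ne_two hzf
    rw [← trace_projSub hr (Υ z), ← hB, Matrix.trace, Fin.sum_univ_three]
    simp [h00, hB11, hB22]
  have hB11 : B 1 1 ≠ 0 := by
    intro h
    rw [h] at h11
    have hy' : (y : ℂ) ≠ 0 := by exact_mod_cast hy
    have : 3 * (y : ℂ) ^ 2 * B 0 0 ≠ 0 :=
      mul_ne_zero (mul_ne_zero (by norm_num) (pow_ne_zero 2 hy')) h00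
    exact this (by simpa using h11.symm)
  intro hev
  obtain ⟨v, hv, hvne⟩ := hev.exists_hasEigenvector
  apply hvne
  have hv' : (Υ z).mulVec v = v := by
    have := Module.End.mem_eigenspace_iff.mp hv
    rwa [one_smul, Matrix.toLin'_apply] at this
  have hvk : ∀ k, ∑ j, Υ z k j * v j = v k := fun k => congrFun hv' k
  -- Υ is hermitian and annihilates the gradient, so its range, which contains v, is orthogonal to
  -- the gradient.
  have hrv : ∑ k, (starRingEnd ℂ) (exampleGrad z k) * v k = 0 := by
    have h1 : ∑ k, (starRingEnd ℂ) (exampleGrad z k) * v k =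
        ∑ k, ∑ j, (starRingEnd ℂ) (exampleGrad z k) * (Υ z k j * v j) := by
      refine Finset.sum_congr rfl fun k _ => ?_
      rw [← Finset.mul_sum, hvk]
    rw [h1, Finset.sum_comm]
    refine Finset.sum_eq_zero fun j _ => ?_
    have h2 := congrArg (starRingEnd ℂ) (htang j)
    rw [map_sum, map_zero] at h2
    have h3 : ∑ k, (starRingEnd ℂ) (exampleGrad z k) * (Υ z k j * v j) =
        (∑ k, (starRingEnd ℂ) (Υ z j k * exampleGrad z k)) * v j := by
      rw [Finset.sum_mul]
      refine Finset.sum_congr rfl fun k _ => ?_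
      have : (starRingEnd ℂ) (Υ z j k) = Υ z k j := hherm.apply k j
      rw [map_mul, this]
      ring
    rw [h3, h2, zero_mul]
  have hBv : ∀ k, ∑ j, B k j * v j = 0 := by
    intro k
    have h1 : ∑ j, B k j * v j = v k - exampleGrad z k / vecNormSq (exampleGrad z) *
        (∑ j, (starRingEnd ℂ) (exampleGrad z j) * v j) - ∑ j, Υ z k j * v j := by
      rw [Finset.mul_sum]
      have : v k = ∑ j, (if k = j then v j else 0) := by simp
      conv_rhs => rw [this]
      rw [← Finset.sum_sub_distrib, ← Finset.sum_sub_distrib]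
      refine Finset.sum_congr rfl fun j _ => ?_
      simp only [hB, projSub, Matrix.of_apply]
      split_ifs <;> ring
    rw [h1, hrv, hvk]
    simp
  have e0 := hBv 0
  have e1 := hBv 1
  rw [Fin.sum_univ_three] at e0 e1 hrv
  rw [h10, hB12] at e1
  rw [h01] at e0
  rw [hg1, exampleGrad_two] at hrv
  simp only [map_zero, zero_mul, add_zero, zero_add, map_div₀, conj_I, RCLike.conj_ofNat] at e0 e1 hrv
  have hv1 : v 1 = 0 := (mul_eq_zero.mp e1).resolve_left hB11
  have hv0 : v 0 = -2 * I * f * v 2 := by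
    have h1 : B 0 0 * (v 0 + 2 * I * f * v 2) = 0 := by
      linear_combination e0 + I * v 2 * hB02 0 - B 0 2 * v 2 * I_sq
    have h2 := (mul_eq_zero.mp h1).resolve_left h00
    linear_combination h2
  have hv2 : v 2 = 0 := by
    rw [hv0] at hrv
    -- Row 0 of Bv = 0 puts (v₀, v₂) in the normal direction tested by B, and orthogonality to the
    -- gradient leaves only zero.
    have h1 : ((4 * normSq f + 1 : ℝ) : ℂ) * v 2 = 0 := by
      have hff : (normSq f : ℂ) = f * (starRingEnd ℂ) f := (mul_conj f).symm
      push_cast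
      rw [hff]
      linear_combination 2 * I * hrv + (4 * f * (starRingEnd ℂ) f * v 2 + v 2) * I_sq
    refine (mul_eq_zero.mp h1).resolve_left ?_
    have : 0 < 4 * normSq f + 1 := by
      have := normSq_nonneg f
      linarith
    exact_mod_cast this.ne'
  ext i
  fin_cases i
  · simp [hv0, hv2]
  · exact hv1
  · exact hv2

theorem exists_not_hasEigenvalue_one (hm : 2 ≤ m)
    (hρ : IsUniformDefiningFunction m exampleDomain ρ)
    (hΥ : IsAdmissible m 2 exampleDomain ρ Υ) {V : Set (Cn 3)} (hV : IsOpen V)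
    (hKV : criticalLine ⊆ V) : ∃ z ∈ V ∩ frontier exampleDomain,
      ¬ Module.End.HasEigenvalue (Matrix.toLin' (Υ z)) 1 := by
  have hc : Continuous fun y : ℝ => graphPoint (y * I) 0 0 := by
    refine (PiLp.continuous_toLp 2 _).comp ?_
    refine continuous_pi fun i => ?_
    fin_cases i
    · simp
      fun_prop
    · simp
      fun_prop
    · simp [polyF, polyS]
      fun_prop
  have h0 : graphPoint ((0 : ℝ) * I) 0 0 ∈ V := hKV (by
    simpa using graphPoint_mem_criticalLine 0)
  have h1 : ∀ᶠ y : ℝ in nhdsWithin (0 : ℝ) {0}ᶜ, graphPoint ((y : ℂ) * I) 0 0 ∈ V :=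
    (hc.continuousAt.eventually (hV.mem_nhds h0)).filter_mono nhdsWithin_le_nhds
  obtain ⟨y, hy, hy0⟩ := (h1.and self_mem_nhdsWithin).exists
  exact ⟨_, ⟨hy, graphPoint_mem_frontier _ _ _⟩, hΥ.not_hasEigenvalue_one hm hρ hy0 0⟩

/-- Off the critical line the value one is excluded, so eigenvalues in {0, 1} force Υ = 0 and B is
the projection. The point y = 1/2 is chosen so that 3y² < 2: there B₁₁ = 1 and B₀₀ ≤ 1 contradict
2B₁₁ = 3y²B₀₀. -/
theorem not_isOnePseudoconvex_example (hm : 2 ≤ m) : ¬ IsOnePseudoconvex m exampleDomain := by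
  rintro ⟨ρ, hρ, Υ, hΥ, h01⟩
  set z := graphPoint (((1 / 2 : ℝ) : ℂ) * I) 0 0 with hz
  have hzf : z ∈ frontier exampleDomain := graphPoint_mem_frontier _ _ _
  have hne := hΥ.not_hasEigenvalue_one hm hρ (y := 1 / 2) (by norm_num) 0
  obtain ⟨hherm, -⟩ := hΥ.hermitian_eigenvalues z hzf
  have hΥ0 : Υ z = 0 := by
    rw [← hherm.eigenvalues_eq_zero_iff]
    funext i
    have hev : Module.End.HasEigenvalue (Matrix.toLin' (Υ z)) (hherm.eigenvalues i : ℂ) := by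
      refine Module.End.hasEigenvalue_of_hasEigenvector
        (x := (hherm.eigenvectorBasis i : Fin 3 → ℂ)) ⟨?_, ?_⟩
      · rw [Module.End.mem_eigenspace_iff, Matrix.toLin'_apply]
        exact hherm.mulVec_eigenvectorBasis i
      · intro h
        have h1 := hherm.eigenvectorBasis.orthonormal.ne_zero i
        exact h1 (by ext j; exact congrFun h j)
    rcases h01 z hzf _ hev with h | h
    · exact_mod_cast h
    · rw [h] at hev
      exact absurd hev hne
  obtain ⟨-, -, h11⟩ := hΥ.proj_axis hm hρ (1 / 2) 0 rfl
  rw [← hz] at h11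
  have hg1 : exampleGrad z 1 = 0 := by
    simp [exampleGrad, hz, graphPoint]
  simp only [projSub, Matrix.of_apply, hΥ0, hg1] at h11
  have hr := vecNormSq_exampleGrad_pos z
  have hdiv : 0 ≤ normSq (exampleGrad z 0) / vecNormSq (exampleGrad z) := by
    have := normSq_nonneg (exampleGrad z 0)
    positivity
  have h3 : (2 : ℝ) = 3 * (1 / 2) ^ 2 *
      (1 - normSq (exampleGrad z 0) / vecNormSq (exampleGrad z)) := by
    apply ofReal_injective
    push_cast
    simp at h11
    refine h11.trans ?_
    rw [← mul_conj]
    ring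
  linarith

end Admissible

/-! ### Algebras of functions with all derivatives bounded. -/

set_option linter.unusedSectionVars false

section BoundedDerivatives

variable {E ι : Type*} [NormedAddCommGroup E] [NormedSpace ℝ E] [Fintype ι]

/-- `g' k` are the coefficients of the differential of `g` with respect to the forms `ℓ k`. -/
def HasPartials (ℓ : ι → E →L[ℝ] ℝ) (g : E → ℂ) (g' : ι → E → ℂ) : Prop :=
  ∀ z, HasFDerivAt g (∑ k, g' k z • ofRealCLM.comp (ℓ k)) z

theorem sum_smul_ofReal_apply (ℓ : ι → E →L[ℝ] ℝ) (c : ι → ℂ) (v : E) :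
    (∑ k, c k • ofRealCLM.comp (ℓ k)) v = ∑ k, c k * ℓ k v := by
  simp

/-- The elements of `A` have partial derivatives in `A`. -/
def ClosedUnderPartials (ℓ : ι → E →L[ℝ] ℝ) (A : Set (E → ℂ)) : Prop :=
  ∀ g ∈ A, ∃ g' : ι → E → ℂ, (∀ k, g' k ∈ A) ∧ HasPartials ℓ g g'

/-- Induction on the order: the differential of an element of A is a sum of fixed linear forms with
coefficients again in A, so bounds on A itself bound every derivative. -/
theorem ClosedUnderPartials.bounded_iteratedFDeriv {ℓ : ι → E →L[ℝ] ℝ} {A : Set (E → ℂ)}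
    (hA : ClosedUnderPartials ℓ A) {U : Set E} (hU : ∀ g ∈ A, ∃ C : ℝ, ∀ z ∈ U, ‖g z‖ ≤ C) (n : ℕ) :
    ∀ g ∈ A, ContDiff ℝ n g ∧ ∃ C : ℝ, ∀ z ∈ U, ‖iteratedFDeriv ℝ n g z‖ ≤ C := by
  induction n with
  | zero =>
    intro g hg
    obtain ⟨g', -, hd⟩ := hA g hg
    refine ⟨?_, ?_⟩
    · rw [Nat.cast_zero, contDiff_zero]
      exact continuous_iff_continuousAt.mpr fun z => (hd z).continuousAt
    · simpa using hU g hg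
  | succ n ih =>
    intro g hg
    obtain ⟨g', hg', hd⟩ := hA g hg
    let T : ι → ℂ →L[ℝ] (E →L[ℝ] ℂ) := fun k =>
      (ContinuousLinearMap.lsmul ℝ ℂ).flip (ofRealCLM.comp (ℓ k))
    have hf : fderiv ℝ g = fun z => ∑ k, (T k ∘ g' k) z := by
      funext z
      rw [(hd z).fderiv]
      rfl
    have hc : ∀ k, ContDiff ℝ n (T k ∘ g' k) := fun k =>
      (T k).contDiff.comp (ih _ (hg' k)).1
    refine ⟨?_, ?_⟩
    · rw [Nat.cast_succ, contDiff_succ_iff_fderiv]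
      refine ⟨fun z => (hd z).differentiableAt, by simp, ?_⟩
      rw [hf]
      exact ContDiff.sum fun k _ => hc k
    · choose C hC using fun k => (ih _ (hg' k)).2
      refine ⟨∑ k, ‖T k‖ * C k, fun z hz => ?_⟩
      rw [← norm_iteratedFDeriv_fderiv, hf, iteratedFDeriv_fun_sum_apply (fun k _ => (hc k).contDiffAt)]
      refine (norm_sum_le _ _).trans (Finset.sum_le_sum fun k _ => ?_)
      refine ((T k).norm_iteratedFDeriv_comp_left (ih _ (hg' k)).1.contDiffAt le_rfl).trans ?_
      exact mul_le_mul_of_nonneg_left (hC k z hz) (norm_nonneg _)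

theorem HasPartials.add {ℓ : ι → E →L[ℝ] ℝ} {g h : E → ℂ} {g' h' : ι → E → ℂ}
    (hg : HasPartials ℓ g g') (hh : HasPartials ℓ h h') :
    HasPartials ℓ (g + h) (fun k => g' k + h' k) := by
  intro z
  refine ((hg z).add (hh z)).congr_fderiv ?_
  ext v
  simp only [add_apply, sum_smul_ofReal_apply, Pi.add_apply, add_mul, Finset.sum_add_distrib]

theorem HasPartials.mul {ℓ : ι → E →L[ℝ] ℝ} {g h : E → ℂ} {g' h' : ι → E → ℂ}
    (hg : HasPartials ℓ g g') (hh : HasPartials ℓ h h') :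
    HasPartials ℓ (g * h) (fun k => g * h' k + h * g' k) := by
  intro z
  refine ((hg z).mul (hh z)).congr_fderiv ?_
  ext v
  simp only [add_apply, smul_apply, sum_smul_ofReal_apply, Pi.add_apply, Pi.mul_apply, add_mul,
    Finset.sum_add_distrib, smul_eq_mul, Finset.mul_sum, mul_assoc]

theorem hasPartials_const {ℓ : ι → E →L[ℝ] ℝ} (c : ℂ) :
    HasPartials ℓ (fun _ => c) (fun _ => 0) := by
  intro z
  refine (hasFDerivAt_const c z).congr_fderiv ?_
  ext v
  rw [sum_smul_ofReal_apply]
  simp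

theorem HasPartials.inv {ℓ : ι → E →L[ℝ] ℝ} {g : E → ℂ} {g' : ι → E → ℂ}
    (hg : HasPartials ℓ g g') (h0 : ∀ z, g z ≠ 0) :
    HasPartials ℓ g⁻¹ (fun k => -(g⁻¹ * g⁻¹ * g' k)) := by
  intro z
  have h1 := (hasDerivAt_inv (h0 z)).comp_hasFDerivAt_of_eq z (hg z) rfl
  refine h1.congr_fderiv ?_
  ext v
  simp only [smul_apply, sum_smul_ofReal_apply, Pi.neg_apply, Pi.mul_apply, Pi.inv_apply,
    smul_eq_mul, Finset.mul_sum]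
  refine Finset.sum_congr rfl fun k _ => ?_
  field_simp

theorem HasPartials.pow {ℓ : ι → E →L[ℝ] ℝ} {g : E → ℂ} {g' : ι → E → ℂ}
    (hg : HasPartials ℓ g g') (n : ℕ) :
    HasPartials ℓ (g ^ n) (fun k => (n : E → ℂ) * g ^ (n - 1) * g' k) := by
  intro z
  refine ((hg z).pow n).congr_fderiv ?_
  ext v
  simp only [smul_apply, sum_smul_ofReal_apply, Pi.mul_apply, Pi.pow_apply, smul_eq_mul,
    Finset.mul_sum, nsmul_eq_mul, mul_assoc]
  rfl

/-- By linearity and the Leibniz rule only the generators have to be checked. -/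
theorem closedUnderPartials_adjoin {ℓ : ι → E →L[ℝ] ℝ} {S : Set (E → ℂ)}
    (hS : ∀ g ∈ S, ∃ g' : ι → E → ℂ, (∀ k, g' k ∈ Algebra.adjoin ℂ S) ∧ HasPartials ℓ g g') :
    ClosedUnderPartials ℓ (Algebra.adjoin ℂ S : Set (E → ℂ)) := by
  intro g hg
  induction hg using Algebra.adjoin_induction with
  | mem g hg => exact hS g hg
  | algebraMap c => exact ⟨fun _ => 0, fun _ => zero_mem _, hasPartials_const c⟩
  | add g h _ _ hg hh =>
    obtain ⟨g', hg', hgd⟩ := hg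
    obtain ⟨h', hh', hhd⟩ := hh
    exact ⟨_, fun k => add_mem (hg' k) (hh' k), hgd.add hhd⟩
  | mul g h hgA hhA hg hh =>
    obtain ⟨g', hg', hgd⟩ := hg
    obtain ⟨h', hh', hhd⟩ := hh
    exact ⟨_, fun k => add_mem (mul_mem hgA (hh' k)) (mul_mem hhA (hg' k)), hgd.mul hhd⟩

theorem bounded_adjoin {S : Set (E → ℂ)} {U : Set E}
    (hS : ∀ g ∈ S, ∃ C : ℝ, ∀ z ∈ U, ‖g z‖ ≤ C) :
    ∀ g ∈ Algebra.adjoin ℂ S, ∃ C : ℝ, ∀ z ∈ U, ‖g z‖ ≤ C := by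
  intro g hg
  induction hg using Algebra.adjoin_induction with
  | mem g hg => exact hS g hg
  | algebraMap c => exact ⟨‖c‖, fun z _ => le_rfl⟩
  | add g h _ _ hg hh =>
    obtain ⟨C, hC⟩ := hg
    obtain ⟨D, hD⟩ := hh
    exact ⟨C + D, fun z hz => (norm_add_le _ _).trans (add_le_add (hC z hz) (hD z hz))⟩
  | mul g h _ _ hg hh =>
    obtain ⟨C, hC⟩ := hg
    obtain ⟨D, hD⟩ := hh
    refine ⟨C * D, fun z hz => ?_⟩
    rw [Pi.mul_apply, norm_mul]
    exact mul_le_mul (hC z hz) (hD z hz) (norm_nonneg _) ((norm_nonneg _).trans (hC z hz))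

/-- Adjoining to a closed algebra an element with partials in the new algebra. -/
theorem closedUnderPartials_adjoin_insert {ℓ : ι → E →L[ℝ] ℝ} {S : Set (E → ℂ)} {h : E → ℂ}
    (hS : ClosedUnderPartials ℓ (Algebra.adjoin ℂ S : Set (E → ℂ))) {h' : ι → E → ℂ}
    (hh' : ∀ k, h' k ∈ Algebra.adjoin ℂ (insert h S)) (hd : HasPartials ℓ h h') :
    ClosedUnderPartials ℓ (Algebra.adjoin ℂ (insert h S) : Set (E → ℂ)) := by
  refine closedUnderPartials_adjoin fun g hg => ?_
  rcases hg with rfl | hg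
  · exact ⟨h', hh', hd⟩
  · obtain ⟨g', hg', hgd⟩ := hS g (Algebra.subset_adjoin hg)
    exact ⟨g', fun k => Algebra.adjoin_mono (Set.subset_insert _ _) (hg' k), hgd⟩

end BoundedDerivatives

theorem hasFiniteCmNorm_of_mem {n : ℕ} {ι : Type*} [Fintype ι] {ℓ : ι → Cn n →L[ℝ] ℝ}
    {A : Set (Cn n → ℂ)}
    (hA : ClosedUnderPartials ℓ A) {U : Set (Cn n)}
    (hU : ∀ g ∈ A, ∃ C : ℝ, ∀ z ∈ U, ‖g z‖ ≤ C) {g : Cn n → ℂ} (hg : g ∈ A) :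
    HasFiniteCmNorm ⊤ g U :=
  ⟨(contDiff_infty.mpr fun i => (hA.bounded_iteratedFDeriv hU i g hg).1).contDiffOn,
    fun i _ => (hA.bounded_iteratedFDeriv hU i g hg).2⟩

/-! ### Negative powers of brackets -/

section Bracket

variable {E ι : Type*} [NormedAddCommGroup E] [NormedSpace ℝ E] [Fintype ι] [DecidableEq ι]

/-- The function `(1 + ∑_{k ∈ J} (ℓ k)²)^{-1/2}`. -/
def bracketInv (ℓ : ι → E →L[ℝ] ℝ) (J : Finset ι) (z : E) : ℝ :=
  (Real.sqrt (1 + ∑ k ∈ J, ℓ k z ^ 2))⁻¹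

theorem bracket_pos (ℓ : ι → E →L[ℝ] ℝ) (J : Finset ι) (z : E) :
    0 < 1 + ∑ k ∈ J, ℓ k z ^ 2 := by
  have : 0 ≤ ∑ k ∈ J, ℓ k z ^ 2 := Finset.sum_nonneg fun k _ => sq_nonneg _
  linarith

theorem bracketInv_pos (ℓ : ι → E →L[ℝ] ℝ) (J : Finset ι) (z : E) : 0 < bracketInv ℓ J z :=
  inv_pos.mpr (Real.sqrt_pos.mpr (bracket_pos ℓ J z))

theorem bracketInv_sq_mul (ℓ : ι → E →L[ℝ] ℝ) (J : Finset ι) (z : E) :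
    bracketInv ℓ J z ^ 2 * (1 + ∑ k ∈ J, ℓ k z ^ 2) = 1 := by
  rw [bracketInv, inv_pow, Real.sq_sqrt (bracket_pos ℓ J z).le]
  exact inv_mul_cancel₀ (bracket_pos ℓ J z).ne'

theorem bracketInv_le_one (ℓ : ι → E →L[ℝ] ℝ) (J : Finset ι) (z : E) : bracketInv ℓ J z ≤ 1 := by
  have h1 := bracketInv_sq_mul ℓ J z
  have h2 : 0 ≤ ∑ k ∈ J, ℓ k z ^ 2 := Finset.sum_nonneg fun k _ => sq_nonneg _
  have h3 := bracketInv_pos ℓ J z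
  nlinarith [mul_nonneg (sq_nonneg (bracketInv ℓ J z)) h2]

theorem abs_mul_bracketInv_le_one (ℓ : ι → E →L[ℝ] ℝ) {J : Finset ι} {i : ι} (hi : i ∈ J) (z : E) :
    |ℓ i z * bracketInv ℓ J z| ≤ 1 := by
  have h1 := bracketInv_sq_mul ℓ J z
  have h2 : ℓ i z ^ 2 ≤ ∑ k ∈ J, ℓ k z ^ 2 :=
    Finset.single_le_sum (f := fun k => ℓ k z ^ 2) (fun k _ => sq_nonneg _) hi
  rw [← sq_le_one_iff_abs_le_one]
  nlinarith [mul_le_mul_of_nonneg_left h2 (sq_nonneg (bracketInv ℓ J z)),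
    sq_nonneg (bracketInv ℓ J z)]

theorem hasPartials_form (ℓ : ι → E →L[ℝ] ℝ) (i : ι) :
    HasPartials ℓ (fun z => (ℓ i z : ℂ)) (fun k _ => if k = i then 1 else 0) := by
  intro z
  refine (ofRealCLM.comp (ℓ i)).hasFDerivAt.congr_fderiv ?_
  ext v
  rw [sum_smul_ofReal_apply]
  simp

theorem hasPartials_bracketInv (ℓ : ι → E →L[ℝ] ℝ) (J : Finset ι) :
    HasPartials ℓ (fun z => (bracketInv ℓ J z : ℂ))
      (fun k => if k ∈ J then fun z => -((bracketInv ℓ J z : ℂ) ^ 2 *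
        (ℓ k z * bracketInv ℓ J z)) else 0) := by
  intro z
  have hq : HasFDerivAt (fun z => 1 + ∑ k ∈ J, ℓ k z ^ 2)
      (∑ k ∈ J, (2 * ℓ k z) • ℓ k) z := by
    refine HasFDerivAt.const_add 1 ?_
    refine HasFDerivAt.fun_sum fun k _ => ?_
    refine ((ℓ k).hasFDerivAt.pow 2).congr_fderiv ?_
    simp
  have hpos := bracket_pos ℓ J z
  have hs := (hq.sqrt hpos.ne')
  have hsp := Real.sqrt_pos.mpr hpos
  have h1 := (hasDerivAt_inv hsp.ne').comp_hasFDerivAt z hs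
  have h2 := ofRealCLM.hasFDerivAt.comp z h1
  refine h2.congr_fderiv ?_
  ext v
  rw [sum_smul_ofReal_apply]
  simp only [ContinuousLinearMap.comp_apply, smul_apply, FunLike.coe_sum,
    Finset.sum_apply, ofRealCLM_apply, smul_eq_mul]
  have hw : bracketInv ℓ J z = (Real.sqrt (1 + ∑ k ∈ J, ℓ k z ^ 2))⁻¹ := rfl
  rw [← Finset.sum_subset (Finset.subset_univ J) (fun k _ hk => by simp [hk])]
  push_cast
  rw [Finset.mul_sum, Finset.mul_sum]
  refine Finset.sum_congr rfl fun k hk => ?_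
  simp only [hk, if_true, hw]
  push_cast
  field_simp

/-- The functions `⟨J⟩⁻¹` and `ℓ k ⟨J⟩⁻¹`, for `k ∈ J`. -/
def bracketGenerators (ℓ : ι → E →L[ℝ] ℝ) (J : Finset ι) : Set (E → ℂ) :=
  insert (fun z => (bracketInv ℓ J z : ℂ))
    ((fun k z => (ℓ k z : ℂ) * bracketInv ℓ J z) '' (J : Set ι))

theorem bracketInv_mem (ℓ : ι → E →L[ℝ] ℝ) (J : Finset ι) :
    (fun z => (bracketInv ℓ J z : ℂ)) ∈ bracketGenerators ℓ J := Set.mem_insert _ _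

theorem mul_bracketInv_mem (ℓ : ι → E →L[ℝ] ℝ) {J : Finset ι} {k : ι} (hk : k ∈ J) :
    (fun z => (ℓ k z : ℂ) * bracketInv ℓ J z) ∈ bracketGenerators ℓ J :=
  Set.mem_insert_of_mem _ ⟨k, hk, rfl⟩

theorem bracketGenerators_bounded (ℓ : ι → E →L[ℝ] ℝ) (J : Finset ι) {g : E → ℂ}
    (hg : g ∈ bracketGenerators ℓ J) (z : E) : ‖g z‖ ≤ 1 := by
  rcases hg with rfl | ⟨k, hk, rfl⟩
  · rw [norm_real, Real.norm_of_nonneg (bracketInv_pos ℓ J z).le]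
    exact bracketInv_le_one ℓ J z
  · simp only
    rw [← ofReal_mul, norm_real]
    exact abs_mul_bracketInv_le_one ℓ hk z

/-- With w the inverse bracket, the coefficient of ℓ k in dw is -w²(ℓ k · w) for k in J. Every
partial of w and of ℓ i · w is thus a polynomial in the generators. -/
theorem bracketGenerators_partials (ℓ : ι → E →L[ℝ] ℝ) (J : Finset ι) {g : E → ℂ}
    (hg : g ∈ bracketGenerators ℓ J) : ∃ g' : ι → E → ℂ,
      (∀ k, g' k ∈ Algebra.adjoin ℂ (bracketGenerators ℓ J)) ∧ HasPartials ℓ g g' := by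
  have hw := Algebra.subset_adjoin (R := ℂ) (bracketInv_mem ℓ J)
  have hwk : ∀ k ∈ J, _ := fun k hk => Algebra.subset_adjoin (R := ℂ) (mul_bracketInv_mem ℓ (J := J) hk)
  rcases hg with rfl | ⟨i, hi, rfl⟩
  · refine ⟨_, fun k => ?_, hasPartials_bracketInv ℓ J⟩
    split_ifs with hk
    · exact neg_mem (mul_mem (pow_mem hw 2) (hwk k hk))
    · exact zero_mem _
  · refine ⟨_, fun k => ?_, (hasPartials_form ℓ i).mul (hasPartials_bracketInv ℓ J)⟩
    refine add_mem ?_ ?_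
    · split_ifs with hk
      · have : (fun z => (ℓ i z : ℂ)) * (fun z => -((bracketInv ℓ J z : ℂ) ^ 2 *
            (ℓ k z * bracketInv ℓ J z))) = -((fun z => (bracketInv ℓ J z : ℂ)) *
            (fun z => (ℓ i z : ℂ) * bracketInv ℓ J z) *
            (fun z => (ℓ k z : ℂ) * bracketInv ℓ J z)) := by
          funext z
          simp
          ring
        rw [this]
        exact neg_mem (mul_mem (mul_mem hw (hwk i hi)) (hwk k hk))
      · rw [mul_zero]
        exact zero_mem _
    · refine mul_mem hw ?_
      split_ifs
      · exact one_mem _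
      · exact zero_mem _

end Bracket

/-! ### Estimates for the polynomials -/

theorem polyS_nonneg (x u v : ℝ) : 0 ≤ polyS x u v := by
  unfold polyS
  positivity

/-- The weights 2 and 3y² are those forced by rigidity: they cancel the indefinite terms -3xy² and
2x coming from P, and what remains is a sum of nonnegative terms from Q. -/
theorem polyHess_combination_nonneg (x y u v : ℝ) :
    2 * polyS x u v ^ 2 + 2 * polyS x u v * y ^ 2 ≤
      2 * polyHess11 x y u v + 3 * y ^ 2 * polyHess22 x y u v := by
  have hs := polyS_nonneg x u v
  have h : 0 ≤ 4 * (polyS x u v + y ^ 2) * x ^ 2 + 6 * y ^ 2 * (polyS x u v + y ^ 2) *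
    (u ^ 2 + v ^ 2) + 3 * y ^ 2 * polyS x u v ^ 2 + 6 * polyS x u v * y ^ 4 := by positivity
  unfold polyHess11 polyHess22
  nlinarith

theorem polyHess_trace (x y u v : ℝ) :
    polyHess11 x y u v + polyHess22 x y u v =
      x * (2 - 3 * y ^ 2) + 4 * polyS x u v ^ 2 + 5 * polyS x u v * y ^ 2 := by
  unfold polyHess11 polyHess22 polyS
  ring

/-- The main inequality: a positive diagonal tensor has nonnegative trace against the Levi form. -/
theorem weighted_polyHess_nonneg (x y u v τ : ℝ) (hτ : τ * (1 + polyS x u v) = 1) :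
    0 ≤ (2 * τ ^ 5 + (polyS x u v * τ) ^ 2 / 64) * polyHess11 x y u v +
      (3 * y ^ 2 * τ ^ 5 + (polyS x u v * τ) ^ 2 / 64) * polyHess22 x y u v := by
  have hs := polyS_nonneg x u v
  have h1 := polyHess_combination_nonneg x y u v
  have h2 := polyHess_trace x y u v
  have hx : x ^ 2 ≤ polyS x u v := by
    unfold polyS
    nlinarith [sq_nonneg u, sq_nonneg v]
  set s := polyS x u v
  set A := polyHess11 x y u v
  set D := polyHess22 x y u v
  have hτ0 : 0 < τ := by
    by_contra h
    push Not at h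
    nlinarith
  have hτ1 : τ ≤ 1 := by nlinarith
  have e : (2 * τ ^ 5 + (s * τ) ^ 2 / 64) * A + (3 * y ^ 2 * τ ^ 5 + (s * τ) ^ 2 / 64) * D =
      τ ^ 5 * (2 * A + 3 * y ^ 2 * D) + (s * τ) ^ 2 / 64 * (A + D) := by ring
  rw [e]
  have hy : 0 ≤ y ^ 2 := sq_nonneg y
  have hxy : -(|x| * (2 + 3 * y ^ 2)) ≤ x * (2 - 3 * y ^ 2) := by
    nlinarith [neg_abs_le x, le_abs_self x, mul_le_mul_of_nonneg_right (le_abs_self x) hy]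
  -- For s ≥ 1 one has |x| ≤ s, and both combinations are nonnegative separately. For s < 1 the
  -- trace may be negative, but then τ ≥ 1/2, and the loss (s²/64)(2 + 3y²) is covered by (1/32)(2s²
  -- + 2sy²); the divisor 64 is chosen for this.
  by_cases h : 1 ≤ s
  · have hxs : |x| ≤ s := abs_le_of_sq_le_sq (by nlinarith) hs
    have h3 : 0 ≤ A + D := by
      rw [h2]
      nlinarith [mul_le_mul_of_nonneg_right hxs (show 0 ≤ 2 + 3 * y ^ 2 by positivity),
        mul_nonneg hs hy, mul_nonneg hs (sub_nonneg.mpr h)]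
    have h4 : 0 ≤ 2 * A + 3 * y ^ 2 * D := le_trans (by positivity) h1
    positivity
  · push Not at h
    have hxs : |x| ≤ 1 := by
      rw [← sq_le_one_iff_abs_le_one]
      linarith
    have hτh : 1 / 2 ≤ τ := by nlinarith
    have hτ5 : (1 / 2) ^ 5 ≤ τ ^ 5 := pow_le_pow_left₀ (by norm_num) hτh 5
    have h5 : (1 / 2) ^ 5 * (2 * s ^ 2 + 2 * s * y ^ 2) ≤ τ ^ 5 * (2 * A + 3 * y ^ 2 * D) :=
      mul_le_mul hτ5 h1 (by positivity) (by positivity)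
    have h6 : -(2 + 3 * y ^ 2) ≤ A + D := by
      rw [h2]
      have : |x| * (2 + 3 * y ^ 2) ≤ 1 * (2 + 3 * y ^ 2) :=
        mul_le_mul_of_nonneg_right hxs (by positivity)
      nlinarith [sq_nonneg s, mul_nonneg hs hy]
    have h7 : (s * τ) ^ 2 ≤ s ^ 2 := pow_le_pow_left₀ (by positivity) (by nlinarith) 2
    have h8 : -(s ^ 2 / 64 * (2 + 3 * y ^ 2)) ≤ (s * τ) ^ 2 / 64 * (A + D) := by
      have h9 : (s * τ) ^ 2 / 64 * (2 + 3 * y ^ 2) ≤ s ^ 2 / 64 * (2 + 3 * y ^ 2) :=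
        mul_le_mul_of_nonneg_right (by linarith) (by positivity)
      have h10 := mul_le_mul_of_nonneg_left h6 (show 0 ≤ (s * τ) ^ 2 / 64 by positivity)
      linarith
    have h11 : s ^ 2 * y ^ 2 ≤ s * y ^ 2 := by
      nlinarith [mul_nonneg (mul_nonneg hs hy) (sub_nonneg.mpr h.le)]
    nlinarith [sq_nonneg s, mul_nonneg hs hy]

/-- By Euler's identity the radial derivative is 6Q plus 3 and 5 times the two homogeneous pieces of
P. It remains to bound 6Q from below. -/
theorem radial_derivative_lower (x y u v : ℝ) :
    (1 / 640) * (x ^ 2 + y ^ 2 + u ^ 2 + v ^ 2) ^ 3 + 6 * x * (u ^ 2 + v ^ 2) - 5 * x * y ^ 4 ≤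
      x * polyFx x y u v + y * polyFy x y u v + (u ^ 2 + v ^ 2) * polyFw x y u v := by
  have hs := polyS_nonneg x u v
  have hx : x ^ 2 ≤ polyS x u v := by
    unfold polyS
    nlinarith [sq_nonneg u, sq_nonneg v]
  have e1 : x * polyFx x y u v + y * polyFy x y u v + (u ^ 2 + v ^ 2) * polyFw x y u v =
      6 * ((1 / 3) * polyS x u v ^ 3 + polyS x u v ^ 2 * y ^ 2 - (1 / 60) * x ^ 6
        + (1 / 4) * x ^ 4 * y ^ 2 - (1 / 4) * x ^ 2 * y ^ 4 + (1 / 60) * y ^ 6)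
        + 6 * x * (u ^ 2 + v ^ 2) - 5 * x * y ^ 4 := by
    unfold polyFx polyFy polyFw polyS
    ring
  have e2 : x ^ 2 + y ^ 2 + u ^ 2 + v ^ 2 = polyS x u v + y ^ 2 := by
    unfold polyS
    ring
  rw [e1, e2]
  set s := polyS x u v
  have h6 : x ^ 6 ≤ s ^ 3 := by
    calc x ^ 6 = (x ^ 2) ^ 3 := by ring
      _ ≤ s ^ 3 := pow_le_pow_left₀ (sq_nonneg x) hx 3
  have h4 : x ^ 2 * y ^ 4 ≤ s * y ^ 4 := mul_le_mul_of_nonneg_right hx (by positivity)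
  have h5 : 0 ≤ x ^ 4 * y ^ 2 := by positivity
  -- Six times this square absorbs the negative term of 6Q and leaves (1/10 - 6/64)y⁶ = y⁶/160. The
  -- next inequality gives (s + y²)³ ≤ 4(s³ + y⁶), whence 1/640.
  have h7 : 0 ≤ y ^ 2 * (s - y ^ 2 / 8) ^ 2 := by positivity
  have h8 : 0 ≤ (s + y ^ 2) * (s - y ^ 2) ^ 2 := by positivity
  have h9 : 0 ≤ s ^ 3 := by positivity
  have h10 : 0 ≤ y ^ 6 := by positivity
  nlinarith

/-- The squared length of the real gradient of `exampleFun`. -/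
def polyGradSq (x y u v : ℝ) : ℝ :=
  1 + polyFx x y u v ^ 2 + polyFy x y u v ^ 2 + (u ^ 2 + v ^ 2) * polyFw x y u v ^ 2

-- Cauchy–Schwarz bounds the gradient below by the radial derivative, whose degree-six part
-- dominates far out; on a bounded set the constant term 1 suffices.
set_option maxHeartbeats 600000 in
theorem exists_polyGradSq_lower : ∃ c : ℝ, 0 < c ∧ ∀ x y u v : ℝ,
    c * (1 + (x ^ 2 + y ^ 2 + u ^ 2 + v ^ 2)) ^ 5 ≤ polyGradSq x y u v := by
  refine ⟨((1 + 15360 ^ 2) ^ 5)⁻¹, by positivity, fun x y u v => ?_⟩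
  have hR : 0 ≤ x ^ 2 + y ^ 2 + u ^ 2 + v ^ 2 := by positivity
  have hrad := radial_derivative_lower x y u v
  have hG : polyGradSq x y u v = 1 + (polyFx x y u v ^ 2 + polyFy x y u v ^ 2 +
      (u * polyFw x y u v) ^ 2 + (v * polyFw x y u v) ^ 2) := by
    unfold polyGradSq
    ring
  rw [hG]
  have hCS : (x * polyFx x y u v + y * polyFy x y u v + (u ^ 2 + v ^ 2) * polyFw x y u v) ^ 2 ≤
      (x ^ 2 + y ^ 2 + u ^ 2 + v ^ 2) * (polyFx x y u v ^ 2 + polyFy x y u v ^ 2 +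
      (u * polyFw x y u v) ^ 2 + (v * polyFw x y u v) ^ 2) := by
    set a := polyFx x y u v
    set b := polyFy x y u v
    set c := polyFw x y u v
    have h : (x ^ 2 + y ^ 2 + u ^ 2 + v ^ 2) * (a ^ 2 + b ^ 2 + (u * c) ^ 2 + (v * c) ^ 2) -
        (x * a + y * b + (u ^ 2 + v ^ 2) * c) ^ 2 = (x * b - y * a) ^ 2 +
        (x * (u * c) - u * a) ^ 2 + (x * (v * c) - v * a) ^ 2 + (y * (u * c) - u * b) ^ 2 +
        (y * (v * c) - v * b) ^ 2 := by ring
    have h0 : 0 ≤ (x * b - y * a) ^ 2 +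
        (x * (u * c) - u * a) ^ 2 + (x * (v * c) - v * a) ^ 2 + (y * (u * c) - u * b) ^ 2 +
        (y * (v * c) - v * b) ^ 2 := by positivity
    linarith
  set T := polyFx x y u v ^ 2 + polyFy x y u v ^ 2 +
      (u * polyFw x y u v) ^ 2 + (v * polyFw x y u v) ^ 2 with hT
  have hT0 : 0 ≤ T := by positivity
  obtain ⟨D, hD0, hD⟩ : ∃ D : ℝ, 0 ≤ D ∧ x ^ 2 + y ^ 2 + u ^ 2 + v ^ 2 = D ^ 2 :=
    ⟨Real.sqrt _, Real.sqrt_nonneg _, (Real.sq_sqrt hR).symm⟩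
  have hxD : |x| ≤ D := abs_le_of_sq_le_sq (by nlinarith [sq_nonneg y, sq_nonneg u, sq_nonneg v]) hD0
  have hw : u ^ 2 + v ^ 2 ≤ D ^ 2 := by nlinarith [sq_nonneg x, sq_nonneg y]
  have hy2 : y ^ 2 ≤ D ^ 2 := by nlinarith [sq_nonneg x, sq_nonneg u, sq_nonneg v]
  have hy4 : y ^ 4 ≤ D ^ 4 := by
    calc y ^ 4 = (y ^ 2) ^ 2 := by ring
      _ ≤ (D ^ 2) ^ 2 := pow_le_pow_left₀ (sq_nonneg y) hy2 2
      _ = D ^ 4 := by ring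
  rw [hD] at hrad hCS ⊢
  -- 15360 = 12 · 1280: beyond this radius the contribution of P, at most 12D⁵, is at most half of
  -- D⁶/640.
  by_cases hbig : 15360 ≤ D
  · have h1 : |6 * x * (u ^ 2 + v ^ 2) - 5 * x * y ^ 4| ≤ 12 * D ^ 5 := by
      have h2 : 6 * x * (u ^ 2 + v ^ 2) - 5 * x * y ^ 4 =
        x * (6 * (u ^ 2 + v ^ 2) - 5 * y ^ 4) := by ring
      have h3 : |6 * (u ^ 2 + v ^ 2) - 5 * y ^ 4| ≤ 6 * D ^ 4 + 5 * D ^ 4 := by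
        have h4 : D ^ 2 ≤ D ^ 4 := by
          nlinarith [mul_nonneg (sq_nonneg D) (show 0 ≤ D ^ 2 - 1 by nlinarith)]
        have h5 : 0 ≤ y ^ 4 := by positivity
        rw [abs_le]
        constructor <;> nlinarith [sq_nonneg u, sq_nonneg v]
      rw [h2, abs_mul]
      calc |x| * |6 * (u ^ 2 + v ^ 2) - 5 * y ^ 4| ≤ D * (6 * D ^ 4 + 5 * D ^ 4) :=
            mul_le_mul hxD h3 (abs_nonneg _) hD0
        _ ≤ 12 * D ^ 5 := by nlinarith [pow_nonneg hD0 5]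
    have h2 : 12 * D ^ 5 ≤ (1 / 1280) * D ^ 6 := by
      nlinarith [mul_nonneg (pow_nonneg hD0 5) (sub_nonneg.mpr hbig)]
    have h3 : (1 / 1280) * D ^ 6 ≤
        x * polyFx x y u v + y * polyFy x y u v + (u ^ 2 + v ^ 2) * polyFw x y u v := by
      have := neg_le_of_abs_le h1
      nlinarith
    have h4 : ((1 / 1280) * D ^ 6) ^ 2 ≤ D ^ 2 * T :=
      (pow_le_pow_left₀ (by positivity) h3 2).trans hCS
    have hDpos : 0 < D ^ 2 := by positivity
    have h5 : (1 / 1280) ^ 2 * D ^ 10 ≤ T := by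
      refine le_of_mul_le_mul_left ?_ hDpos
      calc D ^ 2 * ((1 / 1280) ^ 2 * D ^ 10) = ((1 / 1280) * D ^ 6) ^ 2 := by ring
        _ ≤ _ := h4
    have h6 : (1 + D ^ 2) ^ 5 ≤ (2 * D ^ 2) ^ 5 :=
      pow_le_pow_left₀ (by positivity) (by nlinarith) 5
    have h7 : (2 * D ^ 2) ^ 5 = 32 * D ^ 10 := by ring
    have h8 : ((1 + 15360 ^ 2 : ℝ) ^ 5)⁻¹ ≤ (1 / 1280) ^ 2 / 32 := by norm_num
    calc ((1 + 15360 ^ 2 : ℝ) ^ 5)⁻¹ * (1 + D ^ 2) ^ 5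
        ≤ (1 / 1280) ^ 2 / 32 * (32 * D ^ 10) :=
          mul_le_mul h8 (h6.trans_eq h7) (by positivity) (by positivity)
      _ = (1 / 1280) ^ 2 * D ^ 10 := by ring
      _ ≤ 1 + T := by linarith
  · push Not at hbig
    have h1 : (1 + D ^ 2) ^ 5 ≤ (1 + 15360 ^ 2) ^ 5 :=
      pow_le_pow_left₀ (by positivity) (by nlinarith) 5
    calc ((1 + 15360 ^ 2 : ℝ) ^ 5)⁻¹ * (1 + D ^ 2) ^ 5
        ≤ ((1 + 15360 ^ 2 : ℝ) ^ 5)⁻¹ * (1 + 15360 ^ 2) ^ 5 :=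
          mul_le_mul_of_nonneg_left h1 (by positivity)
      _ = 1 := inv_mul_cancel₀ (by positivity)
      _ ≤ 1 + T := by linarith

/-- Near the y-axis the weight of the second frame vector may vanish, so the growth has to come from
the z₁-derivatives alone. The term y⁶/60 of Q provides it through the y-derivative once y² ≥ 100. -/
theorem exists_polyGradSq_near_axis : ∃ c : ℝ, 0 < c ∧ ∀ x y u v : ℝ, polyS x u v ≤ 1 →
    c * (1 + y ^ 2) ^ 5 ≤ 1 + polyFx x y u v ^ 2 + polyFy x y u v ^ 2 := by
  refine ⟨(101 ^ 5)⁻¹, by positivity, fun x y u v hs1 => ?_⟩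
  have hs := polyS_nonneg x u v
  have hx2 : x ^ 2 ≤ 1 := by
    unfold polyS at hs1
    nlinarith [sq_nonneg u, sq_nonneg v]
  have hx : x ≤ 1 := by nlinarith
  have hFx := sq_nonneg (polyFx x y u v)
  have hFy := sq_nonneg (polyFy x y u v)
  obtain ⟨Y, hY⟩ : ∃ Y, Y = y ^ 2 := ⟨_, rfl⟩
  have hY0 : 0 ≤ Y := hY ▸ sq_nonneg y
  rw [← hY]
  by_cases hbig : 100 ≤ Y
  · have e : y * polyFy x y u v = Y * (-4 * x * Y + 2 * polyS x u v ^ 2 + (1 / 2) * x ^ 4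
        - x ^ 2 * Y + (1 / 10) * Y ^ 2) := by
      rw [hY]
      unfold polyFy
      ring
    have h1 : (1 / 20) * Y ^ 2 ≤ -4 * x * Y + 2 * polyS x u v ^ 2 + (1 / 2) * x ^ 4
        - x ^ 2 * Y + (1 / 10) * Y ^ 2 := by
      have h4 : 0 ≤ x ^ 4 := by positivity
      nlinarith [mul_nonneg hY0 (sub_nonneg.mpr hx), mul_nonneg hY0 (sub_nonneg.mpr hx2),
        sq_nonneg (polyS x u v), mul_nonneg hY0 (sub_nonneg.mpr hbig)]
    have h2 : (1 / 20) * Y ^ 3 ≤ y * polyFy x y u v := by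
      rw [e]
      nlinarith [mul_le_mul_of_nonneg_left h1 hY0]
    have h3 : ((1 / 20) * Y ^ 3) ^ 2 ≤ Y * polyFy x y u v ^ 2 := by
      refine (pow_le_pow_left₀ (by positivity) h2 2).trans_eq ?_
      rw [hY]
      ring
    have h4 : (1 / 400) * Y ^ 5 ≤ polyFy x y u v ^ 2 := by
      refine le_of_mul_le_mul_left ?_ (show 0 < Y by linarith)
      calc Y * ((1 / 400) * Y ^ 5) = ((1 / 20) * Y ^ 3) ^ 2 := by ring
        _ ≤ _ := h3
    have h5 : (1 + Y) ^ 5 ≤ (2 * Y) ^ 5 := pow_le_pow_left₀ (by positivity) (by linarith) 5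
    have h6 : ((101 : ℝ) ^ 5)⁻¹ ≤ 1 / 400 / 32 := by norm_num
    calc ((101 : ℝ) ^ 5)⁻¹ * (1 + Y) ^ 5 ≤ 1 / 400 / 32 * (2 * Y) ^ 5 :=
          mul_le_mul h6 h5 (by positivity) (by positivity)
      _ = (1 / 400) * Y ^ 5 := by ring
      _ ≤ _ := by linarith
  · push Not at hbig
    have h1 : (1 + Y) ^ 5 ≤ 101 ^ 5 := pow_le_pow_left₀ (by positivity) (by linarith) 5
    calc ((101 : ℝ) ^ 5)⁻¹ * (1 + Y) ^ 5 ≤ ((101 : ℝ) ^ 5)⁻¹ * 101 ^ 5 :=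
          mul_le_mul_of_nonneg_left h1 (by positivity)
      _ = 1 := by norm_num
      _ ≤ _ := by linarith

/-- The lower bound for the trace of the weighted tensor. -/
theorem exists_weighted_trace_lower : ∃ c : ℝ, 0 < c ∧ ∀ x y u v τ β : ℝ,
    τ * (1 + polyS x u v) = 1 → β * (1 + (x ^ 2 + y ^ 2 + u ^ 2 + v ^ 2)) = 1 →
    c ≤ β ^ 5 * ((2 * τ ^ 5 + (polyS x u v * τ) ^ 2 / 64) *
        (1 + polyFx x y u v ^ 2 + polyFy x y u v ^ 2) +
      (3 * y ^ 2 * τ ^ 5 + (polyS x u v * τ) ^ 2 / 64) *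
        (1 + (u ^ 2 + v ^ 2) * polyFw x y u v ^ 2)) := by
  obtain ⟨c₁, hc₁, h₁⟩ := exists_polyGradSq_lower
  obtain ⟨c₂, hc₂, h₂⟩ := exists_polyGradSq_near_axis
  refine ⟨min (c₁ / 256) (c₂ / 512), by positivity, fun x y u v τ β hτ hβ => ?_⟩
  have hs := polyS_nonneg x u v
  have hR : x ^ 2 + y ^ 2 + u ^ 2 + v ^ 2 = polyS x u v + y ^ 2 := by
    unfold polyS
    ring
  have h₁' := h₁ x y u v
  have h₂' := h₂ x y u v
  rw [hR] at h₁' hβ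
  unfold polyGradSq at h₁'
  set s := polyS x u v
  set p := polyFx x y u v ^ 2 + polyFy x y u v ^ 2 with hp
  set q := (u ^ 2 + v ^ 2) * polyFw x y u v ^ 2 with hq
  have hp0 : 0 ≤ p := by positivity
  have hq0 : 0 ≤ q := by positivity
  have hτ0 : 0 < τ := by
    by_contra h
    push Not at h
    nlinarith
  have hβ0 : 0 < β := by
    by_contra h
    push Not at h
    nlinarith [mul_nonneg (neg_nonneg.mpr h) (show 0 ≤ 1 + (s + y ^ 2) by positivity)]
  have hβ5 : β ^ 5 * (1 + (s + y ^ 2)) ^ 5 = 1 := by rw [← mul_pow, hβ, one_pow]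
  -- For s ≥ 1 both weights are at least 1/256 and the full gradient bound applies. For s < 1 only
  -- the first weight is used, at least 1/16, together with the bound near the axis.
  by_cases h : 1 ≤ s
  · refine (min_le_left _ _).trans ?_
    have h1 : 1 / 2 ≤ s * τ := by nlinarith
    have h2 : (1 / 2) ^ 2 ≤ (s * τ) ^ 2 := pow_le_pow_left₀ (by norm_num) h1 2
    have h3 : 1 / 256 ≤ 2 * τ ^ 5 + (s * τ) ^ 2 / 64 := by
      have : 0 ≤ τ ^ 5 := by positivity
      linarith
    have h4 : 1 / 256 ≤ 3 * y ^ 2 * τ ^ 5 + (s * τ) ^ 2 / 64 := by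
      have : 0 ≤ 3 * y ^ 2 * τ ^ 5 := by positivity
      linarith
    have h5 : c₁ * (1 + (s + y ^ 2)) ^ 5 ≤ (1 + p) + (1 + q) := by
      refine h₁'.trans ?_
      linarith
    calc c₁ / 256 = β ^ 5 * (1 / 256 * (c₁ * (1 + (s + y ^ 2)) ^ 5)) := by
          linear_combination -(c₁ / 256) * hβ5
      _ ≤ β ^ 5 * (1 / 256 * ((1 + p) + (1 + q))) := by gcongr
      _ = β ^ 5 * (1 / 256 * (1 + p) + 1 / 256 * (1 + q)) := by ring
      _ ≤ β ^ 5 * ((2 * τ ^ 5 + (s * τ) ^ 2 / 64) * (1 + p) +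
          (3 * y ^ 2 * τ ^ 5 + (s * τ) ^ 2 / 64) * (1 + q)) := by gcongr
      _ = _ := by rw [hp]; ring
  · push Not at h
    refine (min_le_right _ _).trans ?_
    have h1 : 1 / 2 ≤ τ := by nlinarith
    have h2 : (1 / 2) ^ 5 ≤ τ ^ 5 := pow_le_pow_left₀ (by norm_num) h1 5
    have h3 : 1 / 16 ≤ 2 * τ ^ 5 + (s * τ) ^ 2 / 64 := by
      have : 0 ≤ (s * τ) ^ 2 / 64 := by positivity
      linarith
    have h4 : c₂ * (1 + y ^ 2) ^ 5 ≤ 1 + p := (h₂' h.le).trans_eq (by rw [hp]; ring)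
    have h5 : (1 + (s + y ^ 2)) ^ 5 ≤ 32 * (1 + y ^ 2) ^ 5 := by
      calc (1 + (s + y ^ 2)) ^ 5 ≤ (2 * (1 + y ^ 2)) ^ 5 :=
            pow_le_pow_left₀ (by positivity) (by nlinarith [sq_nonneg y]) 5
        _ = 32 * (1 + y ^ 2) ^ 5 := by ring
    calc c₂ / 512 = β ^ 5 * (1 / 16 * (c₂ * ((1 + (s + y ^ 2)) ^ 5 / 32))) := by
          linear_combination -(c₂ / 512) * hβ5
      _ ≤ β ^ 5 * (1 / 16 * (c₂ * (1 + y ^ 2) ^ 5)) := by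
          gcongr
          linarith
      _ ≤ β ^ 5 * (1 / 16 * (1 + p)) := by gcongr
      _ ≤ β ^ 5 * ((2 * τ ^ 5 + (s * τ) ^ 2 / 64) * (1 + p) +
          (3 * y ^ 2 * τ ^ 5 + (s * τ) ^ 2 / 64) * (1 + q)) := by
          have h6 : 0 ≤ (3 * y ^ 2 * τ ^ 5 + (s * τ) ^ 2 / 64) * (1 + q) := by positivity
          have h7 := mul_le_mul_of_nonneg_right h3 (show 0 ≤ 1 + p by positivity)
          refine mul_le_mul_of_nonneg_left ?_ (by positivity)
          linarith
      _ = _ := by rw [hp]; ring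

/-! ### Symbol classes and the uniform defining function -/

/-- The functions with bounded derivatives that are generated by the two brackets. -/
def bracketAlgebra : Subalgebra ℂ (Cn 3 → ℂ) :=
  Algebra.adjoin ℂ (bracketGenerators realCoord {0, 1, 2, 3} ∪ bracketGenerators realCoord {0, 2, 3})

/-- The bracket in all the coordinates `x, y, u, v`, to the power `-1`. -/
def bracketFull (z : Cn 3) : ℝ := bracketInv realCoord {0, 1, 2, 3} z

/-- The bracket in the coordinates `x, u, v`, to the power `-1`. -/
def bracketPart (z : Cn 3) : ℝ := bracketInv realCoord {0, 2, 3} z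

theorem bracketFull_pos (z : Cn 3) : 0 < bracketFull z := bracketInv_pos _ _ _

theorem bracketPart_pos (z : Cn 3) : 0 < bracketPart z := bracketInv_pos _ _ _

theorem bracketFull_sq (z : Cn 3) : bracketFull z ^ 2 *
    (1 + ((z 0).re ^ 2 + (z 0).im ^ 2 + (z 1).re ^ 2 + (z 1).im ^ 2)) = 1 := by
  have h := bracketInv_sq_mul realCoord {0, 1, 2, 3} z
  rw [Finset.sum_insert (by decide), Finset.sum_insert (by decide), Finset.sum_insert (by decide),
    Finset.sum_singleton] at h
  simp only [realCoord_zero, realCoord_one, realCoord_two, realCoord_three] at h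
  rw [bracketFull]
  linear_combination h

theorem bracketPart_sq (z : Cn 3) : bracketPart z ^ 2 *
    (1 + polyS (z 0).re (z 1).re (z 1).im) = 1 := by
  have h := bracketInv_sq_mul realCoord {0, 2, 3} z
  rw [Finset.sum_insert (by decide), Finset.sum_insert (by decide), Finset.sum_singleton] at h
  simp only [realCoord_zero, realCoord_two, realCoord_three] at h
  rw [bracketPart, polyS]
  linear_combination h

theorem closedUnderPartials_bracketAlgebra :
    ClosedUnderPartials realCoord (bracketAlgebra : Set (Cn 3 → ℂ)) := by
  refine closedUnderPartials_adjoin fun g hg => ?_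
  rcases hg with hg | hg
  · obtain ⟨g', h1, h2⟩ := bracketGenerators_partials realCoord _ hg
    exact ⟨g', fun k => Algebra.adjoin_mono Set.subset_union_left (h1 k), h2⟩
  · obtain ⟨g', h1, h2⟩ := bracketGenerators_partials realCoord _ hg
    exact ⟨g', fun k => Algebra.adjoin_mono Set.subset_union_right (h1 k), h2⟩

theorem bounded_bracketGenerators (U : Set (Cn 3)) :
    ∀ g ∈ bracketGenerators realCoord {0, 1, 2, 3} ∪ bracketGenerators realCoord {0, 2, 3},
      ∃ C : ℝ, ∀ z ∈ U, ‖g z‖ ≤ C := by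
  rintro g (hg | hg)
  · exact ⟨1, fun z _ => bracketGenerators_bounded realCoord _ hg z⟩
  · exact ⟨1, fun z _ => bracketGenerators_bounded realCoord _ hg z⟩

theorem bounded_bracketAlgebra (U : Set (Cn 3)) :
    ∀ g ∈ bracketAlgebra, ∃ C : ℝ, ∀ z ∈ U, ‖g z‖ ≤ C :=
  bounded_adjoin (bounded_bracketGenerators U)

theorem bracketFull_mem : (fun z => (bracketFull z : ℂ)) ∈ bracketAlgebra :=
  Algebra.subset_adjoin (Or.inl (bracketInv_mem _ _))

theorem bracketPart_mem : (fun z => (bracketPart z : ℂ)) ∈ bracketAlgebra :=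
  Algebra.subset_adjoin (Or.inr (bracketInv_mem _ _))

theorem realCoord_mul_bracketFull_mem {k : Fin 6} (hk : k ∈ ({0, 1, 2, 3} : Finset (Fin 6))) :
    (fun z => (realCoord k z : ℂ) * bracketFull z) ∈ bracketAlgebra :=
  Algebra.subset_adjoin (Or.inl (mul_bracketInv_mem _ hk))

/-- `f` times `d` powers of the partial bracket and `e` powers of the full one is in the
algebra. -/
def IsSymbol (d e : ℕ) (f : Cn 3 → ℂ) : Prop :=
  (fun z => f z * (bracketPart z : ℂ) ^ d * (bracketFull z : ℂ) ^ e) ∈ bracketAlgebra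

theorem IsSymbol.of_mem {d e : ℕ} {f g : Cn 3 → ℂ} (hg : g ∈ bracketAlgebra)
    (h : ∀ z, f z * (bracketPart z : ℂ) ^ d * (bracketFull z : ℂ) ^ e = g z) : IsSymbol d e f := by
  rw [IsSymbol, funext h]
  exact hg

theorem IsSymbol.mono {d e d' e' : ℕ} {f : Cn 3 → ℂ} (h : IsSymbol d e f) (hd : d ≤ d')
    (he : e ≤ e') : IsSymbol d' e' f := by
  obtain ⟨a, rfl⟩ := Nat.exists_eq_add_of_le hd
  obtain ⟨b, rfl⟩ := Nat.exists_eq_add_of_le he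
  have h1 := mul_mem h (mul_mem (pow_mem bracketPart_mem a) (pow_mem bracketFull_mem b))
  refine IsSymbol.of_mem h1 fun z => ?_
  simp
  ring

theorem IsSymbol.mul {d e d' e' : ℕ} {f g : Cn 3 → ℂ} (hf : IsSymbol d e f)
    (hg : IsSymbol d' e' g) : IsSymbol (d + d') (e + e') (fun z => f z * g z) := by
  have h1 := mul_mem hf hg
  refine IsSymbol.of_mem h1 fun z => ?_
  simp
  ring

theorem IsSymbol.add {d e : ℕ} {f g : Cn 3 → ℂ} (hf : IsSymbol d e f)
    (hg : IsSymbol d e g) : IsSymbol d e (fun z => f z + g z) := by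
  have h1 := add_mem hf hg
  refine IsSymbol.of_mem h1 fun z => ?_
  simp
  ring

theorem IsSymbol.const_mul {d e : ℕ} {f : Cn 3 → ℂ} (c : ℂ) (hf : IsSymbol d e f) :
    IsSymbol d e (fun z => c * f z) := by
  have h1 := bracketAlgebra.smul_mem hf c
  refine IsSymbol.of_mem h1 fun z => ?_
  simp
  ring

theorem IsSymbol.sub {d e : ℕ} {f g : Cn 3 → ℂ} (hf : IsSymbol d e f)
    (hg : IsSymbol d e g) : IsSymbol d e (fun z => f z - g z) := by
  have h1 := sub_mem hf hg
  refine IsSymbol.of_mem h1 fun z => ?_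
  simp
  ring

theorem isSymbol_const (c : ℂ) : IsSymbol 0 0 (fun _ => c) := by
  have h1 := bracketAlgebra.algebraMap_mem c
  refine IsSymbol.of_mem h1 fun z => ?_
  simp

theorem IsSymbol.pow {d e : ℕ} {f : Cn 3 → ℂ} (hf : IsSymbol d e f) (n : ℕ) :
    IsSymbol (d * n) (e * n) (fun z => f z ^ n) := by
  have h1 := pow_mem hf n
  refine IsSymbol.of_mem h1 fun z => ?_
  simp
  ring

theorem isSymbol_realCoord_full {k : Fin 6} (hk : k ∈ ({0, 1, 2, 3} : Finset (Fin 6))) :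
    IsSymbol 0 1 (fun z => (realCoord k z : ℂ)) := by
  have h1 := realCoord_mul_bracketFull_mem hk
  refine IsSymbol.of_mem h1 fun z => ?_
  simp

theorem isSymbol_realCoord_part {k : Fin 6} (hk : k ∈ ({0, 2, 3} : Finset (Fin 6))) :
    IsSymbol 1 0 (fun z => (realCoord k z : ℂ)) := by
  have h1 : (fun z => (realCoord k z : ℂ) * bracketPart z) ∈ bracketAlgebra :=
    Algebra.subset_adjoin (Or.inr (mul_bracketInv_mem _ hk))
  refine IsSymbol.of_mem h1 fun z => ?_
  simp

theorem isSymbol_re : IsSymbol 0 1 (fun z => ((z 0).re : ℂ)) :=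
  isSymbol_realCoord_full (k := 0) (by decide)

theorem isSymbol_im : IsSymbol 0 1 (fun z => ((z 0).im : ℂ)) :=
  isSymbol_realCoord_full (k := 1) (by decide)

theorem isSymbol_re' : IsSymbol 0 1 (fun z => ((z 1).re : ℂ)) :=
  isSymbol_realCoord_full (k := 2) (by decide)

theorem isSymbol_im' : IsSymbol 0 1 (fun z => ((z 1).im : ℂ)) :=
  isSymbol_realCoord_full (k := 3) (by decide)

theorem isSymbol_polyS : IsSymbol 0 2 (fun z => (polyS (z 0).re (z 1).re (z 1).im : ℂ)) := by
  have h := ((isSymbol_re.pow 2).add (isSymbol_re'.pow 2)).add (isSymbol_im'.pow 2)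
  simpa [polyS] using h

theorem isSymbol_polyS_part : IsSymbol 2 0 (fun z => (polyS (z 0).re (z 1).re (z 1).im : ℂ)) := by
  have h := (((isSymbol_realCoord_part (k := 0) (by decide)).pow 2).add
    ((isSymbol_realCoord_part (k := 2) (by decide)).pow 2)).add
    ((isSymbol_realCoord_part (k := 3) (by decide)).pow 2)
  simpa [polyS] using h

theorem isSymbol_polyFx :
    IsSymbol 0 5 (fun z => (polyFx (z 0).re (z 0).im (z 1).re (z 1).im : ℂ)) := by
  have hx := isSymbol_re
  have hy := isSymbol_im
  have h1 := (((isSymbol_re'.pow 2).add (isSymbol_im'.pow 2)).const_mul 2).mono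
    (d' := 0) (e' := 5) (by norm_num) (by norm_num)
  have h2 := (hy.pow 4).mono (d' := 0) (e' := 5) (by norm_num) (by norm_num)
  have h3 := (hx.mul (isSymbol_polyS.pow 2)).const_mul 2
  have h4 := ((hx.mul isSymbol_polyS).mul (hy.pow 2)).const_mul 4
  have h5 := (hx.pow 5).const_mul (1 / 10)
  have h6 := (hx.pow 3).mul (hy.pow 2)
  have h7 := (hx.mul (hy.pow 4)).const_mul (1 / 2)
  have h := (((((h1.sub h2).add h3).add h4).sub h5).add h6).sub h7
  refine IsSymbol.of_mem h fun z => ?_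
  simp only [polyFx]
  push_cast
  ring

theorem isSymbol_polyFy :
    IsSymbol 0 5 (fun z => (polyFy (z 0).re (z 0).im (z 1).re (z 1).im : ℂ)) := by
  have hx := isSymbol_re
  have hy := isSymbol_im
  have h1 := ((hx.mul (hy.pow 3)).const_mul (-4)).mono (d' := 0) (e' := 5) (by norm_num)
    (by norm_num)
  have h2 := ((isSymbol_polyS.pow 2).mul hy).const_mul 2
  have h3 := ((hx.pow 4).mul hy).const_mul (1 / 2)
  have h4 := (hx.pow 2).mul (hy.pow 3)
  have h5 := (hy.pow 5).const_mul (1 / 10)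
  have h := (((h1.add h2).add h3).sub h4).add h5
  refine IsSymbol.of_mem h fun z => ?_
  simp only [polyFy]
  push_cast
  ring

theorem isSymbol_polyFw :
    IsSymbol 0 4 (fun z => (polyFw (z 0).re (z 0).im (z 1).re (z 1).im : ℂ)) := by
  have h1 := (isSymbol_re.const_mul 4).mono (d' := 0) (e' := 4) (by norm_num) (by norm_num)
  have h2 := (isSymbol_polyS.pow 2).const_mul 2
  have h3 := (isSymbol_polyS.mul (isSymbol_im.pow 2)).const_mul 4
  have h := (h1.add h2).add h3
  refine IsSymbol.of_mem h fun z => ?_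
  simp only [polyFw]
  push_cast
  ring

/-- Charging x, u, v to the partial bracket leaves order two in the full one, from y² only. Order
four in the full bracket would be too much once the second weight contributes its extra factor y².
-/
theorem isSymbol_polyFw_part :
    IsSymbol 4 2 (fun z => (polyFw (z 0).re (z 0).im (z 1).re (z 1).im : ℂ)) := by
  have h1 := ((isSymbol_realCoord_part (k := 0) (by decide)).const_mul 4).mono
    (d' := 4) (e' := 2) (by norm_num) (by norm_num)
  have h2 := ((isSymbol_polyS_part.pow 2).const_mul 2).mono
    (d' := 4) (e' := 2) (by norm_num) (by norm_num)
  have h3 := ((isSymbol_polyS_part.mul (isSymbol_im.pow 2)).const_mul 4).mono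
    (d' := 4) (e' := 2) (by norm_num) (by norm_num)
  have h := (h1.add h2).add h3
  refine IsSymbol.of_mem h fun z => ?_
  simp only [polyFw, realCoord_zero]
  push_cast
  ring

/-- The real partial derivatives of `exampleFun`. -/
def examplePartial : Fin 6 → Cn 3 → ℝ
  | 0 => fun z => polyFx (z 0).re (z 0).im (z 1).re (z 1).im
  | 1 => fun z => polyFy (z 0).re (z 0).im (z 1).re (z 1).im
  | 2 => fun z => (z 1).re * polyFw (z 0).re (z 0).im (z 1).re (z 1).im
  | 3 => fun z => (z 1).im * polyFw (z 0).re (z 0).im (z 1).re (z 1).im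
  | 4 => fun _ => 0
  | 5 => fun _ => -1

theorem isSymbol_examplePartial (k : Fin 6) : IsSymbol 0 5 (fun z => (examplePartial k z : ℂ)) := by
  fin_cases k
  · exact isSymbol_polyFx
  · exact isSymbol_polyFy
  · simpa [examplePartial] using isSymbol_re'.mul isSymbol_polyFw
  · simpa [examplePartial] using isSymbol_im'.mul isSymbol_polyFw
  · simpa [examplePartial] using (isSymbol_const 0).mono (Nat.zero_le 0) (Nat.zero_le 5)
  · simpa [examplePartial] using (isSymbol_const (-1)).mono (Nat.zero_le 0) (Nat.zero_le 5)

theorem hasPartials_exampleFun :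
    HasPartials realCoord (fun z => (exampleFun z : ℂ)) (fun k z => examplePartial k z) := by
  intro z
  refine (ofRealCLM.hasFDerivAt.comp z (hasFDerivAt_exampleFun z)).congr_fderiv ?_
  ext v
  rw [sum_smul_ofReal_apply, Fin.sum_univ_six]
  simp [examplePartial]
  ring

/-! ### The normalized defining function and its derivatives. -/

/-- The normalized defining function. -/
def normalizedFun (z : Cn 3) : ℝ := exampleFun z * bracketFull z ^ 5

/-- The real partial derivatives of `normalizedFun`. -/
def normalizedPartial (k : Fin 6) (z : Cn 3) : ℝ :=
  examplePartial k z * bracketFull z ^ 5 -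
    if k ∈ ({0, 1, 2, 3} : Finset (Fin 6)) then
      5 * normalizedFun z * (bracketFull z * (realCoord k z * bracketFull z)) else 0

theorem hasPartials_normalizedFun :
    HasPartials realCoord (fun z => (normalizedFun z : ℂ)) (fun k z => normalizedPartial k z) := by
  have h := hasPartials_exampleFun.mul ((hasPartials_bracketInv realCoord {0, 1, 2, 3}).pow 5)
  intro z
  refine ((h z).congr_fderiv ?_).congr_of_eventuallyEq (Filter.Eventually.of_forall fun w => ?_)
  · ext v
    rw [sum_smul_ofReal_apply, sum_smul_ofReal_apply]
    refine Finset.sum_congr rfl fun k _ => ?_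
    congr 1
    by_cases hk : k ∈ ({0, 1, 2, 3} : Finset (Fin 6))
    · simp only [normalizedPartial, normalizedFun, hk, if_true, bracketFull, Pi.add_apply,
        Pi.mul_apply, Pi.pow_apply, Nat.cast_ofNat, Pi.ofNat_apply]
      push_cast
      ring
    · simp only [normalizedPartial, hk, if_false, bracketFull, Pi.add_apply,
        Pi.mul_apply, Pi.pow_apply, Pi.zero_apply]
      push_cast
      ring
  · simp [normalizedFun, bracketFull]

theorem hasFDerivAt_normalizedFun (z : Cn 3) :
    HasFDerivAt normalizedFun (∑ k, normalizedPartial k z • realCoord k) z := by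
  have h := reCLM.hasFDerivAt.comp z (hasPartials_normalizedFun z)
  refine (h.congr_fderiv ?_).congr_of_eventuallyEq (Filter.Eventually.of_forall fun w => ?_)
  · ext v
    rw [ContinuousLinearMap.comp_apply, sum_smul_ofReal_apply]
    simp
  · simp

/-- The partials of `normalizedFun` are elements of `bracketAlgebra` plus multiples of
`normalizedFun` by such elements. Adjoining the function itself gives an algebra closed under
partials, which is bounded wherever the function is. -/
theorem hasFiniteCmNorm_normalizedFun {U : Set (Cn 3)} (hU : IsOpen U) {C : ℝ}
    (hC : ∀ z ∈ U, |normalizedFun z| ≤ C) : HasFiniteCmNorm ⊤ normalizedFun U := by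
  set S := bracketGenerators realCoord {0, 1, 2, 3} ∪ bracketGenerators realCoord {0, 2, 3}
  have hmono : ∀ g ∈ bracketAlgebra,
      g ∈ Algebra.adjoin ℂ (insert (fun z => (normalizedFun z : ℂ)) S) :=
    fun g hg => Algebra.adjoin_mono (Set.subset_insert _ _) hg
  have hself : (fun z => (normalizedFun z : ℂ)) ∈
      Algebra.adjoin ℂ (insert (fun z => (normalizedFun z : ℂ)) S) :=
    Algebra.subset_adjoin (Set.mem_insert _ _)
  have hclosed : ClosedUnderPartials realCoord
      (Algebra.adjoin ℂ (insert (fun z => (normalizedFun z : ℂ)) S) : Set (Cn 3 → ℂ)) := by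
    refine closedUnderPartials_adjoin_insert closedUnderPartials_bracketAlgebra ?_
      hasPartials_normalizedFun
    intro k
    have h1 : (fun z => (examplePartial k z : ℂ) * (bracketFull z : ℂ) ^ 5) ∈ bracketAlgebra := by
      have := isSymbol_examplePartial k
      simpa [IsSymbol] using this
    by_cases hk : k ∈ ({0, 1, 2, 3} : Finset (Fin 6))
    · have h2 := sub_mem (hmono _ h1) (mul_mem (Subalgebra.smul_mem _ hself 5)
        (hmono _ (mul_mem bracketFull_mem (realCoord_mul_bracketFull_mem hk))))
      convert h2 using 1
      funext z
      simp only [normalizedPartial, hk, if_true, Pi.sub_apply, Pi.mul_apply, Pi.smul_apply,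
        smul_eq_mul]
      push_cast
      ring
    · convert hmono _ h1 using 1
      funext z
      simp only [normalizedPartial, hk, if_false]
      push_cast
      ring
  have hbd : ∀ g ∈ Algebra.adjoin ℂ (insert (fun z => (normalizedFun z : ℂ)) S),
      ∃ C : ℝ, ∀ z ∈ U, ‖g z‖ ≤ C := by
    refine bounded_adjoin ?_
    rintro g (rfl | hg)
    · refine ⟨C, fun z hz => ?_⟩
      rw [norm_real]
      exact hC z hz
    · exact bounded_bracketGenerators U g hg
  obtain ⟨hc, hb⟩ := hasFiniteCmNorm_of_mem hclosed hbd hself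
  have he : normalizedFun = reCLM ∘ fun z => (normalizedFun z : ℂ) := by
    funext z
    simp
  refine ⟨?_, fun i hi => ?_⟩
  · rw [he]
    exact reCLM.contDiff.comp_contDiffOn hc
  · obtain ⟨D, hD⟩ := hb i hi
    refine ⟨‖reCLM‖ * D, fun z hz => ?_⟩
    rw [he]
    refine (reCLM.norm_iteratedFDeriv_comp_left (hc.contDiffAt (hU.mem_nhds hz))
      (WithTop.coe_le_coe.mpr hi)).trans ?_
    exact mul_le_mul_of_nonneg_left (hD z hz) (norm_nonneg _)

/-! ### Diagonalization of the Levi form. -/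

/-- Existence of Levi eigenvalues for a Levi form that is hermitian on the tangent space. -/
theorem exists_isLeviEigenvalues {n : ℕ} {ρ : Cn (n + 1) → ℝ} {z : Cn (n + 1)}
    {i : Fin (n + 1)} (hr : complexGradient ρ z i ≠ 0)
    (hherm : ∀ L M : Cn (n + 1), ∑ j, complexGradient ρ z j * L j = 0 →
      ∑ j, complexGradient ρ z j * M j = 0 →
      leviForm (complexHessian ρ z) L M =
        (starRingEnd ℂ) (leviForm (complexHessian ρ z) M L)) :
    ∃ μ : Fin (n + 1 - 1) → ℝ, IsLeviEigenvalues ρ z μ := by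
  set H := complexHessian ρ z with hH
  let w : Cn (n + 1) := WithLp.toLp 2 fun j => (starRingEnd ℂ) (complexGradient ρ z j)
  have hw : w ≠ 0 := by
    intro h
    have : w i = 0 := by rw [h]; rfl
    simp [w] at this
    exact hr this
  let T : Submodule ℂ (Cn (n + 1)) := (Submodule.span ℂ {w})ᗮ
  have hT : ∀ L ∈ T, ∑ j, complexGradient ρ z j * L j = 0 := by
    intro L hL
    have h := Submodule.mem_orthogonal_singleton_iff_inner_right.mp hL
    rw [PiLp.inner_apply] at h
    rw [← h]
    refine Finset.sum_congr rfl fun j _ => ?_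
    simp [w, mul_comm]
  have : Fact (Module.finrank ℂ (Cn (n + 1)) = n + 1) := ⟨by simp⟩
  have hfr : Module.finrank ℂ T = n := Submodule.finrank_orthogonal_span_singleton hw
  let A₀ : Cn (n + 1) →ₗ[ℂ] Cn (n + 1) := Matrix.toEuclideanLin H.transpose
  have hA₀ : ∀ L M, inner ℂ M (A₀ L) = leviForm H L M := by
    intro L M
    rw [PiLp.inner_apply, leviForm, Finset.sum_comm]
    refine Finset.sum_congr rfl fun k _ => ?_
    simp only [A₀, Matrix.toLpLin_apply, Matrix.mulVec, dotProduct, Matrix.transpose_apply,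
      RCLike.inner_apply, Finset.sum_mul]
  -- The compression of the transposed Hessian to the complex tangent space represents the Levi
  -- form, and is symmetric even if the Hessian is hermitian only there.
  let A : T →ₗ[ℂ] T :=
    (T.orthogonalProjectionOnto : Cn (n + 1) →ₗ[ℂ] T) ∘ₗ A₀ ∘ₗ T.subtype
  have hA : ∀ L M : T, inner ℂ M (A L) = leviForm H L M := by
    intro L M
    rw [← hA₀]
    exact Submodule.inner_orthogonalProjectionOnto_eq_of_mem_left M (A₀ L)
  have hsym : A.IsSymmetric := by
    intro L M
    rw [hA, ← inner_conj_symm, hA]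
    exact (hherm _ _ (hT _ M.2) (hT _ L.2)).symm
  let e := hsym.eigenvectorBasis hfr
  -- `eigenvalues` is decreasing, so the index is reversed.
  refine ⟨fun a => hsym.eigenvalues hfr (Fin.rev a), ?_, fun a => (e (Fin.rev a) : Cn (n + 1)),
    ?_, ?_, ?_⟩
  · intro a b hab
    exact hsym.eigenvalues_antitone hfr (Fin.rev_le_rev.mpr hab)
  · have h1 : Orthonormal ℂ fun a : Fin n => (e a : Cn (n + 1)) :=
      e.orthonormal.comp_linearIsometry T.subtypeₗᵢ
    exact h1.comp _ Fin.rev_injective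
  · intro a
    exact hT _ (e (Fin.rev a)).2
  · intro a b
    change leviForm H (e (Fin.rev a)) (e (Fin.rev b)) = _
    rw [← hA, hsym.apply_eigenvectorBasis hfr, inner_smul_right,
      orthonormal_iff_ite.mp e.orthonormal]
    by_cases hab : a = b
    · subst hab
      simp
    · have : ¬ b.rev = a.rev := fun h => hab (Fin.rev_injective h).symm
      rw [if_neg this, if_neg hab, mul_zero]

theorem leviForm_exampleHess_conj (z L M : Cn 3) :
    leviForm (exampleHess z) L M = (starRingEnd ℂ) (leviForm (exampleHess z) M L) := by
  simp [leviForm, Fin.sum_univ_three, exampleHess]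
  ring

theorem IsUniformDefiningFunction.exists_isLeviEigenvalues {m : ℕ∞} (hm : 2 ≤ m) {ρ : Cn 3 → ℝ}
    (h : IsUniformDefiningFunction m exampleDomain ρ) {z : Cn 3}
    (hz : z ∈ frontier exampleDomain) : ∃ μ : Fin (3 - 1) → ℝ, IsLeviEigenvalues ρ z μ := by
  obtain ⟨κ, hκ, hgrad, hlevi⟩ := h.exists_factor hm hz
  have hκc : (κ : ℂ) ≠ 0 := by exact_mod_cast hκ.ne'
  have ht : ∀ L : Cn 3, ∑ j, complexGradient ρ z j * L j = 0 →
      ∑ j, exampleGrad z j * L j = 0 := by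
    intro L hL
    simp_rw [hgrad, mul_assoc] at hL
    rw [← Finset.mul_sum] at hL
    exact (mul_eq_zero.mp hL).resolve_left hκc
  refine _root_.exists_isLeviEigenvalues (n := 2) (i := 2) ?_ fun L M hL hM => ?_
  · rw [hgrad]
    exact mul_ne_zero hκc (exampleGrad_two_ne_zero z)
  · rw [hlevi _ _ (ht L hL) (ht M hM), hlevi _ _ (ht M hM) (ht L hL), map_mul, conj_ofReal,
      ← leviForm_exampleHess_conj]

/-! ### Gradient and distance bounds for the normalized defining function. -/

/-- The basis dual to `realCoord`. -/
def dualVec : Fin 6 → Cn 3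
  | 0 => EuclideanSpace.single 0 1
  | 1 => EuclideanSpace.single 0 I
  | 2 => EuclideanSpace.single 1 1
  | 3 => EuclideanSpace.single 1 I
  | 4 => EuclideanSpace.single 2 1
  | 5 => EuclideanSpace.single 2 I

theorem norm_dualVec (k : Fin 6) : ‖dualVec k‖ = 1 := by
  fin_cases k <;> simp [dualVec]

theorem fderiv_normalizedFun_dualVec (k : Fin 6) (z : Cn 3) :
    fderiv ℝ normalizedFun z (dualVec k) = normalizedPartial k z := by
  rw [(hasFDerivAt_normalizedFun z).fderiv, Fin.sum_univ_six]
  fin_cases k <;> simp [dualVec]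

theorem abs_normalizedPartial_le (k : Fin 6) (z : Cn 3) :
    |normalizedPartial k z| ≤ ‖fderiv ℝ normalizedFun z‖ := by
  have h := (fderiv ℝ normalizedFun z).le_opNorm (dualVec k)
  rwa [fderiv_normalizedFun_dualVec, norm_dualVec, mul_one, Real.norm_eq_abs] at h

/-- The correction term in `normalizedPartial`. -/
theorem abs_normalizedPartial_sub_le (k : Fin 6) (z : Cn 3) :
    |examplePartial k z * bracketFull z ^ 5 - normalizedPartial k z| ≤ 5 * |normalizedFun z| := by
  rw [normalizedPartial, sub_sub_cancel]
  split_ifs with hk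
  · have h1 := abs_mul_bracketInv_le_one realCoord hk z
    have h2 : |bracketFull z| ≤ 1 := by
      rw [abs_of_pos (bracketFull_pos z)]
      exact bracketInv_le_one _ _ _
    rw [abs_mul, abs_mul, abs_mul, abs_of_pos (show (0 : ℝ) < 5 by norm_num)]
    have h3 : |bracketFull z| * |realCoord k z * bracketFull z| ≤ 1 * 1 :=
      mul_le_mul h2 h1 (abs_nonneg _) (by norm_num)
    have h4 : 0 ≤ 5 * |normalizedFun z| := by positivity
    nlinarith
  · rw [abs_zero]
    positivity

/-- Each normalized partial of `exampleFun` differs from that of `normalizedFun` by at most 5 times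
`|normalizedFun|`. Squaring costs 2 and 50 for each of the six coordinates, hence 12 and 300. -/
theorem exists_fderiv_normalizedFun_lower : ∃ c : ℝ, 0 < c ∧ ∀ z : Cn 3,
    c ≤ 12 * ‖fderiv ℝ normalizedFun z‖ ^ 2 + 300 * normalizedFun z ^ 2 := by
  obtain ⟨c, hc, h⟩ := exists_polyGradSq_lower
  refine ⟨c, hc, fun z => ?_⟩
  have hz := h (z 0).re (z 0).im (z 1).re (z 1).im
  have hb := bracketFull_sq z
  set b := bracketFull z with hbdef
  have hb10 : b ^ 10 * (1 + ((z 0).re ^ 2 + (z 0).im ^ 2 + (z 1).re ^ 2 + (z 1).im ^ 2)) ^ 5 = 1 := by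
    calc _ = (b ^ 2 * (1 + ((z 0).re ^ 2 + (z 0).im ^ 2 + (z 1).re ^ 2 + (z 1).im ^ 2))) ^ 5 := by
          ring
      _ = 1 := by rw [hb, one_pow]
  have hk : ∀ k, (examplePartial k z * b ^ 5) ^ 2 ≤
      2 * ‖fderiv ℝ normalizedFun z‖ ^ 2 + 50 * normalizedFun z ^ 2 := by
    intro k
    have h1 := abs_normalizedPartial_le k z
    have h2 := abs_normalizedPartial_sub_le k z
    have h3 : normalizedPartial k z ^ 2 ≤ ‖fderiv ℝ normalizedFun z‖ ^ 2 :=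
      sq_le_sq' (neg_le_of_abs_le h1) (le_of_abs_le h1)
    have h4 : (examplePartial k z * b ^ 5 - normalizedPartial k z) ^ 2 ≤
        25 * normalizedFun z ^ 2 := by
      rw [← sq_abs, ← sq_abs (normalizedFun z)]
      refine (pow_le_pow_left₀ (abs_nonneg _) h2 2).trans_eq ?_
      ring
    nlinarith [sq_nonneg (examplePartial k z * b ^ 5 - 2 * normalizedPartial k z)]
  have hsum : ∑ k, (examplePartial k z * b ^ 5) ^ 2 =
      b ^ 10 * polyGradSq (z 0).re (z 0).im (z 1).re (z 1).im := by
    rw [Fin.sum_univ_six]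
    simp only [examplePartial, polyGradSq]
    ring
  have h5 : c ≤ b ^ 10 * polyGradSq (z 0).re (z 0).im (z 1).re (z 1).im := by
    calc c = b ^ 10 * (c * (1 + ((z 0).re ^ 2 + (z 0).im ^ 2 + (z 1).re ^ 2 +
            (z 1).im ^ 2)) ^ 5) := by linear_combination -c * hb10
      _ ≤ _ := mul_le_mul_of_nonneg_left hz (by positivity)
  rw [← hsum, Fin.sum_univ_six] at h5
  linarith [hk 0, hk 1, hk 2, hk 3, hk 4, hk 5]

theorem exists_fderiv_normalizedFun_upper : ∃ C : ℝ, 0 < C ∧ ∀ z : Cn 3,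
    ‖fderiv ℝ normalizedFun z‖ ≤ C * (1 + |normalizedFun z|) := by
  have h1 : ∀ k, ∃ C : ℝ, ∀ z : Cn 3, |examplePartial k z * bracketFull z ^ 5| ≤ C := by
    intro k
    obtain ⟨C, hC⟩ := bounded_bracketAlgebra Set.univ _ (isSymbol_examplePartial k)
    refine ⟨C, fun z => ?_⟩
    have := hC z (Set.mem_univ z)
    rw [pow_zero, mul_one, ← ofReal_pow, ← ofReal_mul, norm_real, Real.norm_eq_abs] at this
    exact this
  choose C hC using h1
  have hC0 : ∀ k, 0 ≤ C k := fun k => (abs_nonneg _).trans (hC k 0)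
  refine ⟨∑ k, (C k + 5) * ‖realCoord k‖ + 1, ?_, fun z => ?_⟩
  · have : 0 ≤ ∑ k, (C k + 5) * ‖realCoord k‖ := Finset.sum_nonneg fun k _ =>
      mul_nonneg (by linarith [hC0 k]) (norm_nonneg _)
    linarith
  · have h0 : 0 ≤ |normalizedFun z| := abs_nonneg _
    rw [(hasFDerivAt_normalizedFun z).fderiv]
    refine (norm_sum_le _ _).trans ?_
    have h2 : ∀ k, ‖normalizedPartial k z • realCoord k‖ ≤
        (C k + 5) * ‖realCoord k‖ * (1 + |normalizedFun z|) := by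
      intro k
      rw [norm_smul, Real.norm_eq_abs]
      have h3 : |normalizedPartial k z| ≤ C k + 5 * |normalizedFun z| := by
        have h4 := abs_sub_abs_le_abs_sub (normalizedPartial k z)
          (examplePartial k z * bracketFull z ^ 5)
        rw [abs_sub_comm (normalizedPartial k z)] at h4
        linarith [hC k z, abs_normalizedPartial_sub_le k z]
      have h5 : |normalizedPartial k z| ≤ (C k + 5) * (1 + |normalizedFun z|) := by
        nlinarith [mul_nonneg (hC0 k) h0]
      calc _ ≤ (C k + 5) * (1 + |normalizedFun z|) * ‖realCoord k‖ :=
            mul_le_mul_of_nonneg_right h5 (norm_nonneg _)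
        _ = _ := by ring
    refine (Finset.sum_le_sum fun k _ => h2 k).trans ?_
    rw [← Finset.sum_mul]
    exact mul_le_mul_of_nonneg_right (by linarith) (by linarith)

/-- The gradient of `normalizedFun` is controlled only by 1 + `|normalizedFun|`, so the function
need not be Lipschitz; its arctangent is. This separates its level sets by a positive distance. -/
theorem exists_dist_lower_of_normalizedFun : ∃ C : ℝ, 0 < C ∧ ∀ p q : Cn 3,
    |Real.arctan (normalizedFun q) - Real.arctan (normalizedFun p)| ≤ C * dist p q := by
  obtain ⟨C, hC, h⟩ := exists_fderiv_normalizedFun_upper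
  refine ⟨2 * C, by positivity, fun p q => ?_⟩
  have hd : ∀ z, HasFDerivAt (fun z => Real.arctan (normalizedFun z))
      ((1 / (1 + normalizedFun z ^ 2)) • fderiv ℝ normalizedFun z) z := fun z =>
    (hasFDerivAt_normalizedFun z).differentiableAt.hasFDerivAt.arctan
  have hb : ∀ z ∈ (Set.univ : Set (Cn 3)),
      ‖(1 / (1 + normalizedFun z ^ 2)) • fderiv ℝ normalizedFun z‖ ≤ 2 * C := by
    intro z _
    have h1 : 0 < 1 + normalizedFun z ^ 2 := by positivity
    rw [norm_smul, Real.norm_of_nonneg (by positivity), one_div, inv_mul_le_iff₀ h1]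
    refine (h z).trans ?_
    have h2 : 1 + |normalizedFun z| ≤ 2 * (1 + normalizedFun z ^ 2) := by
      rw [← sq_abs]
      nlinarith [sq_nonneg (|normalizedFun z| - 1)]
    nlinarith
  have := Convex.norm_image_sub_le_of_norm_hasFDerivWithin_le
    (fun z _ => (hd z).hasFDerivWithinAt) hb convex_univ (Set.mem_univ p) (Set.mem_univ q)
  rwa [Real.norm_eq_abs, ← dist_eq_norm, dist_comm] at this

theorem isUniformDefiningFunction_normalizedFun :
    IsUniformDefiningFunction ⊤ exampleDomain normalizedFun := by
  have hzero : frontier exampleDomain = {z | normalizedFun z = 0} := by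
    rw [frontier_exampleDomain]
    ext z
    have := (bracketFull_pos z).ne'
    simp [normalizedFun, this]
  refine ⟨?_, hzero, ?_⟩
  · rw [exampleDomain_eq]
    ext z
    have hp : 0 < bracketFull z ^ 5 := pow_pos (bracketFull_pos z) 5
    refine ⟨fun h => mul_neg_of_neg_of_pos h hp, fun h => ?_⟩
    by_contra hc
    exact absurd h (not_lt.mpr (mul_nonneg (not_lt.mp hc) hp.le))
  · obtain ⟨c, hc, hlow⟩ := exists_fderiv_normalizedFun_lower
    obtain ⟨C, hC, hdist⟩ := exists_dist_lower_of_normalizedFun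
    have hcont : Continuous normalizedFun :=
      continuous_iff_continuousAt.mpr fun z => (hasFDerivAt_normalizedFun z).continuousAt
    -- On the tube of width δ the term 300 · `normalizedFun`² is at most c/2, which leaves c/24 as a
    -- lower bound for the squared gradient.
    set δ : ℝ := Real.sqrt (c / 600) with hδ
    have hδ0 : 0 < δ := Real.sqrt_pos.mpr (by positivity)
    have hδ2 : δ ^ 2 = c / 600 := Real.sq_sqrt (by positivity)
    have hU : IsOpen {z | |normalizedFun z| < δ} := isOpen_lt hcont.abs continuous_const
    refine ⟨{z | |normalizedFun z| < δ}, ⟨hU, ?_, Real.arctan δ / C, ?_, ?_⟩,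
      hasFiniteCmNorm_normalizedFun hU (fun z hz => le_of_lt hz), Real.sqrt (c / 24), ?_, ?_⟩
    · intro z hz
      rw [hzero] at hz
      have hz' : normalizedFun z = 0 := hz
      simp [hz', hδ0]
    · exact div_pos (Real.arctan_pos.mpr hδ0) hC
    · intro p hp q hq
      rw [hzero] at hp
      have hp' : normalizedFun p = 0 := hp
      have hq' : |normalizedFun q| = δ := frontier_lt_subset_eq hcont.abs continuous_const hq
      have h := hdist p q
      rw [hp', Real.arctan_zero, sub_zero] at h
      have h2 : |Real.arctan (normalizedFun q)| = Real.arctan δ := by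
        rcases abs_choice (normalizedFun q) with h3 | h3
        · rw [h3] at hq'
          rw [hq', abs_of_pos (Real.arctan_pos.mpr hδ0)]
        · rw [h3] at hq'
          rw [← hq', Real.arctan_neg, ← abs_neg, abs_of_pos]
          rw [← Real.arctan_neg, hq']
          exact Real.arctan_pos.mpr hδ0
      rw [h2] at h
      rw [div_le_iff₀ hC]
      linarith
    · exact Real.sqrt_pos.mpr (by positivity)
    · intro z hz
      have hz' : normalizedFun z ^ 2 ≤ δ ^ 2 := by
        rw [← sq_abs]
        exact pow_le_pow_left₀ (abs_nonneg _) (le_of_lt hz) 2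
      refine Real.sqrt_le_iff.mpr ⟨norm_nonneg _, ?_⟩
      have := hlow z
      rw [hδ2] at hz'
      linarith

/-! ### The admissible tensor -/

/-- The coefficient of the positive tensor along the first tangent vector. -/
def weightOne (z : Cn 3) : ℝ :=
  2 * (bracketPart z ^ 2) ^ 5 +
    (polyS (z 0).re (z 1).re (z 1).im * bracketPart z ^ 2) ^ 2 / 64

/-- The coefficient of the positive tensor along the second tangent vector. -/
def weightTwo (z : Cn 3) : ℝ :=
  3 * (z 0).im ^ 2 * (bracketPart z ^ 2) ^ 5 +
    (polyS (z 0).re (z 1).re (z 1).im * bracketPart z ^ 2) ^ 2 / 64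

theorem weightOne_nonneg (z : Cn 3) : 0 ≤ weightOne z := by
  unfold weightOne
  have := (bracketPart_pos z).le
  positivity

theorem weightTwo_nonneg (z : Cn 3) : 0 ≤ weightTwo z := by
  unfold weightTwo
  have := (bracketPart_pos z).le
  positivity

/-- A positive tangential tensor with nonnegative trace against the Levi form. -/
def positiveTensor (z : Cn 3) : Matrix (Fin 3) (Fin 3) ℂ :=
  Matrix.of fun k j => ((bracketFull z ^ 10 : ℝ) : ℂ) *
    (weightOne z * ((starRingEnd ℂ) (tangentFrame (exampleGrad z) 0 k) *
        tangentFrame (exampleGrad z) 0 j) +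
      weightTwo z * ((starRingEnd ℂ) (tangentFrame (exampleGrad z) 1 k) *
        tangentFrame (exampleGrad z) 1 j))

theorem isHermitian_positiveTensor (z : Cn 3) : (positiveTensor z).IsHermitian := by
  ext k j
  simp only [Matrix.conjTranspose_apply, positiveTensor, Matrix.of_apply, RCLike.star_def, map_mul,
    map_add, conj_conj, conj_ofReal]
  ring

theorem sum_positiveTensor_mul (z : Cn 3) (k : Fin 3) :
    ∑ j, positiveTensor z k j * exampleGrad z j = 0 := by
  have h := sum_mul_tangentFrame (exampleGrad_two_ne_zero z)
  have h0 := h 0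
  have h1 := h 1
  rw [Fin.sum_univ_three] at h0 h1 ⊢
  simp only [positiveTensor, Matrix.of_apply]
  linear_combination ((bracketFull z ^ 10 : ℝ) : ℂ) * weightOne z *
      (starRingEnd ℂ) (tangentFrame (exampleGrad z) 0 k) * h0 +
    ((bracketFull z ^ 10 : ℝ) : ℂ) * weightTwo z *
      (starRingEnd ℂ) (tangentFrame (exampleGrad z) 1 k) * h1

theorem tangentFrame_zero_two (z : Cn 3) :
    tangentFrame (exampleGrad z) 0 2 = 2 * I * exampleGrad z 0 := by
  change -exampleGrad z 0 / exampleGrad z 2 = _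
  rw [exampleGrad_two]
  field_simp
  linear_combination -exampleGrad z 0 * I_sq

theorem tangentFrame_one_two (z : Cn 3) :
    tangentFrame (exampleGrad z) 1 2 = 2 * I * exampleGrad z 1 := by
  change -exampleGrad z 1 / exampleGrad z 2 = _
  rw [exampleGrad_two]
  field_simp
  linear_combination -exampleGrad z 1 * I_sq

theorem normSq_exampleGrad_zero (z : Cn 3) : 4 * normSq (exampleGrad z 0) =
    polyFx (z 0).re (z 0).im (z 1).re (z 1).im ^ 2 +
      polyFy (z 0).re (z 0).im (z 1).re (z 1).im ^ 2 := by
  simp [exampleGrad, normSq_apply]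
  ring

theorem normSq_exampleGrad_one (z : Cn 3) : 4 * normSq (exampleGrad z 1) =
    ((z 1).re ^ 2 + (z 1).im ^ 2) * polyFw (z 0).re (z 0).im (z 1).re (z 1).im ^ 2 := by
  simp [exampleGrad, normSq_apply]
  ring

theorem vecNormSq_tangentFrame_zero (z : Cn 3) :
    vecNormSq (fun j => tangentFrame (exampleGrad z) 0 j) =
      1 + polyFx (z 0).re (z 0).im (z 1).re (z 1).im ^ 2 +
        polyFy (z 0).re (z 0).im (z 1).re (z 1).im ^ 2 := by
  rw [vecNormSq, Fin.sum_univ_three, tangentFrame_zero_two]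
  have h := normSq_exampleGrad_zero z
  have e0 : tangentFrame (exampleGrad z) 0 0 = 1 := rfl
  have e1 : tangentFrame (exampleGrad z) 0 1 = 0 := rfl
  rw [e0, e1, map_mul, map_mul, normSq_I, normSq_ofNat, map_one, map_zero]
  linarith

theorem vecNormSq_tangentFrame_one (z : Cn 3) :
    vecNormSq (fun j => tangentFrame (exampleGrad z) 1 j) =
      1 + ((z 1).re ^ 2 + (z 1).im ^ 2) *
        polyFw (z 0).re (z 0).im (z 1).re (z 1).im ^ 2 := by
  rw [vecNormSq, Fin.sum_univ_three, tangentFrame_one_two]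
  have h := normSq_exampleGrad_one z
  have e0 : tangentFrame (exampleGrad z) 1 0 = 0 := rfl
  have e1 : tangentFrame (exampleGrad z) 1 1 = 1 := rfl
  rw [e0, e1, map_mul, map_mul, normSq_I, normSq_ofNat, map_one, map_zero]
  linarith

theorem vecNormSq_exampleGrad (z : Cn 3) :
    4 * vecNormSq (exampleGrad z) = polyGradSq (z 0).re (z 0).im (z 1).re (z 1).im := by
  rw [vecNormSq, Fin.sum_univ_three, exampleGrad_two]
  have h0 := normSq_exampleGrad_zero z
  have h1 := normSq_exampleGrad_one z
  have h2 : normSq (I / 2) = 1 / 4 := by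
    rw [map_div₀, normSq_I, normSq_ofNat]
    norm_num
  rw [h2, polyGradSq]
  linarith

/-- The trace of `positiveTensor`. -/
def tensorTrace (z : Cn 3) : ℝ :=
  bracketFull z ^ 10 * (weightOne z * vecNormSq (fun j => tangentFrame (exampleGrad z) 0 j) +
    weightTwo z * vecNormSq (fun j => tangentFrame (exampleGrad z) 1 j))

theorem trace_positiveTensor (z : Cn 3) : (positiveTensor z).trace = tensorTrace z := by
  have h0 := sum_mul_conj_eq_vecNormSq fun j => tangentFrame (exampleGrad z) 0 j
  have h1 := sum_mul_conj_eq_vecNormSq fun j => tangentFrame (exampleGrad z) 1 j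
  rw [tensorTrace]
  push_cast
  rw [← h0, ← h1]
  simp only [Matrix.trace, Matrix.diag_apply, positiveTensor, Matrix.of_apply, Fin.sum_univ_three]
  push_cast
  ring

theorem exists_tensorTrace_lower : ∃ c : ℝ, 0 < c ∧ ∀ z, c ≤ tensorTrace z := by
  obtain ⟨c, hc, h⟩ := exists_weighted_trace_lower
  refine ⟨c, hc, fun z => ?_⟩
  refine (h (z 0).re (z 0).im (z 1).re (z 1).im _ _ (bracketPart_sq z)
    (bracketFull_sq z)).trans_eq ?_
  rw [tensorTrace, vecNormSq_tangentFrame_zero, vecNormSq_tangentFrame_one, weightOne, weightTwo]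
  ring

theorem re_sum_positiveTensor_nonneg (z : Cn 3) :
    0 ≤ (∑ j, ∑ k, positiveTensor z k j * exampleHess z j k).re := by
  rw [re_sum_mul_exampleHess (isHermitian_positiveTensor z)]
  have h := weighted_polyHess_nonneg (z 0).re (z 0).im (z 1).re (z 1).im _ (bracketPart_sq z)
  have e00 : tangentFrame (exampleGrad z) 0 0 = 1 := rfl
  have e01 : tangentFrame (exampleGrad z) 0 1 = 0 := rfl
  have e10 : tangentFrame (exampleGrad z) 1 0 = 0 := rfl
  have e11 : tangentFrame (exampleGrad z) 1 1 = 1 := rfl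
  have h00 : positiveTensor z 0 0 = ((bracketFull z ^ 10 * weightOne z : ℝ) : ℂ) := by
    simp only [positiveTensor, Matrix.of_apply, e00, e10]
    simp
  have h11 : positiveTensor z 1 1 = ((bracketFull z ^ 10 * weightTwo z : ℝ) : ℂ) := by
    simp only [positiveTensor, Matrix.of_apply, e01, e11]
    simp
  have h10 : positiveTensor z 1 0 = 0 := by
    simp only [positiveTensor, Matrix.of_apply, e00, e01, e10, e11]
    simp
  rw [h00, h11, h10, ofReal_re, ofReal_re, zero_mul, zero_re]
  have hb : 0 ≤ bracketFull z ^ 10 := pow_nonneg (bracketFull_pos z).le 10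
  have := mul_nonneg hb h
  unfold weightOne weightTwo
  linarith

/-! ### Bounds for the quadratic form -/

/-- Bessel's inequality for two orthogonal vectors. -/
theorem normSq_sum_le_of_orthogonal {n : ℕ} {r e : Fin n → ℂ} (hr : 0 < vecNormSq r)
    (h : ∑ j, r j * e j = 0) (v : Fin n → ℂ) :
    normSq (∑ j, e j * v j) ≤ vecNormSq e *
      (vecNormSq v - normSq (∑ j, (starRingEnd ℂ) (r j) * v j) / vecNormSq r) := by
  have hs : (vecNormSq r : ℂ) ≠ 0 := by exact_mod_cast hr.ne'
  set c : ℂ := ∑ j, (starRingEnd ℂ) (r j) * v j with hc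
  -- Removing the component of v along r does not change the pairing with e; Cauchy–Schwarz for w is
  -- then the claim.
  set w : Fin n → ℂ := fun j => v j - c / vecNormSq r * r j with hw
  have h1 : ∑ j, e j * w j = ∑ j, e j * v j := by
    have : ∀ j, e j * w j = e j * v j - c / vecNormSq r * (r j * e j) := fun j => by
      simp only [hw]
      ring
    simp_rw [this]
    rw [Finset.sum_sub_distrib, ← Finset.mul_sum, h, mul_zero, sub_zero]
  have hcc : ∑ j, r j * (starRingEnd ℂ) (v j) = (starRingEnd ℂ) c := by
    rw [hc, map_sum]
    refine Finset.sum_congr rfl fun j _ => ?_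
    rw [map_mul, conj_conj]
  have h2 : vecNormSq w = vecNormSq v - normSq c / vecNormSq r := by
    have h3 : (vecNormSq w : ℂ) = ((vecNormSq v - normSq c / vecNormSq r : ℝ) : ℂ) := by
      rw [← sum_mul_conj_eq_vecNormSq w]
      have : ∀ j, w j * (starRingEnd ℂ) (w j) = v j * (starRingEnd ℂ) (v j) -
          (starRingEnd ℂ) c / vecNormSq r * ((starRingEnd ℂ) (r j) * v j) -
          c / vecNormSq r * (r j * (starRingEnd ℂ) (v j)) +
          c * (starRingEnd ℂ) c / (vecNormSq r * vecNormSq r) *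
            (r j * (starRingEnd ℂ) (r j)) := by
        intro j
        simp only [hw, map_sub, map_mul, map_div₀, conj_ofReal]
        field_simp
        ring
      simp_rw [this]
      rw [Finset.sum_add_distrib, Finset.sum_sub_distrib, Finset.sum_sub_distrib,
        ← Finset.mul_sum, ← Finset.mul_sum, ← Finset.mul_sum, sum_mul_conj_eq_vecNormSq,
        sum_mul_conj_eq_vecNormSq, hcc, ← hc]
      push_cast
      rw [← mul_conj c]
      field_simp
      ring
    exact_mod_cast h3
  have h4 : ∀ x : Fin n → ℂ, vecNormSq x = ‖(WithLp.toLp 2 x : Cn n)‖ ^ 2 := by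
    intro x
    rw [EuclideanSpace.norm_sq_eq]
    simp [vecNormSq, normSq_eq_norm_sq]
  rw [← h1, ← h2]
  have h5 := norm_inner_le_norm (𝕜 := ℂ)
    (WithLp.toLp 2 (fun j => (starRingEnd ℂ) (e j)) : Cn n) (WithLp.toLp 2 w : Cn n)
  have h6 : inner ℂ (WithLp.toLp 2 (fun j => (starRingEnd ℂ) (e j)) : Cn n)
      (WithLp.toLp 2 w : Cn n) = ∑ j, e j * w j := by
    rw [PiLp.inner_apply]
    refine Finset.sum_congr rfl fun j _ => ?_
    simp [mul_comm]
  have h7 : vecNormSq (fun j => (starRingEnd ℂ) (e j)) = vecNormSq e := by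
    simp [vecNormSq]
  rw [h6] at h5
  rw [← h7, h4 w, h4 fun j => (starRingEnd ℂ) (e j), normSq_eq_norm_sq, ← mul_pow]
  exact pow_le_pow_left₀ (norm_nonneg _) h5 2

/-- The quadratic form of a difference of tensors with the projection. -/
theorem sum_conj_projSub_mul {n : ℕ} (r : Fin n → ℂ) (M : Matrix (Fin n) (Fin n) ℂ)
    (v : Fin n → ℂ) :
    ∑ k, (starRingEnd ℂ) (v k) * ∑ j, projSub r M k j * v j =
      ((vecNormSq v - normSq (∑ j, (starRingEnd ℂ) (r j) * v j) / vecNormSq r : ℝ) : ℂ) -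
        ∑ k, (starRingEnd ℂ) (v k) * ∑ j, M k j * v j := by
  set c : ℂ := ∑ j, (starRingEnd ℂ) (r j) * v j with hc
  have h1 : ∀ k, ∑ j, projSub r M k j * v j =
      v k - r k * c / vecNormSq r - ∑ j, M k j * v j := by
    intro k
    have h2 : v k = ∑ j, (if k = j then v j else 0) := by simp
    rw [hc, Finset.mul_sum, Finset.sum_div]
    conv_rhs => rw [h2]
    rw [← Finset.sum_sub_distrib, ← Finset.sum_sub_distrib]
    refine Finset.sum_congr rfl fun j _ => ?_
    simp only [projSub, Matrix.of_apply]
    split_ifs <;> ring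
  have hcc : ∑ j, r j * (starRingEnd ℂ) (v j) = (starRingEnd ℂ) c := by
    rw [hc, map_sum]
    refine Finset.sum_congr rfl fun j _ => ?_
    rw [map_mul, conj_conj]
  have h3 : ∀ k, (starRingEnd ℂ) (v k) * ∑ j, projSub r M k j * v j =
      v k * (starRingEnd ℂ) (v k) - c / vecNormSq r * (r k * (starRingEnd ℂ) (v k)) -
        (starRingEnd ℂ) (v k) * ∑ j, M k j * v j := by
    intro k
    rw [h1]
    ring
  simp_rw [h3]
  rw [Finset.sum_sub_distrib, Finset.sum_sub_distrib, ← Finset.mul_sum, hcc,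
    sum_mul_conj_eq_vecNormSq]
  push_cast
  rw [← mul_conj c]
  ring

theorem sum_conj_positiveTensor_mul (z : Cn 3) (v : Fin 3 → ℂ) :
    ∑ k, (starRingEnd ℂ) (v k) * ∑ j, positiveTensor z k j * v j =
      ((bracketFull z ^ 10 *
        (weightOne z * normSq (∑ j, tangentFrame (exampleGrad z) 0 j * v j) +
          weightTwo z * normSq (∑ j, tangentFrame (exampleGrad z) 1 j * v j)) : ℝ) : ℂ) := by
  push_cast
  rw [← mul_conj, ← mul_conj]
  simp only [positiveTensor, Matrix.of_apply, Fin.sum_univ_three, map_add, map_mul]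
  push_cast
  ring

/-! ### Uniform smoothness of the tensors. -/

section Inverse

variable {E : Type*} [NormedAddCommGroup E] [NormedSpace ℝ E] {ι : Type*} [Fintype ι]

theorem closedUnderPartials_adjoin_inv {ℓ : ι → E →L[ℝ] ℝ} {S : Set (E → ℂ)} {h : E → ℂ}
    (hS : ClosedUnderPartials ℓ (Algebra.adjoin ℂ S : Set (E → ℂ)))
    (hh : h ∈ Algebra.adjoin ℂ S) (h0 : ∀ z, h z ≠ 0) :
    ClosedUnderPartials ℓ (Algebra.adjoin ℂ (insert h⁻¹ S) : Set (E → ℂ)) := by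
  obtain ⟨h', hh', hd⟩ := hS h hh
  have hinv : h⁻¹ ∈ Algebra.adjoin ℂ (insert h⁻¹ S) :=
    Algebra.subset_adjoin (Set.mem_insert _ _)
  exact closedUnderPartials_adjoin_insert hS (fun k => neg_mem (mul_mem (mul_mem hinv hinv)
    (Algebra.adjoin_mono (Set.subset_insert _ _) (hh' k)))) (hd.inv h0)

end Inverse

theorem conj_mem_bracketAlgebra {f : Cn 3 → ℂ} (hf : f ∈ bracketAlgebra) :
    (fun z => (starRingEnd ℂ) (f z)) ∈ bracketAlgebra := by
  induction hf using Algebra.adjoin_induction with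
  | mem g hg =>
    have : (fun z => (starRingEnd ℂ) (g z)) = g := by
      funext z
      rcases hg with (rfl | ⟨k, -, rfl⟩) | (rfl | ⟨k, -, rfl⟩) <;> simp
    rw [this]
    exact Algebra.subset_adjoin hg
  | algebraMap c => exact bracketAlgebra.algebraMap_mem ((starRingEnd ℂ) c)
  | add f g _ _ hf hg =>
    have := add_mem hf hg
    convert this using 1
    funext z
    simp
  | mul f g _ _ hf hg =>
    have := mul_mem hf hg
    convert this using 1
    funext z
    simp

theorem IsSymbol.conj {d e : ℕ} {f : Cn 3 → ℂ} (hf : IsSymbol d e f) :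
    IsSymbol d e (fun z => (starRingEnd ℂ) (f z)) := by
  refine IsSymbol.of_mem (conj_mem_bracketAlgebra hf) fun z => ?_
  simp

theorem IsSymbol.congr {d e d' e' : ℕ} {f f' : Cn 3 → ℂ} (hf : IsSymbol d e f) (hd : d = d')
    (he : e = e') (h : ∀ z, f' z = f z) : IsSymbol d' e' f' := by
  rw [← hd, ← he, funext h]
  exact hf

theorem isSymbol_exampleGrad : ∀ j : Fin 3, IsSymbol 0 5 (fun z => exampleGrad z j)
  | 0 => ((isSymbol_polyFx.sub (isSymbol_polyFy.const_mul I)).const_mul (1 / 2)).congr rfl rfl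
      fun _ => rfl
  | 1 => (((isSymbol_re'.sub (isSymbol_im'.const_mul I)).const_mul (1 / 2)).mul
      isSymbol_polyFw).congr rfl rfl fun _ => rfl
  | 2 => ((isSymbol_const (I / 2)).mono (Nat.zero_le 0) (Nat.zero_le 5)).congr rfl rfl fun _ => rfl

theorem isSymbol_exampleGrad_one_part : IsSymbol 5 2 (fun z => exampleGrad z 1) :=
  ((((isSymbol_realCoord_part (k := 2) (by decide)).sub
    ((isSymbol_realCoord_part (k := 3) (by decide)).const_mul I)).const_mul (1 / 2)).mul
      isSymbol_polyFw_part).congr rfl rfl fun _ => rfl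

theorem isSymbol_const_of_le (c : ℂ) (d e : ℕ) : IsSymbol d e (fun _ => c) :=
  (isSymbol_const c).mono (Nat.zero_le d) (Nat.zero_le e)

theorem isSymbol_tangentFrame_zero :
    ∀ j : Fin 3, IsSymbol 0 5 (fun z => tangentFrame (exampleGrad z) 0 j)
  | 0 => (isSymbol_const_of_le 1 0 5).congr rfl rfl fun _ => rfl
  | 1 => (isSymbol_const_of_le 0 0 5).congr rfl rfl fun _ => rfl
  | 2 => ((isSymbol_exampleGrad 0).const_mul (2 * I)).congr rfl rfl tangentFrame_zero_two

theorem isSymbol_tangentFrame_one :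
    ∀ j : Fin 3, IsSymbol 0 5 (fun z => tangentFrame (exampleGrad z) 1 j)
  | 0 => (isSymbol_const_of_le 0 0 5).congr rfl rfl fun _ => rfl
  | 1 => (isSymbol_const_of_le 1 0 5).congr rfl rfl fun _ => rfl
  | 2 => ((isSymbol_exampleGrad 1).const_mul (2 * I)).congr rfl rfl tangentFrame_one_two

theorem isSymbol_tangentFrame_one_part :
    ∀ j : Fin 3, IsSymbol 5 2 (fun z => tangentFrame (exampleGrad z) 1 j)
  | 0 => (isSymbol_const_of_le 0 5 2).congr rfl rfl fun _ => rfl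
  | 1 => (isSymbol_const_of_le 1 5 2).congr rfl rfl fun _ => rfl
  | 2 => (isSymbol_exampleGrad_one_part.const_mul (2 * I)).congr rfl rfl tangentFrame_one_two

/-- The tenth power of the full bracket absorbs two frame vectors of order five, but not the factor
y² of the second weight. There the fifth power of (1 + s)⁻¹ absorbs the growth in x and z₂, and
order 2 + 2 · 2 = 6 in the full bracket remains. The factors s² in the weights are absorbed by their
own powers of (1 + s)⁻¹. -/
theorem positiveTensor_mem (k j : Fin 3) :
    (fun z => positiveTensor z k j) ∈ bracketAlgebra := by
  have h0 := (isSymbol_tangentFrame_zero k).conj.mul (isSymbol_tangentFrame_zero j)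
  have h1 := (isSymbol_tangentFrame_one k).conj.mul (isSymbol_tangentFrame_one j)
  have h2 := ((isSymbol_im.pow 2).mul ((isSymbol_tangentFrame_one_part k).conj.mul
    (isSymbol_tangentFrame_one_part j))).mono (d' := 10) (e' := 10) (by norm_num) (by norm_num)
  have hS := isSymbol_polyS_part.pow 2
  have hσ := pow_mem bracketPart_mem 10
  have h := add_mem (add_mem (bracketAlgebra.smul_mem (mul_mem hσ h0) 2)
    (bracketAlgebra.smul_mem h2 3))
    (bracketAlgebra.smul_mem (add_mem (hS.mul h0) (hS.mul h1)) (1 / 64))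
  convert h using 1
  funext z
  simp only [positiveTensor, Matrix.of_apply, weightOne, weightTwo, Pi.add_apply, Pi.mul_apply,
    Pi.smul_apply, Pi.pow_apply, smul_eq_mul]
  push_cast
  ring

/-- The squared length of the complex gradient, normalized to be bounded. -/
def normalizedNormSq (z : Cn 3) : ℂ := (vecNormSq (exampleGrad z) : ℂ) * (bracketFull z : ℂ) ^ 10

theorem normalizedNormSq_mem : normalizedNormSq ∈ bracketAlgebra := by
  have hj := fun j => (isSymbol_exampleGrad j).mul (isSymbol_exampleGrad j).conj
  have h := ((hj 0).add (hj 1)).add (hj 2)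
  rw [IsSymbol] at h
  convert h using 1
  funext z
  rw [normalizedNormSq, ← sum_mul_conj_eq_vecNormSq, Fin.sum_univ_three, pow_zero, mul_one]

theorem exists_normalizedNormSq_lower : ∃ c : ℝ, 0 < c ∧ ∀ z, c ≤ ‖normalizedNormSq z‖ := by
  obtain ⟨c, hc, h⟩ := exists_polyGradSq_lower
  refine ⟨c / 4, by positivity, fun z => ?_⟩
  have hb := (bracketFull_pos z).le
  have h1 := mul_le_mul_of_nonneg_right (h (z 0).re (z 0).im (z 1).re (z 1).im) (pow_nonneg hb 10)
  rw [← vecNormSq_exampleGrad] at h1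
  have h2 : (1 + ((z 0).re ^ 2 + (z 0).im ^ 2 + (z 1).re ^ 2 + (z 1).im ^ 2)) ^ 5 *
      bracketFull z ^ 10 = 1 := by
    have := congrArg (· ^ 5) (bracketFull_sq z)
    simp only [mul_pow] at this
    linear_combination this
  rw [mul_assoc, h2] at h1
  have h3 : normalizedNormSq z = ((vecNormSq (exampleGrad z) * bracketFull z ^ 10 : ℝ) : ℂ) := by
    rw [normalizedNormSq]
    push_cast
    rfl
  rw [h3, norm_real, Real.norm_of_nonneg
    (mul_nonneg (vecNormSq_exampleGrad_pos z).le (pow_nonneg hb 10))]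
  linarith

/-- The algebra generated by `bracketAlgebra` and the inverse of `normalizedNormSq`. -/
def gradAlgebra : Subalgebra ℂ (Cn 3 → ℂ) :=
  Algebra.adjoin ℂ (insert normalizedNormSq⁻¹ (bracketGenerators realCoord {0, 1, 2, 3} ∪
    bracketGenerators realCoord {0, 2, 3}))

theorem normalizedNormSq_ne_zero (z : Cn 3) : normalizedNormSq z ≠ 0 := by
  obtain ⟨c, hc, h⟩ := exists_normalizedNormSq_lower
  exact norm_pos_iff.mp (hc.trans_le (h z))

theorem hasFiniteCmNorm_of_mem_gradAlgebra {g : Cn 3 → ℂ} (hg : g ∈ gradAlgebra) :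
    HasFiniteCmNorm ⊤ g Set.univ := by
  refine hasFiniteCmNorm_of_mem (closedUnderPartials_adjoin_inv closedUnderPartials_bracketAlgebra
    normalizedNormSq_mem normalizedNormSq_ne_zero) (bounded_adjoin ?_) hg
  rintro g (rfl | hg)
  · obtain ⟨c, hc, h⟩ := exists_normalizedNormSq_lower
    refine ⟨c⁻¹, fun z _ => ?_⟩
    rw [Pi.inv_apply, norm_inv]
    exact inv_anti₀ hc (h z)
  · exact bounded_bracketGenerators _ g hg

theorem bracketAlgebra_le_gradAlgebra : bracketAlgebra ≤ gradAlgebra :=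
  Algebra.adjoin_mono (Set.subset_insert _ _)

/-- Numerator and denominator of the projection are both multiplied by the tenth power of the
bracket; the denominator becomes `normalizedNormSq`, which is bounded away from zero. -/
theorem projSub_mem_gradAlgebra (ε : ℂ) (k j : Fin 3) :
    (fun z => projSub (exampleGrad z) (ε • positiveTensor z) k j) ∈ gradAlgebra := by
  have h1 : normalizedNormSq⁻¹ ∈ gradAlgebra := Algebra.subset_adjoin (Set.mem_insert _ _)
  have h2 := bracketAlgebra_le_gradAlgebra
    ((isSymbol_exampleGrad k).mul (isSymbol_exampleGrad j).conj)
  have h3 := bracketAlgebra_le_gradAlgebra (positiveTensor_mem k j)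
  have h := sub_mem (sub_mem (gradAlgebra.algebraMap_mem (if k = j then 1 else 0))
    (mul_mem h2 h1)) (gradAlgebra.smul_mem h3 ε)
  convert h using 1
  funext z
  have hb : (bracketFull z : ℂ) ≠ 0 := by exact_mod_cast (bracketFull_pos z).ne'
  have hr : (vecNormSq (exampleGrad z) : ℂ) ≠ 0 := by
    exact_mod_cast (vecNormSq_exampleGrad_pos z).ne'
  simp only [projSub, Matrix.of_apply, Matrix.smul_apply, Pi.sub_apply, Pi.mul_apply,
    Pi.smul_apply, Pi.inv_apply, smul_eq_mul, normalizedNormSq, Pi.algebraMap_apply,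
    Algebra.algebraMap_self, RingHom.id_apply]
  congr 2
  field_simp
  simp

theorem exists_tensorTrace_upper : ∃ C : ℝ, 0 < C ∧ ∀ z, tensorTrace z ≤ C := by
  have h := add_mem (add_mem (positiveTensor_mem 0 0) (positiveTensor_mem 1 1))
    (positiveTensor_mem 2 2)
  obtain ⟨C, hC⟩ := bounded_bracketAlgebra Set.univ _ h
  refine ⟨max C 1, by positivity, fun z => ?_⟩
  have h1 := hC z trivial
  have h2 := trace_positiveTensor z
  rw [Matrix.trace, Fin.sum_univ_three] at h2
  simp only [Pi.add_apply] at h1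
  simp only [Matrix.diag_apply] at h2
  rw [h2, norm_real] at h1
  exact (le_abs_self _).trans (h1.trans (le_max_left _ _))

/-! ### Admissibility. -/

/-- The tensor for which `exampleDomain` satisfies `Z(2)` weakly. -/
def exampleTensor (ε : ℝ) (z : Cn 3) : Matrix (Fin 3) (Fin 3) ℂ :=
  projSub (exampleGrad z) ((ε : ℂ) • positiveTensor z)

theorem isHermitian_smul_positiveTensor (ε : ℝ) (z : Cn 3) :
    ((ε : ℂ) • positiveTensor z).IsHermitian := by
  have h := isHermitian_positiveTensor z
  rw [Matrix.IsHermitian] at h ⊢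
  rw [Matrix.conjTranspose_smul, h]
  simp

theorem isHermitian_exampleTensor (ε : ℝ) (z : Cn 3) : (exampleTensor ε z).IsHermitian :=
  isHermitian_projSub (isHermitian_smul_positiveTensor ε z)

theorem sum_exampleTensor_mul (ε : ℝ) (z : Cn 3) (k : Fin 3) :
    ∑ j, exampleTensor ε z k j * exampleGrad z j = 0 := by
  refine sum_projSub_mul (vecNormSq_exampleGrad_pos z) (fun i => ?_) k
  simp_rw [Matrix.smul_apply, smul_eq_mul, mul_assoc]
  rw [← Finset.mul_sum, sum_positiveTensor_mul, mul_zero]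

/-- `projSub` is an involution in its second argument, so the weak Z(2) inequality for
`exampleTensor` is the one already proved for `positiveTensor`. -/
theorem projSub_exampleTensor (ε : ℝ) (z : Cn 3) :
    projSub (exampleGrad z) (exampleTensor ε z) = (ε : ℂ) • positiveTensor z := by
  ext k j
  simp [exampleTensor, projSub]

theorem trace_exampleTensor (ε : ℝ) (z : Cn 3) :
    (exampleTensor ε z).trace = 2 - ε * tensorTrace z := by
  rw [exampleTensor, trace_projSub (vecNormSq_exampleGrad_pos z), Matrix.trace_smul,
    trace_positiveTensor, smul_eq_mul]

/-- The form is t₀ - εp, where t₀ ≤ |v|² is the squared length of the projection of v and p ≥ 0 is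
the form of the positive tensor. Bessel's inequality gives p ≤ `tensorTrace` · t₀, so the smallness
of ε keeps the difference nonnegative. -/
theorem sum_conj_exampleTensor_mul_mem {ε : ℝ} (hε : 0 ≤ ε) {z : Cn 3}
    (hz : ε * tensorTrace z ≤ 1) (v : Fin 3 → ℂ) :
    ∃ t : ℝ, 0 ≤ t ∧ t ≤ vecNormSq v ∧
      ∑ k, (starRingEnd ℂ) (v k) * ∑ j, exampleTensor ε z k j * v j = t := by
  set t₀ := vecNormSq v - normSq (∑ j, (starRingEnd ℂ) (exampleGrad z j) * v j) /
    vecNormSq (exampleGrad z) with ht₀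
  set p := bracketFull z ^ 10 *
        (weightOne z * normSq (∑ j, tangentFrame (exampleGrad z) 0 j * v j) +
          weightTwo z * normSq (∑ j, tangentFrame (exampleGrad z) 1 j * v j)) with hp
  have hb : 0 ≤ bracketFull z ^ 10 := pow_nonneg (bracketFull_pos z).le 10
  have hw1 := weightOne_nonneg z
  have hw2 := weightTwo_nonneg z
  have hp0 : 0 ≤ p := mul_nonneg hb (add_nonneg (mul_nonneg hw1 (normSq_nonneg _))
    (mul_nonneg hw2 (normSq_nonneg _)))
  have hpos := vecNormSq_exampleGrad_pos z
  have hB : ∀ a, _ := fun a => normSq_sum_le_of_orthogonal hpos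
    (sum_mul_tangentFrame (exampleGrad_two_ne_zero z) a) v
  have hpt : p ≤ tensorTrace z * t₀ := by
    have h0 := mul_le_mul_of_nonneg_left (hB 0) hw1
    have h1 := mul_le_mul_of_nonneg_left (hB 1) hw2
    have := mul_le_mul_of_nonneg_left (add_le_add h0 h1) hb
    refine this.trans_eq ?_
    rw [tensorTrace]
    ring
  have ht0 : 0 ≤ t₀ := by
    have h0 := (normSq_nonneg _).trans (hB 0)
    refine nonneg_of_mul_nonneg_right h0 ?_
    rw [vecNormSq_tangentFrame_zero]
    positivity
  have ht1 : t₀ ≤ vecNormSq v := by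
    have : 0 ≤ normSq (∑ j, (starRingEnd ℂ) (exampleGrad z j) * v j) /
      vecNormSq (exampleGrad z) := div_nonneg (normSq_nonneg _) hpos.le
    linarith
  refine ⟨t₀ - ε * p, ?_, ?_, ?_⟩
  · have h1 := mul_le_mul_of_nonneg_left hpt hε
    have h2 := mul_le_mul_of_nonneg_right hz ht0
    nlinarith
  · have := mul_nonneg hε hp0
    linarith
  · rw [exampleTensor, sum_conj_projSub_mul]
    have h := sum_conj_positiveTensor_mul z v
    have h2 : ∑ k, (starRingEnd ℂ) (v k) * ∑ j, ((ε : ℂ) • positiveTensor z) k j * v j =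
        ε * ∑ k, (starRingEnd ℂ) (v k) * ∑ j, positiveTensor z k j * v j := by
      simp_rw [Matrix.smul_apply, smul_eq_mul, Finset.mul_sum]
      refine Finset.sum_congr rfl fun k _ => Finset.sum_congr rfl fun j _ => ?_
      ring
    rw [h2, h]
    rw [ht₀, hp]
    push_cast
    rfl

theorem eigenvalues_exampleTensor_mem {ε : ℝ} (hε : 0 ≤ ε) {z : Cn 3}
    (hz : ε * tensorTrace z ≤ 1) (i : Fin 3) :
    (isHermitian_exampleTensor ε z).eigenvalues i ∈ Set.Icc (0 : ℝ) 1 := by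
  set h := isHermitian_exampleTensor ε z
  obtain ⟨t, h0, h1, ht⟩ := sum_conj_exampleTensor_mul_mem hε hz (h.eigenvectorBasis i)
  have hev := h.mulVec_eigenvectorBasis i
  have hn : vecNormSq (h.eigenvectorBasis i) = 1 := by
    have := EuclideanSpace.norm_sq_eq (h.eigenvectorBasis i)
    rw [h.eigenvectorBasis.norm_eq_one i] at this
    simp only [vecNormSq, normSq_eq_norm_sq]
    linarith
  have hk : ∀ k, ∑ j, exampleTensor ε z k j * h.eigenvectorBasis i j =
      h.eigenvalues i * h.eigenvectorBasis i k := by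
    intro k
    have := congrFun hev k
    simpa [Matrix.mulVec, dotProduct] using this
  have hs := sum_mul_conj_eq_vecNormSq (h.eigenvectorBasis i)
  rw [hn] at hs
  have ht' : (t : ℂ) = h.eigenvalues i := by
    rw [← ht]
    simp_rw [hk]
    calc _ = (h.eigenvalues i : ℂ) * ∑ k, h.eigenvectorBasis i k *
          (starRingEnd ℂ) (h.eigenvectorBasis i k) := by
          rw [Finset.mul_sum]
          exact Finset.sum_congr rfl fun k _ => by ring
      _ = _ := by rw [hs]; simp
  rw [← ofReal_injective ht']
  exact ⟨h0, hn ▸ h1⟩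

theorem isUniformNhd_univ {n : ℕ} (S : Set (Cn n)) : IsUniformNhd Set.univ S :=
  ⟨isOpen_univ, Set.subset_univ S, 1, one_pos, fun p _ q hq => by simp at hq⟩

theorem isAdmissible_exampleTensor {ρ : Cn 3 → ℝ}
    (hρ : IsUniformDefiningFunction ⊤ exampleDomain ρ) {ε : ℝ} (hε : 0 < ε)
    (hz : ∀ z, ε * tensorTrace z ≤ 1) :
    IsAdmissible ⊤ 2 exampleDomain ρ (exampleTensor ε) where
  uniformly_bounded k j := ⟨Set.univ, _, isUniformNhd_univ _,
    hasFiniteCmNorm_of_mem_gradAlgebra (projSub_mem_gradAlgebra ε k j), fun _ _ => rfl⟩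
  tangential z hz k := by
    obtain ⟨κ, -, hgrad, -⟩ := hρ.exists_factor le_top hz
    simp_rw [hgrad, mul_left_comm _ (κ : ℂ)]
    rw [← Finset.mul_sum, sum_exampleTensor_mul, mul_zero]
  hermitian_eigenvalues z _ :=
    ⟨isHermitian_exampleTensor ε z, eigenvalues_exampleTensor_mem hε.le (hz z)⟩
  levi_nonneg z hz := by
    obtain ⟨κ, hκ, hgrad, hlevi⟩ := hρ.exists_factor le_top hz
    obtain ⟨μ, hμ⟩ := hρ.exists_isLeviEigenvalues le_top hz
    refine ⟨μ, hμ, ?_⟩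
    rw [hμ.sum_sub_eq hκ hgrad hlevi (isHermitian_exampleTensor ε z) (sum_exampleTensor_mul ε z),
      projSub_exampleTensor]
    have h : ∑ j, ∑ k, ((ε : ℂ) • positiveTensor z) k j * exampleHess z j k =
        ε * ∑ j, ∑ k, positiveTensor z k j * exampleHess z j k := by
      simp_rw [Matrix.smul_apply, smul_eq_mul, Finset.mul_sum, mul_assoc]
    rw [h, re_ofReal_mul]
    exact mul_nonneg hκ.le (mul_nonneg hε.le (re_sum_positiveTensor_nonneg z))
  trace_ne := by
    obtain ⟨c, hc, h⟩ := exists_tensorTrace_lower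
    refine ⟨ε * c, mul_pos hε hc, fun z _ => ?_⟩
    have h1 : ((2 : ℕ) : ℂ) - (exampleTensor ε z).trace = ((ε * tensorTrace z : ℝ) : ℂ) := by
      rw [trace_exampleTensor]
      push_cast
      ring
    rw [h1, norm_real]
    exact (mul_le_mul_of_nonneg_left (h z) hε.le).trans (le_abs_self _)

theorem weakZ_exampleDomain : WeakZ ⊤ 2 exampleDomain := by
  obtain ⟨C, hC, h⟩ := exists_tensorTrace_upper
  -- The factor C⁻¹ makes ε · `tensorTrace` ≤ 1, as needed for eigenvalues in [0, 1]. The lower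
  -- bound for `tensorTrace` keeps the trace of Υ away from 2.
  refine ⟨normalizedFun, isUniformDefiningFunction_normalizedFun, exampleTensor C⁻¹,
    isAdmissible_exampleTensor isUniformDefiningFunction_normalizedFun (inv_pos.mpr hC)
      fun z => ?_⟩
  rw [inv_mul_le_iff₀ hC, mul_one]
  exact h z

end

theorem mainTheorem5 :
    -- the example is a domain
    (IsOpen exampleDomain ∧ IsConnected exampleDomain) ∧
    -- it has a uniformly smooth defining function and satisfies weak `Z(2)`
    WeakZ ⊤ 2 exampleDomain ∧
    -- for a closed unbounded set `K` in the boundary, every admissible `Υ` has exactly one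
    -- eigenvalue equal to one on `K`, but none at some points of every neighborhood of `K`
    (∃ K : Set (Cn 3), K ⊆ frontier exampleDomain ∧ IsClosed K ∧ ¬ Bornology.IsBounded K ∧
      ∀ (m : ℕ∞), 2 ≤ m → ∀ (ρ : Cn 3 → ℝ), IsUniformDefiningFunction m exampleDomain ρ →
        ∀ (Υ : Cn 3 → Matrix (Fin 3) (Fin 3) ℂ), IsAdmissible m 2 exampleDomain ρ Υ →
          (∀ z ∈ K,
            Module.finrank ℂ (Module.End.eigenspace (Matrix.toLin' (Υ z)) 1) = 1) ∧
          ∀ V : Set (Cn 3), IsOpen V → K ⊆ V →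
            ∃ z ∈ V ∩ frontier exampleDomain,
              ¬ Module.End.HasEigenvalue (Matrix.toLin' (Υ z)) 1) ∧
    -- the domain is not `1`-pseudoconvex
    ∀ m : ℕ∞, 2 ≤ m → ¬ IsOnePseudoconvex m exampleDomain :=
  ⟨⟨isOpen_exampleDomain, isConnected_exampleDomain⟩, weakZ_exampleDomain,
    ⟨criticalLine, criticalLine_subset_frontier, isClosed_criticalLine, not_isBounded_criticalLine,
      fun _ hm _ hρ _ hΥ => ⟨fun _ hz => hΥ.finrank_eigenspace hm hρ hz,
        fun _ hV hKV => exists_not_hasEigenvalue_one hm hρ hΥ hV hKV⟩⟩,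
    fun _ hm => not_isOnePseudoconvex_example hm⟩
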